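/- Let $K$ be a number field of degree $d=[K:\mathbb{Q}]$ with $r_1$ real and $r_2$ complex places, ring of integers $\mathcal{O}_K$, discriminant $\Delta_K$, class number $h_K$, regulator $R_K$, number of roots of unity $\varpi_K$, and Dedekind zeta function $\zeta_K$. For a finite place $v$ let $v(\cdot)$ be the normalized discrete valuation (with $v(0)=\infty$) and $q_v$ the cardinality of the residue field; for an infinite place $v$ let $|\cdot|_v$ be the normalized absolute value (the square of the usual one if $v$ is complex). The naive height of an elliptic curve $E$ over $K$ is defined, using any short Weierstrass equation $y^2=x^3+ax+b$ of $E$ with $a,b\in K$, by \[ \mathrm{Ht}(E)=\mathrm{Ht}_{(4,6)}([a:b])^{12},\qquad \mathrm{Ht}_{(4,6)}([a:b])=\prod_{v\nmid\infty}\max\left\{q_v^{-\lfloor v(a)/4\rfloor},\,q_v^{-\lfloor v(b)/6\rfloor}\right\}\prod_{v\mid\infty}\max\left\{|a|_v^{1/4},\,|b|_v^{1/6}\right\}, \] where $q_v^{-\infty}=0$; it depends only on the $K$-isomorphism class of $E$. For real $B$ let $\mathcal{E}_K(B)$ be the set of $K$-isomorphism classes of elliptic curves over $K$ with naive height less than $B$.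 Then $\mathcal{E}_K(B)$ is finite for every $B$, and for all $B\ge 1$ \[ \#\mathcal{E}_K(B)=\kappa B^{5/6}+O\left(B^{\frac56-\frac1{3d}}\right), \qquad \kappa=\frac{h_K\left(2^{r_1+r_2}\pi^{r_2}\right)^{2}R_K\,10^{r_1+r_2-1}\gcd(2,\varpi_K)}{\varpi_K\,|\Delta_K|\,\zeta_K(10)}, \] where the implied constant depends only on $K$. -/

import Mathlib

open NumberField IsDedekindDomain

noncomputable section

namespace EllipticCount

variable {K : Type*} [Field K] [NumberField K]

/-- The normalized discrete valuation `v(x)` of `x` at a finite place `v`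
(only used for `x ≠ 0`; at `x = 0` it has the junk value `0`). -/
def ord (v : HeightOneSpectrum (𝓞 K)) (x : K) : ℤ :=
  -WithZero.log (v.valuation K x)

/-- The weighted size `|π_v|_v ^ ⌊v(x) / w⌋` of a coordinate `x` of weight `w` at a finite place
`v`, where `|π_v|_v = N(v)⁻¹`; it is `0` for `x = 0`, as `v(0) = ∞`.
Division of integers by a positive integer is the floor of the quotient. -/
def finiteSize (v : HeightOneSpectrum (𝓞 K)) (w : ℕ) (x : K) : ℝ :=
  open scoped Classical in
  if x = 0 then 0 else ((Ideal.absNorm v.asIdeal : ℝ)⁻¹) ^ (ord v x / (w : ℤ))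

/-- The size `|x|_v ^ (1 / w)` of a coordinate `x` of weight `w` at an infinite place `v`, where
`|x|_v` is the normalized absolute value (the square of the usual one if `v` is complex). -/
def infiniteSize (v : InfinitePlace K) (w : ℕ) (x : K) : ℝ :=
  (v x ^ v.mult) ^ (1 / (w : ℝ))

/-- The height of the point `[a : b]` of the weighted projective line `ℙ(w₀, w₁)` over `K`
with respect to the tautological bundle. -/
def weightedHeight (w₀ w₁ : ℕ) (a b : K) : ℝ :=
  (∏ᶠ v : HeightOneSpectrum (𝓞 K), max (finiteSize v w₀ a) (finiteSize v w₁ b)) *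
    ∏ v : InfinitePlace K, max (infiniteSize v w₀ a) (infiniteSize v w₁ b)

/-- The naive height of an elliptic curve. Every Weierstrass curve over `K` is isomorphic to the
short Weierstrass curve `y² = x³ + a x + b` with `a = -c₄ / 48` and `b = -c₆ / 864`, and the naive
height is the twelfth power of the height of `[a : b]` in `ℙ(4, 6)`. -/
def naiveHeight (W : WeierstrassCurve K) : ℝ :=
  weightedHeight 4 6 (-W.c₄ / 48) (-W.c₆ / 864) ^ 12

/-- For a curve that is already in short form, the naive height can be read off its coefficients. -/
theorem naiveHeight_of_isShortNF (W : WeierstrassCurve K) [W.IsShortNF] :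
    naiveHeight W = weightedHeight 4 6 W.a₄ W.a₆ ^ 12 := by
  have h4 : -W.c₄ / 48 = W.a₄ := by rw [W.c₄_of_isShortNF]; ring
  have h6 : -W.c₆ / 864 = W.a₆ := by rw [W.c₆_of_isShortNF]; ring
  rw [naiveHeight, h4, h6]

theorem adicAbv_eq (v : HeightOneSpectrum (𝓞 K)) {x : K} (hx : x ≠ 0) :
    HeightOneSpectrum.adicAbv K v x = ((Ideal.absNorm v.asIdeal : ℝ)⁻¹) ^ ord v x := by
  have h : v.valuation K x ≠ 0 := (Valuation.ne_zero_iff _).2 hx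
  rw [HeightOneSpectrum.adicAbv_def, WithZeroMulInt.toNNReal_neg_apply _ h,
    WithZero.toAdd_unzero_eq_log, ord]
  push_cast
  rw [inv_zpow', neg_neg]

theorem ord_mul (v : HeightOneSpectrum (𝓞 K)) {x y : K} (hx : x ≠ 0) (hy : y ≠ 0) :
    ord v (x * y) = ord v x + ord v y := by
  rw [ord, map_mul, WithZero.log_mul ((Valuation.ne_zero_iff _).2 hx)
    ((Valuation.ne_zero_iff _).2 hy), ord, ord]
  ring

theorem ord_pow (v : HeightOneSpectrum (𝓞 K)) (x : K) (n : ℕ) : ord v (x ^ n) = n * ord v x := by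
  rw [ord, map_pow, WithZero.log_pow, ord]
  simp

theorem finiteSize_smul (v : HeightOneSpectrum (𝓞 K)) {w : ℕ} (hw : 0 < w) {t : K} (ht : t ≠ 0)
    (x : K) :
    finiteSize v w (t ^ w * x) = HeightOneSpectrum.adicAbv K v t * finiteSize v w x := by
  by_cases hx : x = 0
  · simp [finiteSize, hx]
  have hN : ((Ideal.absNorm v.asIdeal : ℝ)⁻¹) ≠ 0 := by
    have := HeightOneSpectrum.one_lt_absNorm v
    positivity
  have hw' : (w : ℤ) ≠ 0 := by exact_mod_cast hw.ne'
  rw [finiteSize, finiteSize, if_neg hx, if_neg (mul_ne_zero (pow_ne_zero _ ht) hx),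
    adicAbv_eq v ht, ← zpow_add₀ hN, ord_mul v (pow_ne_zero _ ht) hx, ord_pow,
    Int.add_ediv_of_dvd_left (dvd_mul_right _ _), Int.mul_ediv_cancel_left _ hw']

theorem infiniteSize_smul (v : InfinitePlace K) {w : ℕ} (hw : 0 < w) (t x : K) :
    infiniteSize v w (t ^ w * x) = v t ^ v.mult * infiniteSize v w x := by
  have h0 : 0 ≤ v t ^ v.mult := by positivity
  have hx : 0 ≤ v x ^ v.mult := by positivity
  rw [infiniteSize, infiniteSize, map_mul, map_pow, mul_pow, ← pow_mul, mul_comm w, pow_mul,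
    Real.mul_rpow (by positivity) hx, one_div, Real.pow_rpow_inv_natCast h0 hw.ne']

theorem finite_adicAbv_ne_one {x : K} (hx : x ≠ 0) :
    {v : HeightOneSpectrum (𝓞 K) | HeightOneSpectrum.adicAbv K v x ≠ 1}.Finite := by
  have h := FinitePlace.hasFiniteMulSupport hx
  refine (Set.Finite.preimage
    (FinitePlace.equivHeightOneSpectrum (K := K)).symm.injective.injOn h).subset ?_
  intro v hv
  simpa [FinitePlace.equivHeightOneSpectrum_symm_apply, FinitePlace.norm_embedding] using hv

theorem finprod_adicAbv (x : K) :
    ∏ᶠ v : HeightOneSpectrum (𝓞 K), HeightOneSpectrum.adicAbv K v x =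
      ∏ᶠ w : FinitePlace K, w x := by
  rw [← finprod_comp_equiv FinitePlace.equivHeightOneSpectrum.symm]
  simp [FinitePlace.equivHeightOneSpectrum_symm_apply, FinitePlace.norm_embedding]

theorem finiteSize_eq_one (v : HeightOneSpectrum (𝓞 K)) (w : ℕ) {x : K} (hx : x ≠ 0)
    (h : HeightOneSpectrum.adicAbv K v x = 1) : finiteSize v w x = 1 := by
  have hN := HeightOneSpectrum.one_lt_absNorm v
  have hN' : (1 : ℝ) < Ideal.absNorm v.asIdeal := by exact_mod_cast hN
  rw [adicAbv_eq v hx, zpow_eq_one_iff_right₀ (by positivity) (inv_lt_one_of_one_lt₀ hN').ne] at h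
  simp [finiteSize, hx, h]

theorem finite_max_ne_one (w₀ w₁ : ℕ) {a b : K} (hab : a ≠ 0 ∨ b ≠ 0) :
    {v : HeightOneSpectrum (𝓞 K) |
      max (finiteSize v w₀ a) (finiteSize v w₁ b) ≠ 1}.Finite := by
  by_cases ha : a = 0
  · have hb : b ≠ 0 := by tauto
    refine (finite_adicAbv_ne_one hb).subset fun v hv h => hv ?_
    rw [finiteSize_eq_one v w₁ hb h]
    simp [finiteSize, ha]
  by_cases hb : b = 0
  · refine (finite_adicAbv_ne_one ha).subset fun v hv h => hv ?_
    rw [finiteSize_eq_one v w₀ ha h]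
    simp [finiteSize, hb]
  refine ((finite_adicAbv_ne_one ha).union (finite_adicAbv_ne_one hb)).subset fun v hv => ?_
  by_contra h
  simp only [Set.mem_union, Set.mem_ofPred_eq, not_or, not_not] at h
  exact hv (by rw [finiteSize_eq_one v w₀ ha h.1, finiteSize_eq_one v w₁ hb h.2, max_self])

/-- The weighted height depends only on the point `[a : b]` of the weighted projective line. -/
theorem weightedHeight_smul {w₀ w₁ : ℕ} (h₀ : 0 < w₀) (h₁ : 0 < w₁) {t : K} (ht : t ≠ 0)
    (a b : K) :
    weightedHeight w₀ w₁ (t ^ w₀ * a) (t ^ w₁ * b) = weightedHeight w₀ w₁ a b := by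
  by_cases hab : a ≠ 0 ∨ b ≠ 0
  · simp only [weightedHeight, finiteSize_smul _ h₀ ht, finiteSize_smul _ h₁ ht,
      infiniteSize_smul _ h₀, infiniteSize_smul _ h₁]
    have e1 : ∀ v : HeightOneSpectrum (𝓞 K),
        max (HeightOneSpectrum.adicAbv K v t * finiteSize v w₀ a)
          (HeightOneSpectrum.adicAbv K v t * finiteSize v w₁ b) =
        HeightOneSpectrum.adicAbv K v t * max (finiteSize v w₀ a) (finiteSize v w₁ b) :=
      fun v => (mul_max_of_nonneg _ _ (AbsoluteValue.nonneg _ _)).symm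
    have e2 : ∀ v : InfinitePlace K,
        max (v t ^ v.mult * infiniteSize v w₀ a) (v t ^ v.mult * infiniteSize v w₁ b) =
        v t ^ v.mult * max (infiniteSize v w₀ a) (infiniteSize v w₁ b) :=
      fun v => (mul_max_of_nonneg _ _ (by positivity)).symm
    simp only [e1, e2]
    rw [finprod_mul_distrib (finite_adicAbv_ne_one ht) (finite_max_ne_one w₀ w₁ hab),
      Finset.prod_mul_distrib, finprod_adicAbv]
    linear_combination (∏ᶠ v : HeightOneSpectrum (𝓞 K),
      max (finiteSize v w₀ a) (finiteSize v w₁ b)) *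
      (∏ v : InfinitePlace K, max (infiniteSize v w₀ a) (infiniteSize v w₁ b)) *
      prod_abs_eq_one ht
  · push Not at hab
    simp [hab.1, hab.2]

/-- The naive height is invariant under isomorphisms. -/
theorem naiveHeight_variableChange (C : WeierstrassCurve.VariableChange K)
    (W : WeierstrassCurve K) : naiveHeight (C • W) = naiveHeight W := by
  have ht : ((C.u⁻¹ : Kˣ) : K) ≠ 0 := Units.ne_zero _
  rw [naiveHeight, naiveHeight, W.variableChange_c₄, W.variableChange_c₆,
    ← weightedHeight_smul (w₀ := 4) (w₁ := 6) (by norm_num) (by norm_num) ht (-W.c₄ / 48)]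
  congr 2 <;> ring

variable (K)

/-- Elliptic curves over `K`, given by Weierstrass equations. -/
def EllipticCurve : Type _ := {W : WeierstrassCurve K // W.IsElliptic}

/-- Two elliptic curves over `K` are isomorphic over `K` if and only if an admissible linear
change of variables with coefficients in `K` transforms one equation into the other. -/
def isoSetoid : Setoid (EllipticCurve K) :=
  (MulAction.orbitRel (WeierstrassCurve.VariableChange K) (WeierstrassCurve K)).comap Subtype.val

/-- The set of isomorphism classes of elliptic curves over `K`. -/
def IsoClass : Type _ := Quotient (isoSetoid K)

variable {K} in
/-- The naive height of an isomorphism class of elliptic curves. -/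
def IsoClass.height : IsoClass K → ℝ :=
  Quotient.lift (s := isoSetoid K) (fun E => naiveHeight E.1) (by
    rintro E E' ⟨C, hC⟩
    rw [← hC]
    exact naiveHeight_variableChange C E'.1)

/-- The set of isomorphism classes of elliptic curves over `K` of naive height less than `B`. -/
def isoClassesOfHeightLT (B : ℝ) : Set (IsoClass K) := {E | E.height < B}

/-- The leading constant. Here `dedekindZeta K 10` is a real number, viewed in `ℂ`. -/
def kappa : ℝ :=
  (classNumber K *
      (2 ^ (InfinitePlace.nrRealPlaces K + InfinitePlace.nrComplexPlaces K) *
        Real.pi ^ InfinitePlace.nrComplexPlaces K) ^ 2 *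
      Units.regulator K *
      10 ^ (InfinitePlace.nrRealPlaces K + InfinitePlace.nrComplexPlaces K - 1) *
      (Nat.gcd 2 (Units.torsionOrder K) : ℝ)) /
    (Units.torsionOrder K * |(discr K : ℝ)| * (dedekindZeta K 10).re)

end EllipticCount

end

open NumberField IsDedekindDomain

noncomputable section

namespace EllipticCount

open MeasureTheory NumberField.mixedEmbedding NumberField.InfinitePlace
  NumberField.mixedEmbedding.fundamentalCone NumberField.Units.dirichletUnitTheorem Module
open scoped ENNReal NNReal Classical

set_option linter.unusedSectionVars false

/-! A curve y² = x³ + ax + b may be taken integral, and (a, b) is determined up to (t⁴a, t⁶b). If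
`content p` is the largest ideal I with a ∈ I⁴ and b ∈ I⁶, then the weighted height is the product
of the sizes of (a, b) at the infinite places divided by N(`content p`) (`weightedHeight_eq`).
Curves themselves would require a primitivity condition, so pairs (E, J) with J a nonzero ideal and
Ht(E)·N(J)¹² < T¹² are counted first, where T = B^(1/12).

Fix an integral ideal I_c in each ideal class c. A pair (E, J) has a representative of content
exactly I_c·J for a unique c, unique up to units. Up to roots of unity, the units are used up by
requiring the representative to lie in a fundamental cone. A root of unity acts by (ζ⁴, ζ⁶), with
stabilizer ±1 when ab ≠ 0. Hence w·#pairs is 2·Σ_c #(points of I_c⁴ × I_c⁶ in the cone of height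
below N(I_c)T), up to points with ab = 0 or vanishing discriminant (`abs_ncard_pairsLT_sub_le`).

For the lattice points, take logarithms of the sizes at the infinite places. Since 4 + 6 = 10,
Lebesgue measure becomes exp(10·Σ s_v) ds up to a constant (`map_logSize_volume`). In the basis of
fundamental units and the vector of multiplicities the cone is a box, so volumes are explicit and
contain the regulator (`volume_shell`). A bounded translation moves the coordinates of a point at
level τ by O(e^(-4τ)) (`exists_coneCoord_sub_le`). Comparing unions of translates of a fundamental
domain with slightly thickened and shrunken shells therefore gives an error e^((10d-4)τ), and
summing shells τ, τ-1, ... preserves it. With e^(dτ) of the order of T this is T^(10-4/d).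

Finally J is removed by Möbius inversion over squarefree ideals, encoded as finite sets of primes.
The main terms sum to 1/ζ_K(10). The error terms sum because 10 - 4/d ≥ 6 > 1 and because the pair
estimate holds for every T > 0, so no truncation is needed. -/

variable {K : Type*} [Field K]

/-! ### Sizes at the infinite places and the distribution of their logarithms -/

/-- The size of a pair of points of the mixed space at an infinite place, for the weights
`4` and `6`. -/
def placeSize (v : InfinitePlace K) (x : mixedSpace K × mixedSpace K) : ℝ :=
  max ((normAtPlace v x.1 ^ v.mult) ^ (1 / 4 : ℝ)) ((normAtPlace v x.2 ^ v.mult) ^ (1 / 6 : ℝ))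

theorem placeSize_nonneg (v : InfinitePlace K) (x : mixedSpace K × mixedSpace K) :
    0 ≤ placeSize v x :=
  le_max_of_le_left (Real.rpow_nonneg (pow_nonneg (normAtPlace_nonneg _ _) _) _)

theorem placeSize_lt_exp_iff (v : InfinitePlace K) (x : mixedSpace K × mixedSpace K) (c : ℝ) :
    placeSize v x < Real.exp c ↔ normAtPlace v x.1 < Real.exp (4 * c / v.mult) ∧
      normAtPlace v x.2 < Real.exp (6 * c / v.mult) := by
  have hm : (v.mult : ℝ) ≠ 0 := mult_coe_ne_zero
  have key : ∀ (y : ℝ) (k : ℝ), 0 ≤ y → 0 < k →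
      ((y ^ v.mult) ^ (1 / k) < Real.exp c ↔ y < Real.exp (k * c / v.mult)) := by
    intro y k hy hk
    have h1 : Real.exp c = (Real.exp (k * c / v.mult) ^ v.mult) ^ (1 / k) := by
      rw [← Real.exp_nat_mul, ← Real.exp_mul]
      congr 1
      field_simp
    rw [h1, Real.rpow_lt_rpow_iff (by positivity) (by positivity) (by positivity),
      pow_lt_pow_iff_left₀ hy (by positivity) mult_ne_zero]
  rw [placeSize, max_lt_iff, key _ 4 (normAtPlace_nonneg _ _) (by norm_num),
    key _ 6 (normAtPlace_nonneg _ _) (by norm_num)]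

variable [NumberField K]

theorem continuous_placeSize (v : InfinitePlace K) : Continuous (placeSize v) := by
  have h := continuous_normAtPlace v
  unfold placeSize
  refine Continuous.max ?_ ?_
  · exact ((h.comp continuous_fst).pow _).rpow_const fun _ => Or.inr (by norm_num)
  · exact ((h.comp continuous_snd).pow _).rpow_const fun _ => Or.inr (by norm_num)

/-- The logarithms of the sizes of a pair of points at the infinite places. -/
def logSize (x : mixedSpace K × mixedSpace K) : realSpace K := fun v => Real.log (placeSize v x)

theorem measurable_logSize : Measurable (logSize : mixedSpace K × mixedSpace K → realSpace K) :=
  measurable_pi_lambda _ fun v =>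
    Real.measurable_log.comp (continuous_placeSize v).measurable

variable (K) in
/-- The pairs of points whose components do not vanish simultaneously at any infinite place. -/
def nonvanishing : Set (mixedSpace K × mixedSpace K) := {x | ∀ v, 0 < placeSize v x}

theorem volume_normAtPlace_eq_zero (v : InfinitePlace K) :
    volume {x : mixedSpace K | normAtPlace v x = 0} = 0 := by
  let N : Submodule ℝ (mixedSpace K) :=
    { carrier := {x | normAtPlace v x = 0}
      add_mem' := fun {x y} hx hy => le_antisymm
        ((normAtPlace_add_le v x y).trans (by
          rw [Set.mem_ofPred_eq] at hx hy; rw [hx, hy, add_zero])) (normAtPlace_nonneg _ _)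
      zero_mem' := map_zero _
      smul_mem' := fun c x hx => by
        rw [Set.mem_ofPred_eq] at hx ⊢
        rw [normAtPlace_smul, hx, mul_zero] }
  refine Measure.addHaar_submodule volume N fun h => ?_
  have : (1 : mixedSpace K) ∈ N := h ▸ Submodule.mem_top
  have h1 : normAtPlace v (1 : mixedSpace K) = 0 := this
  simp at h1

/-- Where a size vanishes, `logSize` takes the default value log 0 = 0; such points are harmless
because they lie in finitely many proper subspaces. -/
theorem volume_compl_nonvanishing : volume (nonvanishing K)ᶜ = 0 := by
  have : (nonvanishing K)ᶜ ⊆ ⋃ v, {x : mixedSpace K | normAtPlace v x = 0} ×ˢ Set.univ := by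
    intro x hx
    simp only [nonvanishing, Set.mem_compl_iff, Set.mem_ofPred_eq, not_forall, not_lt] at hx
    obtain ⟨v, hv⟩ := hx
    refine Set.mem_iUnion.2 ⟨v, ?_, trivial⟩
    by_contra h
    have h0 : 0 < normAtPlace v x.1 := lt_of_le_of_ne (normAtPlace_nonneg _ _) (Ne.symm h)
    have : 0 < (normAtPlace v x.1 ^ v.mult) ^ (1 / 4 : ℝ) := by positivity
    exact absurd (this.trans_le (le_max_left _ _)) (not_lt.2 hv)
  refine measure_mono_null this (measure_iUnion_null fun v => ?_)
  rw [Measure.volume_eq_prod, Measure.prod_prod, volume_normAtPlace_eq_zero, zero_mul]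

theorem mem_convexBodyLT_iff (f : InfinitePlace K → ℝ≥0) (x : mixedSpace K) :
    x ∈ convexBodyLT K f ↔ ∀ v, normAtPlace v x < f v := by
  simp only [convexBodyLT, Set.mem_prod, Set.mem_pi, Set.mem_univ, true_imp_iff,
    mem_ball_zero_iff]
  constructor
  · rintro ⟨h1, h2⟩ v
    by_cases hv : IsReal v
    · rw [normAtPlace_apply_of_isReal hv]; exact h1 ⟨v, hv⟩
    · rw [normAtPlace_apply_of_isComplex (not_isReal_iff_isComplex.1 hv)]
      exact h2 ⟨v, not_isReal_iff_isComplex.1 hv⟩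
  · intro h
    refine ⟨fun v => ?_, fun v => ?_⟩
    · rw [← normAtPlace_apply_of_isReal v.2]; exact h v
    · rw [← normAtPlace_apply_of_isComplex v.2]; exact h v

/-- The size conditions on the two coordinates are independent, so the region is a product of two
convex bodies, with volumes proportional to ∏ e^(4 c_v) and ∏ e^(6 c_v). -/
theorem volume_placeSize_lt (c : InfinitePlace K → ℝ) :
    volume {x : mixedSpace K × mixedSpace K | ∀ v, placeSize v x < Real.exp (c v)} =
      (convexBodyLTFactor K : ℝ≥0∞) ^ 2 * ∏ v, ENNReal.ofReal (Real.exp (10 * c v)) := by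
  let f (k : ℝ) : InfinitePlace K → ℝ≥0 := fun v => (Real.exp (k * c v / v.mult)).toNNReal
  have hf : ∀ k v, (f k v : ℝ) = Real.exp (k * c v / v.mult) := fun k v =>
    Real.coe_toNNReal _ (Real.exp_pos _).le
  have hset : {x : mixedSpace K × mixedSpace K | ∀ v, placeSize v x < Real.exp (c v)} =
      convexBodyLT K (f 4) ×ˢ convexBodyLT K (f 6) := by
    ext x
    rw [Set.mem_prod, mem_convexBodyLT_iff, mem_convexBodyLT_iff, Set.mem_ofPred_eq,
      ← forall_and]
    exact forall_congr' fun v => by rw [placeSize_lt_exp_iff, hf, hf]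
  have hp : ∀ k v, ((f k v : ℝ≥0∞)) ^ v.mult = ENNReal.ofReal (Real.exp (k * c v)) := by
    intro k v
    rw [← ENNReal.ofReal_coe_nnreal, hf, ← ENNReal.ofReal_pow (Real.exp_pos _).le,
      ← Real.exp_nat_mul, mul_div_cancel₀ _ mult_coe_ne_zero]
  rw [hset, Measure.volume_eq_prod, Measure.prod_prod, convexBodyLT_volume, convexBodyLT_volume]
  push_cast
  simp_rw [hp]
  rw [mul_mul_mul_comm, ← sq, ← Finset.prod_mul_distrib]
  congr 1
  refine Finset.prod_congr rfl fun v _ => ?_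
  rw [← ENNReal.ofReal_mul (Real.exp_pos _).le, ← Real.exp_add]
  ring_nf

theorem volume_nonvanishing_inter_logSize_lt (c : InfinitePlace K → ℝ) :
    volume (nonvanishing K ∩ logSize ⁻¹' (Set.univ.pi fun v => Set.Iio (c v))) =
      (convexBodyLTFactor K : ℝ≥0∞) ^ 2 * ∏ v, ENNReal.ofReal (Real.exp (10 * c v)) := by
  rw [← volume_placeSize_lt]
  have : nonvanishing K ∩ logSize ⁻¹' (Set.univ.pi fun v => Set.Iio (c v)) =
      {x : mixedSpace K × mixedSpace K | ∀ v, placeSize v x < Real.exp (c v)} \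
        (nonvanishing K)ᶜ := by
    ext x
    simp only [Set.mem_inter_iff, Set.mem_preimage, Set.mem_pi, Set.mem_univ, true_imp_iff,
      Set.mem_Iio, Set.mem_sdiff, Set.mem_compl_iff, not_not, Set.mem_ofPred_eq]
    rw [and_comm]
    refine and_congr_left fun hx => forall_congr' fun v => ?_
    rw [logSize, Real.log_lt_iff_lt_exp (hx v)]
  rw [this, measure_sdiff_null volume_compl_nonvanishing]

theorem setLIntegral_pi_prod_ofReal {ι : Type*} [Fintype ι] (s : ι → Set ℝ) (f : ι → ℝ → ℝ)
    (h0 : ∀ i x, 0 ≤ f i x) (hf : ∀ i, IntegrableOn (f i) (s i)) :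
    ∫⁻ x in Set.univ.pi s, ENNReal.ofReal (∏ i, f i (x i)) =
      ∏ i, ENNReal.ofReal (∫ x in s i, f i x) := by
  rw [volume_pi, Measure.restrict_pi_pi, ← ofReal_integral_eq_lintegral_ofReal
    (Integrable.fintype_prod hf)
    (Filter.Eventually.of_forall fun x => Finset.prod_nonneg fun i _ => h0 i _),
    integral_fintype_prod_eq_prod,
    ENNReal.ofReal_prod_of_nonneg fun i _ => integral_nonneg fun x => h0 i x]

theorem integral_Iio_exp_ten_mul (c : ℝ) :
    ∫ x in Set.Iio c, 10 * Real.exp (10 * x) = Real.exp (10 * c) := by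
  rw [← integral_Iic_eq_integral_Iio, integral_const_mul, integral_exp_mul_Iic (by norm_num)]
  ring

theorem integrableOn_Iio_exp_ten_mul (c : ℝ) :
    IntegrableOn (fun x => 10 * Real.exp (10 * x)) (Set.Iio c) :=
  ((integrableOn_exp_mul_Iic (by norm_num) c).mono_set Set.Iio_subset_Iic_self).const_mul 10

/-- The density is a product, so its measure is a power of a measure `ρ` on ℝ with ρ(-∞, c) =
e^(10c). Products of lower half-lines form a generating π-system, and on these the pushforward was
just computed; uniqueness of product measures does the rest. -/
theorem map_logSize_volume :
    (volume.restrict (nonvanishing K)).map logSize =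
      ((convexBodyLTFactor K : ℝ≥0∞) ^ 2) • (volume : Measure (realSpace K)).withDensity
        fun s => ENNReal.ofReal (∏ v, 10 * Real.exp (10 * s v)) := by
  set C : ℝ≥0∞ := (convexBodyLTFactor K : ℝ≥0∞) ^ 2 with hC
  have hC0 : C ≠ 0 := pow_ne_zero _ (by exact_mod_cast convexBodyLTFactor_ne_zero K)
  have hCt : C ≠ ∞ := ENNReal.pow_ne_top ENNReal.coe_ne_top
  let ρ : Measure ℝ := volume.withDensity fun x => ENNReal.ofReal (10 * Real.exp (10 * x))
  have hρ : ∀ c, ρ (Set.Iio c) = ENNReal.ofReal (Real.exp (10 * c)) := by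
    intro c
    rw [withDensity_apply _ measurableSet_Iio, ← integral_Iio_exp_ten_mul,
      ← ofReal_integral_eq_lintegral_ofReal (integrableOn_Iio_exp_ten_mul c)
      (Filter.Eventually.of_forall fun x => by positivity)]
  let S : ∀ _ : InfinitePlace K, ρ.FiniteSpanningSetsIn (Set.range Set.Iio) := fun _ =>
    { set := fun n => Set.Iio (n : ℝ)
      set_mem := fun n => ⟨n, rfl⟩
      finite := fun n => by rw [hρ]; exact ENNReal.ofReal_lt_top
      spanning := Set.iUnion_eq_univ_iff.2 fun x => exists_nat_gt x }
  have hgen : ∀ _ : InfinitePlace K,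
      MeasurableSpace.generateFrom (Set.range Set.Iio) = (inferInstance : MeasurableSpace ℝ) :=
    fun _ => ((borel_eq_generateFrom_Iio ℝ).symm.trans (BorelSpace.measurable_eq).symm)
  have hpi : ∀ _ : InfinitePlace K, IsPiSystem (Set.range (Set.Iio : ℝ → Set ℝ)) :=
    fun _ => Set.image_univ (f := (Set.Iio : ℝ → Set ℝ)) ▸ isPiSystem_image_Iio _
  have h1 : Measure.pi (fun _ : InfinitePlace K => ρ) =
      (volume : Measure (realSpace K)).withDensity
        fun s => ENNReal.ofReal (∏ v, 10 * Real.exp (10 * s v)) := by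
    refine Measure.pi_eq_generateFrom hgen hpi S fun s hs => ?_
    choose c hc using hs
    obtain rfl : (fun v => Set.Iio (c v)) = s := funext hc
    simp_rw [hρ]
    rw [withDensity_apply _ (MeasurableSet.univ_pi fun _ => measurableSet_Iio),
      setLIntegral_pi_prod_ofReal (fun v => Set.Iio (c v)) (fun _ x => 10 * Real.exp (10 * x))
        (fun _ _ => by positivity) fun v => integrableOn_Iio_exp_ten_mul _]
    simp_rw [integral_Iio_exp_ten_mul]
  have h2 : Measure.pi (fun _ : InfinitePlace K => ρ) =
      C⁻¹ • (volume.restrict (nonvanishing K)).map logSize := by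
    refine Measure.pi_eq_generateFrom hgen hpi S fun s hs => ?_
    choose c hc using hs
    obtain rfl : (fun v => Set.Iio (c v)) = s := funext hc
    simp_rw [hρ]
    have hm : MeasurableSet (Set.univ.pi fun v : InfinitePlace K => Set.Iio (c v)) :=
      MeasurableSet.univ_pi fun _ => measurableSet_Iio
    rw [Measure.smul_apply, Measure.map_apply measurable_logSize hm,
      Measure.restrict_apply (measurable_logSize hm), Set.inter_comm,
      volume_nonvanishing_inter_logSize_lt, smul_eq_mul, ← mul_assoc,
      ENNReal.inv_mul_cancel hC0 hCt, one_mul]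
  rw [← h1, h2, smul_smul, ENNReal.mul_inv_cancel hC0 hCt, one_smul]

/-! ### Cone coordinates and volumes of shells -/

/-- The coordinates of `logSize x` in the basis given by a system of fundamental units and the
vector of multiplicities. -/
def coneCoord (x : mixedSpace K × mixedSpace K) : InfinitePlace K → ℝ :=
  (completeBasis K).equivFun (logSize x)

/-- The logarithm vector of a unit has sum zero because its norm is ±1; the multiplicities add up to
the degree. So only the coordinate at `w₀` records the height. -/
theorem sum_completeBasis (i : InfinitePlace K) :
    ∑ v, completeBasis K i v = if i = w₀ then (finrank ℚ K : ℝ) else 0 := by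
  split_ifs with hi
  · rw [hi, completeBasis_apply_of_eq, ← Nat.cast_sum, sum_mult_eq]
  · rw [completeBasis_apply_of_ne K ⟨i, hi⟩, sum_expMap_symm_apply (Units.coe_ne_zero _)]
    simp [Units.norm]

theorem sum_equivFun_symm_completeBasis (c : InfinitePlace K → ℝ) :
    ∑ v, (completeBasis K).equivFun.symm c v = finrank ℚ K * c w₀ := by
  simp_rw [Basis.equivFun_symm_apply, Finset.sum_apply, Pi.smul_apply, smul_eq_mul]
  rw [Finset.sum_comm]
  simp_rw [← Finset.mul_sum, sum_completeBasis]
  simp [mul_comm]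

theorem sum_logSize (x : mixedSpace K × mixedSpace K) :
    ∑ v, logSize x v = finrank ℚ K * coneCoord x w₀ := by
  rw [← sum_equivFun_symm_completeBasis, coneCoord, LinearEquiv.symm_apply_apply]

/-- The set of pairs of points whose coordinates lie in a half-open box. -/
def shell (l u : InfinitePlace K → ℝ) : Set (mixedSpace K × mixedSpace K) :=
  {x | x ∈ nonvanishing K ∧ ∀ v, coneCoord x v ∈ Set.Ico (l v) (u v)}

variable (K) in
/-- The constant in the volume of a shell. -/
def shellConst : ℝ :=
  (2 ^ nrRealPlaces K * Real.pi ^ nrComplexPlaces K) ^ 2 *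
    10 ^ (nrRealPlaces K + nrComplexPlaces K - 1) * Units.regulator K

theorem shellConst_pos : 0 < shellConst K := by
  have := Units.regulator_pos K
  unfold shellConst
  positivity

theorem coe_convexBodyLTFactor :
    ((convexBodyLTFactor K : ℝ≥0) : ℝ) = 2 ^ nrRealPlaces K * Real.pi ^ nrComplexPlaces K := by
  simp [convexBodyLTFactor]

/-- Linear change of variables from logarithms to cone coordinates, whose Jacobian is the degree
times the regulator. -/
theorem volume_shell_eq_lintegral (l u : InfinitePlace K → ℝ) :
    volume (shell l u) = (convexBodyLTFactor K : ℝ≥0∞) ^ 2 *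
      (ENNReal.ofReal (finrank ℚ K * Units.regulator K) *
        ∫⁻ c in Set.univ.pi fun v => Set.Ico (l v) (u v),
          ENNReal.ofReal (10 ^ Fintype.card (InfinitePlace K) *
            Real.exp (10 * finrank ℚ K * c w₀))) := by
  set e := (completeBasis K).equivFunL
  set box : Set (InfinitePlace K → ℝ) := Set.univ.pi fun v => Set.Ico (l v) (u v)
  have hbox : MeasurableSet box := MeasurableSet.univ_pi fun _ => measurableSet_Ico
  have hpre : MeasurableSet (e ⁻¹' box) := e.continuous.measurable hbox
  have himg : e ⁻¹' box = (e.symm : (InfinitePlace K → ℝ) →L[ℝ] realSpace K) '' box :=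
    (ContinuousLinearEquiv.image_symm_eq_preimage e box).symm
  have hset : shell l u = logSize ⁻¹' (e ⁻¹' box) ∩ nonvanishing K := by
    ext x
    simp only [shell, Set.mem_ofPred_eq, Set.mem_inter_iff, Set.mem_preimage, box, Set.mem_pi,
      Set.mem_univ, true_imp_iff]
    rw [and_comm]
    rfl
  rw [hset, ← Measure.restrict_apply (measurable_logSize hpre),
    ← Measure.map_apply measurable_logSize hpre, map_logSize_volume, Measure.smul_apply,
    smul_eq_mul, withDensity_apply _ hpre, himg,
    lintegral_image_eq_lintegral_abs_det_fderiv_mul volume hbox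
      (fun x _ => (e.symm : (InfinitePlace K → ℝ) →L[ℝ] realSpace K).hasFDerivAt.hasFDerivWithinAt)
      e.symm.injective.injOn, abs_det_completeBasis_equivFunL_symm,
    lintegral_const_mul' _ _ ENNReal.ofReal_ne_top]
  congr 3
  ext c
  rw [Finset.prod_mul_distrib, Finset.prod_const, ← Real.exp_sum, ← Finset.mul_sum,
    Finset.card_univ]
  congr 3
  rw [mul_assoc]
  congr 1
  exact sum_equivFun_symm_completeBasis c

/-- The density depends on the coordinate at `w₀` only, so every other direction contributes its
length. Integrating the exponential divides by 10d: d cancels against the Jacobian, and one of the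
r₁ + r₂ factors 10 is lost. -/
theorem volume_shell {l u : InfinitePlace K → ℝ} (hlu : ∀ v, l v ≤ u v) :
    volume (shell l u) = ENNReal.ofReal (shellConst K *
      (Real.exp (10 * finrank ℚ K * u w₀) - Real.exp (10 * finrank ℚ K * l w₀)) *
        ∏ v ∈ Finset.univ.erase w₀, (u v - l v)) := by
  have hd : (0 : ℝ) < finrank ℚ K := by exact_mod_cast finrank_pos
  have hcard : Fintype.card (InfinitePlace K) = nrRealPlaces K + nrComplexPlaces K :=
    card_eq_nrRealPlaces_add_nrComplexPlaces K
  have hr : 0 < nrRealPlaces K + nrComplexPlaces K := hcard ▸ Fintype.card_pos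
  let f : InfinitePlace K → ℝ → ℝ := fun v x =>
    if v = w₀ then 10 ^ Fintype.card (InfinitePlace K) * Real.exp (10 * finrank ℚ K * x) else 1
  have hf : ∀ c : InfinitePlace K → ℝ, 10 ^ Fintype.card (InfinitePlace K) *
      Real.exp (10 * finrank ℚ K * c w₀) = ∏ v, f v (c v) := by
    intro c
    rw [← Finset.mul_prod_erase _ _ (Finset.mem_univ w₀), Finset.prod_eq_one]
    · simp [f]
    · intro v hv
      simp [f, Finset.ne_of_mem_erase hv]
  have hcont : ∀ v, Continuous (f v) := by
    intro v
    by_cases h : v = w₀ <;> simp only [f, h, if_true, if_false] <;> fun_prop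
  have h0 : ∀ v x, 0 ≤ f v x := by
    intro v x
    by_cases h : v = w₀ <;> simp only [f, h, if_true, if_false] <;> positivity
  have hintegral : ∀ v, ∫ x in Set.Ico (l v) (u v), f v x = if v = w₀ then
      10 ^ Fintype.card (InfinitePlace K) * ((Real.exp (10 * finrank ℚ K * u w₀) -
        Real.exp (10 * finrank ℚ K * l w₀)) / (10 * finrank ℚ K)) else u v - l v := by
    intro v
    rw [integral_Ico_eq_integral_Ioo, ← integral_Ioc_eq_integral_Ioo,
      ← intervalIntegral.integral_of_le (hlu v)]
    by_cases h : v = w₀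
    · subst h
      simp only [f, if_true]
      rw [intervalIntegral.integral_const_mul, intervalIntegral.integral_comp_mul_left _
        (by positivity : (10 * finrank ℚ K : ℝ) ≠ 0), integral_exp, smul_eq_mul, inv_mul_eq_div]
    · simp [f, h]
  rw [volume_shell_eq_lintegral]
  simp_rw [hf]
  rw [setLIntegral_pi_prod_ofReal _ f h0
    fun v => ((hcont v).integrableOn_Icc).mono_set Set.Ico_subset_Icc_self]
  have hexp : 0 ≤ Real.exp (10 * finrank ℚ K * u w₀) - Real.exp (10 * finrank ℚ K * l w₀) :=
    sub_nonneg.2 (Real.exp_le_exp.2 (mul_le_mul_of_nonneg_left (hlu _) (by positivity)))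
  have hR := Units.regulator_pos K
  rw [← ENNReal.ofReal_prod_of_nonneg fun v _ => integral_nonneg fun x => h0 v x,
    ← ENNReal.ofReal_mul (by positivity), ← ENNReal.ofReal_coe_nnreal,
    ← ENNReal.ofReal_pow (by positivity), ← ENNReal.ofReal_mul (by positivity),
    ← Finset.mul_prod_erase _ _ (Finset.mem_univ w₀), Finset.prod_congr rfl fun v hv =>
      (hintegral v).trans (if_neg (Finset.ne_of_mem_erase hv)), hintegral, if_pos rfl,
    coe_convexBodyLTFactor, shellConst, hcard, ← Nat.sub_one_add_one hr.ne', pow_succ,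
    Nat.add_sub_cancel]
  congr 1
  field_simp
  ring

/-! ### Stability of the cone coordinates under bounded translations -/

theorem rpow_size_le {y y' p δ R k : ℝ} {m : ℕ} (hm : 0 < m) (hmk : (m : ℝ) ≤ k) (hy : 0 ≤ y)
    (hy' : 0 ≤ y') (hδ : 0 ≤ δ) (h : y' ≤ y + R) (hp : (y ^ m) ^ (1 / k) ≤ p)
    (hR : R ≤ δ * p ^ (k / m)) : (y' ^ m) ^ (1 / k) ≤ p * (1 + δ) := by
  have hm' : (0 : ℝ) < m := by exact_mod_cast hm
  have hk : 0 < k := hm'.trans_le hmk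
  have hp0 : 0 ≤ p := (by positivity : 0 ≤ (y ^ m) ^ (1 / k)).trans hp
  have hyp : y ≤ p ^ (k / m) := by
    have : y = ((y ^ m) ^ (1 / k)) ^ (k / m) := by
      rw [← Real.rpow_mul (by positivity), ← Real.rpow_natCast, ← Real.rpow_mul hy]
      rw [show (m : ℝ) * (1 / k * (k / m)) = 1 by field_simp, Real.rpow_one]
    rw [this]
    exact Real.rpow_le_rpow (by positivity) hp (by positivity)
  have h1 : y' ≤ p ^ (k / m) * (1 + δ) := by linarith
  calc (y' ^ m) ^ (1 / k) = y' ^ (m / k) := by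
        rw [← Real.rpow_natCast, ← Real.rpow_mul hy']; congr 1; ring
    _ ≤ (p ^ (k / m) * (1 + δ)) ^ (m / k) := Real.rpow_le_rpow hy' h1 (by positivity)
    _ = p * (1 + δ) ^ (m / k) := by
        rw [Real.mul_rpow (by positivity) (by positivity), ← Real.rpow_mul hp0,
          show k / m * (m / k) = 1 by field_simp, Real.rpow_one]
    _ ≤ p * (1 + δ) := by
        gcongr
        conv_rhs => rw [← Real.rpow_one (1 + δ)]
        exact Real.rpow_le_rpow_of_exponent_le (by linarith) ((div_le_one hk).2 hmk)

theorem le_rpow_size {y y' p δ R k : ℝ} {m : ℕ} (hm : 0 < m) (hmk : (m : ℝ) ≤ k) (hy : 0 ≤ y)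
    (hy' : 0 ≤ y') (hδ : 0 ≤ δ) (hδ1 : δ < 1) (h : y ≤ y' + R) (hp : (y ^ m) ^ (1 / k) = p)
    (hR : R ≤ δ * p ^ (k / m)) : p * (1 - δ) ≤ (y' ^ m) ^ (1 / k) := by
  have hm' : (0 : ℝ) < m := by exact_mod_cast hm
  have hk : 0 < k := hm'.trans_le hmk
  have hp0 : 0 ≤ p := hp ▸ (by positivity : 0 ≤ (y ^ m) ^ (1 / k))
  have hyp : y = p ^ (k / m) := by
    rw [← hp, ← Real.rpow_mul (by positivity), ← Real.rpow_natCast, ← Real.rpow_mul hy]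
    rw [show (m : ℝ) * (1 / k * (k / m)) = 1 by field_simp, Real.rpow_one]
  have h1 : p ^ (k / m) * (1 - δ) ≤ y' := by linarith
  have hδ2 : 0 < 1 - δ := by linarith
  calc p * (1 - δ) ≤ p * (1 - δ) ^ (m / k) := by
        gcongr
        conv_lhs => rw [← Real.rpow_one (1 - δ)]
        exact Real.rpow_le_rpow_of_exponent_ge hδ2 (by linarith) ((div_le_one hk).2 hmk)
    _ = (p ^ (k / m) * (1 - δ)) ^ (m / k) := by
        rw [Real.mul_rpow (by positivity) (by positivity), ← Real.rpow_mul hp0,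
          show k / m * (m / k) = 1 by field_simp, Real.rpow_one]
    _ ≤ y' ^ (m / k) := Real.rpow_le_rpow (by positivity) h1 (by positivity)
    _ = (y' ^ m) ^ (1 / k) := by
        rw [← Real.rpow_natCast, ← Real.rpow_mul hy']; congr 1; ring

theorem normAtPlace_le_norm (v : InfinitePlace K) (x : mixedSpace K) : normAtPlace v x ≤ ‖x‖ := by
  rw [norm_eq_sup'_normAtPlace]
  exact Finset.le_sup' (fun w => normAtPlace w x) (Finset.mem_univ v)

theorem normAtPlace_le_add_norm_sub (v : InfinitePlace K) (x y : mixedSpace K) :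
    normAtPlace v y ≤ normAtPlace v x + ‖y - x‖ := by
  calc normAtPlace v y = normAtPlace v (x + (y - x)) := by rw [add_sub_cancel]
    _ ≤ _ := normAtPlace_add_le _ _ _
    _ ≤ _ := by gcongr; exact normAtPlace_le_norm _ _

theorem mult_le_two (v : InfinitePlace K) : (v.mult : ℝ) ≤ 2 := by
  unfold InfinitePlace.mult
  split_ifs <;> norm_num

/-- In a coordinate of weight k a size p corresponds to an absolute value p^(k/m), with m the
multiplicity of the place. If R is at most δ times that, the size changes by a factor between 1 - δ
and 1 + δ, as the exponent m/k is at most 1. -/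
theorem abs_log_placeSize_sub_le {x y : mixedSpace K × mixedSpace K} {v : InfinitePlace K}
    {R δ : ℝ} (hxy : ‖y - x‖ ≤ R) (hx : 0 < placeSize v x) (hδ : 0 ≤ δ) (hδ1 : δ ≤ 1 / 2)
    (h4 : R ≤ δ * placeSize v x ^ (4 / v.mult : ℝ)) (h6 : R ≤ δ * placeSize v x ^ (6 / v.mult : ℝ)) :
    0 < placeSize v y ∧ |Real.log (placeSize v y) - Real.log (placeSize v x)| ≤ 2 * δ := by
  set p := placeSize v x with hp
  have hm := mult_le_two v
  have h1 : ‖y.1 - x.1‖ ≤ R := (norm_fst_le (y - x)).trans hxy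
  have h2 : ‖y.2 - x.2‖ ≤ R := (norm_snd_le (y - x)).trans hxy
  have up : placeSize v y ≤ p * (1 + δ) := by
    refine max_le ?_ ?_
    · exact rpow_size_le mult_pos (by linarith) (normAtPlace_nonneg v x.1) (normAtPlace_nonneg _ _)
        hδ ((normAtPlace_le_add_norm_sub _ _ _).trans (by gcongr)) (le_max_left _ _) h4
    · exact rpow_size_le mult_pos (by linarith) (normAtPlace_nonneg v x.2) (normAtPlace_nonneg _ _)
        hδ ((normAtPlace_le_add_norm_sub _ _ _).trans (by gcongr)) (le_max_right _ _) h6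
  have low : p * (1 - δ) ≤ placeSize v y := by
    -- The coordinate attaining the maximum at `x` alone keeps the size at `y` from dropping.
    rcases max_choice ((normAtPlace v x.1 ^ v.mult) ^ (1 / 4 : ℝ))
      ((normAtPlace v x.2 ^ v.mult) ^ (1 / 6 : ℝ)) with h | h
    · refine le_max_of_le_left ?_
      refine le_rpow_size mult_pos (by linarith) (normAtPlace_nonneg v x.1) (normAtPlace_nonneg _ _)
        hδ (by linarith) ((normAtPlace_le_add_norm_sub v y.1 x.1).trans ?_) h.symm h4
      rw [norm_sub_rev]; gcongr
    · refine le_max_of_le_right ?_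
      refine le_rpow_size mult_pos (by linarith) (normAtPlace_nonneg v x.2) (normAtPlace_nonneg _ _)
        hδ (by linarith) ((normAtPlace_le_add_norm_sub v y.2 x.2).trans ?_) h.symm h6
      rw [norm_sub_rev]; gcongr
  have hδ' : 0 < 1 - δ := by linarith
  have hy : 0 < placeSize v y := lt_of_lt_of_le (by positivity) low
  refine ⟨hy, abs_le.2 ⟨?_, ?_⟩⟩
  · have := Real.log_le_log (by positivity) low
    rw [Real.log_mul hx.ne' hδ'.ne'] at this
    have h3 := Real.one_sub_inv_le_log_of_pos hδ'
    have h4 : (1 - δ)⁻¹ ≤ 1 + 2 * δ := by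
      rw [inv_le_iff_one_le_mul₀ hδ']
      nlinarith
    linarith
  · have := Real.log_le_log hy up
    rw [Real.log_mul hx.ne' (by positivity)] at this
    have h3 := Real.log_le_sub_one_of_pos (by positivity : 0 < 1 + δ)
    linarith

theorem logSize_apply_eq_sum (x : mixedSpace K × mixedSpace K) (v : InfinitePlace K) :
    logSize x v = coneCoord x w₀ * v.mult +
      ∑ i ∈ Finset.univ.erase w₀, coneCoord x i * completeBasis K i v := by
  have h : logSize x = (completeBasis K).equivFun.symm (coneCoord x) :=
    (LinearEquiv.symm_apply_apply _ _).symm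
  conv_lhs => rw [h]
  rw [Basis.equivFun_symm_apply, Finset.sum_apply, ← Finset.add_sum_erase _ _ (Finset.mem_univ w₀)]
  simp only [Pi.smul_apply, smul_eq_mul, completeBasis_apply_of_eq]

variable (K) in
-- With the unit coordinates bounded, the sizes at all places are comparable and governed by the
-- coordinate at `w₀`.
theorem exists_abs_logSize_sub_le : ∃ A : ℝ, 0 ≤ A ∧ ∀ (x : mixedSpace K × mixedSpace K)
    (_ : ∀ v ≠ w₀, |coneCoord x v| ≤ 2) (v : InfinitePlace K),
    |logSize x v - coneCoord x w₀ * v.mult| ≤ A := by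
  refine ⟨∑ v, ∑ i, 2 * |completeBasis K i v|, by positivity, fun x hx v => ?_⟩
  rw [logSize_apply_eq_sum, add_sub_cancel_left]
  calc _ ≤ ∑ i ∈ Finset.univ.erase w₀, |coneCoord x i * completeBasis K i v| :=
        Finset.abs_sum_le_sum_abs _ _
    _ ≤ ∑ i ∈ Finset.univ.erase w₀, 2 * |completeBasis K i v| := by
        refine Finset.sum_le_sum fun i hi => ?_
        rw [abs_mul]
        gcongr
        exact hx i (Finset.ne_of_mem_erase hi)
    _ ≤ ∑ i, 2 * |completeBasis K i v| :=
        Finset.sum_le_sum_of_subset_of_nonneg (Finset.subset_univ _) fun i _ _ => by positivity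
    _ ≤ _ := Finset.single_le_sum (f := fun v => ∑ i, 2 * |completeBasis K i v|)
        (fun v _ => by positivity) (Finset.mem_univ v)

variable (K) in
-- At level at least τ ≥ 0 the dominant coordinate has absolute value at least a constant times
-- e^(4τ) at every place, so a translation by R is a relative perturbation O(e^(-4τ)). The smaller
-- weight 4 is what fixes the error exponent of the theorem.
theorem exists_coneCoord_sub_le {R : ℝ} (hR : 0 ≤ R) : ∃ C τ₀ : ℝ, 0 ≤ C ∧ ∀ τ ≥ τ₀,
    ∀ x ∈ nonvanishing K, (∀ v ≠ w₀, |coneCoord x v| ≤ 2) → τ ≤ coneCoord x w₀ →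
    ∀ y, ‖y - x‖ ≤ R →
      y ∈ nonvanishing K ∧ ∀ v, |coneCoord y v - coneCoord x v| ≤ C * Real.exp (-4 * τ) := by
  obtain ⟨A, hA, hAx⟩ := exists_abs_logSize_sub_le K
  set e := ((completeBasis K).equivFunL : realSpace K →L[ℝ] (InfinitePlace K → ℝ))
  have hlim : Filter.Tendsto (fun τ : ℝ => R * Real.exp (6 * A) * Real.exp (-4 * τ)) Filter.atTop
      (nhds (R * Real.exp (6 * A) * 0)) := by
    refine Filter.Tendsto.const_mul _ (Real.tendsto_exp_atBot.comp ?_)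
    exact Filter.tendsto_id.const_mul_atTop_of_neg (by norm_num)
  rw [mul_zero] at hlim
  obtain ⟨τ₁, hτ₁⟩ := Filter.eventually_atTop.1
    (hlim.eventually (eventually_le_nhds (by norm_num : (0 : ℝ) < 1 / 2)))
  refine ⟨‖e‖ * (2 * (R * Real.exp (6 * A))), max τ₁ 0, by positivity, ?_⟩
  intro τ hτ x hx hx2 hxτ y hy
  set δ := R * Real.exp (6 * A) * Real.exp (-4 * τ) with hδ
  have hδ0 : 0 ≤ δ := by positivity
  have hδ1 : δ ≤ 1 / 2 := hτ₁ τ ((le_max_left _ _).trans hτ)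
  have hτ0 : 0 ≤ τ := (le_max_right _ _).trans hτ
  have key : ∀ v, 0 < placeSize v y ∧
      |Real.log (placeSize v y) - Real.log (placeSize v x)| ≤ 2 * δ := by
    intro v
    have hm1 : (1 : ℝ) ≤ v.mult := by exact_mod_cast mult_pos (w := v)
    have hpow : ∀ k : ℝ, 4 ≤ k → k ≤ 6 → R ≤ δ * placeSize v x ^ (k / v.mult : ℝ) := by
      intro k hk hk6
      have hlog : τ * v.mult - A ≤ Real.log (placeSize v x) := by
        have h1 := (abs_le.1 (hAx x hx2 v)).1
        have h2 : τ * v.mult ≤ coneCoord x w₀ * v.mult := by gcongr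
        have h3 : logSize x v = Real.log (placeSize v x) := rfl
        linarith
      have hk0 : 0 ≤ k / v.mult := by positivity
      -- The loss e^(-6A) covers both weights, since k / mult ≤ 6; for k = 6 the bound also uses τ ≥
      -- 0.
      calc R = R * Real.exp (6 * A) * Real.exp (-4 * τ) * Real.exp (4 * τ - 6 * A) := by
            rw [mul_assoc, mul_assoc, ← Real.exp_add, ← Real.exp_add]
            ring_nf; simp
        _ ≤ δ * Real.exp (Real.log (placeSize v x) * (k / v.mult)) := by
            gcongr
            have h1 : (τ * v.mult - A) * (k / v.mult) ≤ Real.log (placeSize v x) * (k / v.mult) := by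
              gcongr
            have h2 : (τ * v.mult - A) * (k / v.mult) = τ * k - A * (k / v.mult) := by
              field_simp
            have h3 : k / v.mult ≤ 6 := (div_le_self (by linarith) hm1).trans hk6
            nlinarith
        _ = _ := by rw [Real.rpow_def_of_pos (hx v)]
    exact abs_log_placeSize_sub_le hy (hx v) hδ0 hδ1 (hpow 4 le_rfl (by norm_num))
      (hpow 6 (by norm_num) le_rfl)
  refine ⟨fun v => (key v).1, fun v => ?_⟩
  have h1 : coneCoord y v - coneCoord x v = e (logSize y - logSize x) v := by
    rw [map_sub]; rfl
  rw [h1, ← Real.norm_eq_abs]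
  calc _ ≤ ‖e (logSize y - logSize x)‖ := norm_le_pi_norm _ v
    _ ≤ ‖e‖ * ‖logSize y - logSize x‖ := e.le_opNorm _
    _ ≤ ‖e‖ * (2 * δ) := by
        gcongr
        exact (pi_norm_le_iff_of_nonneg (by positivity)).2 fun v => (key v).2
    _ = _ := by rw [hδ]; ring

/-! ### Comparing the number of translates of a set with a volume -/

section Tiling

variable {G : Type*} [AddCommGroup G] [MeasurableSpace G] [MeasurableAdd G] {μ : Measure G}
  [μ.IsAddLeftInvariant] {S F : Set G}

theorem encard_mul_measure_le {B : Set G} (hF : MeasurableSet F) (hS : S.Countable)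
    (huniq : ∀ s ∈ S, ∀ s' ∈ S, ∀ f ∈ F, ∀ f' ∈ F, s + f = s' + f' → s = s')
    (hB : ∀ s ∈ S, ∀ f ∈ F, s + f ∈ B) : (S.encard : ℝ≥0∞) * μ F ≤ μ B := by
  have hm : ∀ s : G, μ ((fun x => s + x) '' F) = μ F := fun s => by
    rw [Set.image_add_left, measure_preimage_add]
  have hmeas : ∀ s : G, MeasurableSet ((fun x => s + x) '' F) := fun s => by
    rw [Set.image_add_left]; exact measurable_const_add _ hF
  have hdisj : S.PairwiseDisjoint fun s => (fun x => s + x) '' F := by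
    intro s hs s' hs' hne
    refine Set.disjoint_left.2 ?_
    rintro _ ⟨f, hf, rfl⟩ ⟨f', hf', h⟩
    exact hne (huniq s hs s' hs' f hf f' hf' h.symm)
  calc (S.encard : ℝ≥0∞) * μ F = ∑' _ : S, μ F := by
        rw [ENNReal.tsum_set_const]
    _ = μ (⋃ s ∈ S, (fun x => s + x) '' F) := by
        rw [measure_biUnion hS hdisj fun s _ => hmeas s]
        exact tsum_congr fun s => (hm s).symm
    _ ≤ μ B := measure_mono (Set.iUnion₂_subset fun s hs => by
        rintro _ ⟨f, hf, rfl⟩; exact hB s hs f hf)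

theorem measure_le_encard_mul {A : Set G} (hS : S.Countable)
    (hA : ∀ x ∈ A, ∃ s ∈ S, ∃ f ∈ F, s + f = x) : μ A ≤ (S.encard : ℝ≥0∞) * μ F := by
  have hm : ∀ s : G, μ ((fun x => s + x) '' F) = μ F := fun s => by
    rw [Set.image_add_left, measure_preimage_add]
  calc μ A ≤ μ (⋃ s ∈ S, (fun x => s + x) '' F) := measure_mono fun x hx => by
        obtain ⟨s, hs, f, hf, rfl⟩ := hA x hx
        exact Set.mem_biUnion hs ⟨f, hf, rfl⟩
    _ ≤ ∑' s : S, μ ((fun x => (s : G) + x) '' F) := measure_biUnion_le μ hS _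
    _ = ∑' _ : S, μ F := tsum_congr fun s => hm s
    _ = _ := by rw [ENNReal.tsum_set_const]

end Tiling

/-! ### The lattices given by powers of an ideal -/

open scoped nonZeroDivisors

variable (K) in
/-- The volume of a fundamental domain of the lattice of integers. -/
def integerCovolume : ℝ := 2⁻¹ ^ nrComplexPlaces K * Real.sqrt |(discr K : ℝ)|

theorem integerCovolume_pos : 0 < integerCovolume K := by
  have : (0 : ℝ) < |(discr K : ℝ)| := abs_pos.2 (Int.cast_ne_zero.2 (discr_ne_zero K))
  unfold integerCovolume
  positivity

/-- Collects what the tiling bounds require: a bounded measurable domain of known volume whose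
translates by the lattice of `J` cover the space without repetition. Existence and uniqueness come
from integer and fractional parts in a lattice basis. -/
theorem exists_fundamentalDomain_ideal {J : Ideal (𝓞 K)} (hJ : J ≠ ⊥) :
    ∃ F : Set (mixedSpace K), MeasurableSet F ∧ (∃ R, 0 ≤ R ∧ ∀ f ∈ F, ‖f‖ ≤ R) ∧
      volume F = ENNReal.ofReal (Ideal.absNorm J * integerCovolume K) ∧
      (∀ x, ∃ a ∈ J, ∃ f ∈ F, mixedEmbedding K a + f = x) ∧
      ∀ a ∈ J, ∀ a' ∈ J, ∀ f ∈ F, ∀ f' ∈ F,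
        mixedEmbedding K a + f = mixedEmbedding K a' + f' → a = a' := by
  let I : (FractionalIdeal (𝓞 K)⁰ K)ˣ :=
    FractionalIdeal.mk0 K ⟨J, mem_nonZeroDivisors_of_ne_zero hJ⟩
  let b := fractionalIdealLatticeBasis K I
  have hmem : ∀ x, x ∈ Submodule.span ℤ (Set.range b) ↔ ∃ a ∈ J, mixedEmbedding K a = x := by
    intro x
    rw [mem_span_fractionalIdealLatticeBasis]
    simp only [I, FractionalIdeal.coe_mk0, Set.mem_image, SetLike.mem_coe,
      FractionalIdeal.mem_coeIdeal]
    constructor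
    · rintro ⟨_, ⟨a, ha, rfl⟩, rfl⟩; exact ⟨a, ha, rfl⟩
    · rintro ⟨a, ha, rfl⟩; exact ⟨_, ⟨a, ha, rfl⟩, rfl⟩
  refine ⟨ZSpan.fundamentalDomain b, ZSpan.fundamentalDomain_measurableSet b, ?_, ?_, ?_, ?_⟩
  · obtain ⟨R, hR⟩ := (ZSpan.fundamentalDomain_isBounded b).exists_norm_le
    exact ⟨max R 0, le_max_right _ _, fun f hf => (hR f hf).trans (le_max_left _ _)⟩
  · rw [volume_fundamentalDomain_fractionalIdealLatticeBasis,
      volume_fundamentalDomain_latticeBasis, ENNReal.ofReal_mul (Nat.cast_nonneg _)]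
    congr 1
    · simp [I, FractionalIdeal.coeIdeal_absNorm]
    · rw [integerCovolume, ENNReal.ofReal_mul (by positivity), ENNReal.ofReal_pow (by positivity),
        ENNReal.ofReal_inv_of_pos (by norm_num), ENNReal.ofReal_ofNat,
        ← ENNReal.ofReal_coe_nnreal, Real.coe_sqrt, coe_nnnorm, Int.norm_eq_abs]
  · intro x
    obtain ⟨a, ha, hax⟩ := (hmem _).1 (ZSpan.floor b x).2
    refine ⟨a, ha, ZSpan.fract b x, ZSpan.fract_mem_fundamentalDomain b x, ?_⟩
    rw [hax, ZSpan.fract_apply, add_sub_cancel]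
  · intro a ha a' ha' f hf f' hf' h
    have h1 := ZSpan.fract_zSpan_add b f ((hmem _).2 ⟨a, ha, rfl⟩)
    have h2 := ZSpan.fract_zSpan_add b f' ((hmem _).2 ⟨a', ha', rfl⟩)
    rw [h, h2, ZSpan.fract_eq_self.2 hf, ZSpan.fract_eq_self.2 hf'] at h1
    rw [h1, add_left_inj] at h
    exact RingOfIntegers.ext (mixedEmbedding_injective K h)

/-- The image of a pair of integers in the mixed space. -/
def pairEmb (p : 𝓞 K × 𝓞 K) : mixedSpace K × mixedSpace K :=
  (mixedEmbedding K p.1, mixedEmbedding K p.2)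

theorem pairEmb_injective : Function.Injective (pairEmb (K := K)) := by
  rintro ⟨a, b⟩ ⟨a', b'⟩ h
  simp only [pairEmb, Prod.mk.injEq] at h
  exact Prod.ext (RingOfIntegers.ext (mixedEmbedding_injective K h.1))
    (RingOfIntegers.ext (mixedEmbedding_injective K h.2))

theorem exists_fundamentalDomain_pair {I : Ideal (𝓞 K)} (hI : I ≠ ⊥) :
    ∃ F : Set (mixedSpace K × mixedSpace K), MeasurableSet F ∧
      (∃ R, 0 ≤ R ∧ ∀ f ∈ F, ‖f‖ ≤ R) ∧
      volume F = ENNReal.ofReal ((Ideal.absNorm I : ℝ) ^ 10 * integerCovolume K ^ 2) ∧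
      (∀ x, ∃ p : 𝓞 K × 𝓞 K, (p.1 ∈ I ^ 4 ∧ p.2 ∈ I ^ 6) ∧ ∃ f ∈ F, pairEmb p + f = x) ∧
      ∀ p : 𝓞 K × 𝓞 K, (p.1 ∈ I ^ 4 ∧ p.2 ∈ I ^ 6) → ∀ p' : 𝓞 K × 𝓞 K,
        (p'.1 ∈ I ^ 4 ∧ p'.2 ∈ I ^ 6) → ∀ f ∈ F, ∀ f' ∈ F,
        pairEmb p + f = pairEmb p' + f' → p = p' := by
  obtain ⟨F, hF, ⟨R, hR0, hR⟩, hvol, hex, huniq⟩ :=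
    exists_fundamentalDomain_ideal (pow_ne_zero 4 hI)
  obtain ⟨F', hF', ⟨R', hR0', hR'⟩, hvol', hex', huniq'⟩ :=
    exists_fundamentalDomain_ideal (pow_ne_zero 6 hI)
  refine ⟨F ×ˢ F', hF.prod hF', ⟨max R R', le_max_of_le_left hR0, fun f hf => ?_⟩, ?_, ?_, ?_⟩
  · exact max_le_max (hR _ hf.1) (hR' _ hf.2)
  · have := integerCovolume_pos (K := K)
    rw [Measure.volume_eq_prod, Measure.prod_prod, hvol, hvol',
      ← ENNReal.ofReal_mul (by positivity), map_pow, map_pow]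
    congr 1
    push_cast
    ring
  · intro x
    obtain ⟨a, ha, f, hf, h⟩ := hex x.1
    obtain ⟨a', ha', f', hf', h'⟩ := hex' x.2
    exact ⟨(a, a'), ⟨ha, ha'⟩, (f, f'), ⟨hf, hf'⟩, Prod.ext h h'⟩
  · intro p hp p' hp' f hf f' hf' h
    exact Prod.ext (huniq _ hp.1 _ hp'.1 _ hf.1 _ hf'.1 (congrArg Prod.fst h))
      (huniq' _ hp.2 _ hp'.2 _ hf.2 _ hf'.2 (congrArg Prod.snd h))

theorem finite_integers_le (X : ℝ) : {a : 𝓞 K | ∀ v : InfinitePlace K, v a ≤ X}.Finite := by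
  refine Set.Finite.of_finite_image ((Embeddings.finite_of_norm_le K ℂ X).subset ?_)
    (f := fun a : 𝓞 K => (a : K)) RingOfIntegers.coe_injective.injOn
  rintro _ ⟨a, ha, rfl⟩
  exact ⟨a.2, fun φ => ha (InfinitePlace.mk φ)⟩

variable (K) in
-- The truncated cone is bounded at every place. This gives finiteness of the count and the box that
-- contains the exceptional points.
theorem exists_normAtPlace_le_of_coneCoord : ∃ A : ℝ, 0 ≤ A ∧
    ∀ (τ : ℝ), ∀ x ∈ nonvanishing K, (∀ v ≠ w₀, |coneCoord x v| ≤ 2) → coneCoord x w₀ ≤ τ →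
      ∀ v, normAtPlace v x.1 ≤ Real.exp (4 * τ + A) ∧
        normAtPlace v x.2 ≤ Real.exp (6 * τ + A) := by
  obtain ⟨A, hA, hAx⟩ := exists_abs_logSize_sub_le K
  refine ⟨6 * (A + 1), by positivity, fun τ x hx hx2 hτ v => ?_⟩
  have hm1 : (1 : ℝ) ≤ v.mult := by exact_mod_cast mult_pos (w := v)
  have h1 := (abs_le.1 (hAx x hx2 v)).2
  have h2 : coneCoord x w₀ * v.mult ≤ τ * v.mult := by gcongr
  have h3 : placeSize v x < Real.exp (τ * v.mult + (A + 1)) := by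
    rw [← Real.log_lt_iff_lt_exp (hx v)]
    change logSize x v < _
    linarith
  rw [placeSize_lt_exp_iff] at h3
  have h4 : ∀ k : ℝ, 0 ≤ k → k ≤ 6 →
      k * (τ * v.mult + (A + 1)) / v.mult ≤ k * τ + 6 * (A + 1) := by
    intro k hk hk6
    rw [div_le_iff₀ (by linarith)]
    have h5 : k * (A + 1) ≤ 6 * (A + 1) * 1 := by nlinarith
    have h6 : 6 * (A + 1) * 1 ≤ 6 * (A + 1) * v.mult := by gcongr
    nlinarith
  exact ⟨h3.1.le.trans (Real.exp_le_exp.2 (h4 4 (by norm_num) (by norm_num))),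
    h3.2.le.trans (Real.exp_le_exp.2 (h4 6 (by norm_num) (by norm_num)))⟩

/-! ### Lattice points in shells and in the cone -/

/-- The pairs in the fundamental cone for the action of the units, with bounded height. -/
def conePoints (I : Ideal (𝓞 K)) (τ : ℝ) : Set (𝓞 K × 𝓞 K) :=
  {p | (p.1 ∈ I ^ 4 ∧ p.2 ∈ I ^ 6) ∧ pairEmb p ∈ nonvanishing K ∧
    (∀ v ≠ w₀, coneCoord (pairEmb p) v ∈ Set.Ico 0 1) ∧ coneCoord (pairEmb p) w₀ < τ}

/-- The pairs in the fundamental cone, with height between two consecutive powers of `e`. -/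
def shellPoints (I : Ideal (𝓞 K)) (τ : ℝ) : Set (𝓞 K × 𝓞 K) :=
  {p | (p.1 ∈ I ^ 4 ∧ p.2 ∈ I ^ 6) ∧ pairEmb p ∈
    shell (fun v => if v = w₀ then τ - 1 else 0) (fun v => if v = w₀ then τ else 1)}

theorem mem_shell_iff {x : mixedSpace K × mixedSpace K} {l u l' u' : ℝ} :
    x ∈ shell (fun v => if v = w₀ then l else l') (fun v => if v = w₀ then u else u') ↔
      x ∈ nonvanishing K ∧ (∀ v ≠ w₀, coneCoord x v ∈ Set.Ico l' u') ∧
        coneCoord x w₀ ∈ Set.Ico l u := by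
  refine and_congr_right fun _ => ⟨fun h => ⟨fun v hv => ?_, ?_⟩, fun h v => ?_⟩
  · simpa [hv] using h v
  · simpa using h w₀
  · by_cases hv : v = w₀
    · subst hv; simpa using h.2
    · simpa [hv] using h.1 v hv

theorem abs_le_two_of_mem_Ico {c : ℝ} (h : c ∈ Set.Ico (0 : ℝ) 1) : |c| ≤ 2 :=
  abs_le.2 ⟨by linarith [h.1], by linarith [h.2]⟩

theorem finite_conePoints (I : Ideal (𝓞 K)) (τ : ℝ) : (conePoints I τ).Finite := by
  obtain ⟨A, -, hA⟩ := exists_normAtPlace_le_of_coneCoord K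
  refine ((finite_integers_le (K := K) (Real.exp (4 * τ + A))).prod
    (finite_integers_le (Real.exp (6 * τ + A)))).subset ?_
  rintro p ⟨-, hp, hc, hτ⟩
  have h := hA τ _ hp (fun v hv => abs_le_two_of_mem_Ico (hc v hv)) hτ.le
  simp only [pairEmb, normAtPlace_apply] at h
  exact ⟨fun v => (h v).1, fun v => (h v).2⟩

theorem shellPoints_subset (I : Ideal (𝓞 K)) (τ : ℝ) : shellPoints I τ ⊆ conePoints I τ := by
  rintro p ⟨hp, h⟩
  rw [mem_shell_iff] at h
  exact ⟨hp, h.1, h.2.1, h.2.2.2⟩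

theorem ncard_conePoints_sub (I : Ideal (𝓞 K)) (τ : ℝ) :
    ((conePoints I τ).ncard : ℝ) - (conePoints I (τ - 1)).ncard = (shellPoints I τ).ncard := by
  have hu : conePoints I τ = conePoints I (τ - 1) ∪ shellPoints I τ := by
    ext p
    simp only [conePoints, shellPoints, mem_shell_iff, Set.mem_union, Set.mem_ofPred_eq,
      Set.mem_Ico (a := τ - 1)]
    by_cases h : coneCoord (pairEmb p) w₀ < τ - 1
    · have : coneCoord (pairEmb p) w₀ < τ := by linarith
      tauto
    · have := not_lt.1 h
      tauto
  have hd : Disjoint (conePoints I (τ - 1)) (shellPoints I τ) := by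
    refine Set.disjoint_left.2 fun p hp hp' => ?_
    have := (mem_shell_iff).1 hp'.2
    exact absurd hp.2.2.2 (not_lt.2 this.2.2.1)
  rw [hu, Set.ncard_union_eq hd (finite_conePoints _ _)
    ((finite_conePoints I τ).subset (shellPoints_subset I τ))]
  push_cast
  ring

instance : MeasurableAdd (mixedSpace K × mixedSpace K) := ContinuousAdd.measurableAdd

instance : (volume : Measure (mixedSpace K × mixedSpace K)).IsAddLeftInvariant :=
  Measure.prod.instIsAddLeftInvariant

/-- The normalized volume of a thickened shell is a differentiable function of the thickness η, with
value 1 - e^(-a) at η = 0; hence the linear error bound. -/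
theorem exists_abs_shellVolume_sub_le (a : ℝ) (k : ℕ) : ∃ C ε : ℝ, 0 ≤ C ∧ 0 < ε ∧
    ∀ η, |η| < ε →
      |(Real.exp (a * η) - Real.exp (-a * (1 + η))) * (1 + 2 * η) ^ k -
        (1 - Real.exp (-a))| ≤ C * |η| := by
  let g : ℝ → ℝ := fun η => (Real.exp (a * η) - Real.exp (-a * (1 + η))) * (1 + 2 * η) ^ k
  have hg : DifferentiableAt ℝ g 0 := by fun_prop
  have h := hg.isBigO_sub
  obtain ⟨C, hC, hb⟩ := h.exists_pos
  obtain ⟨ε, hε, h⟩ := Metric.eventually_nhds_iff.1 hb.bound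
  refine ⟨C, ε, hC.le, hε, fun η hη => ?_⟩
  have := h (y := η) (by simpa using hη)
  simpa [g] using this

/-- Negative η is allowed, so that the same formula serves the shrunken shell; η ≥ -1/2 keeps the
sides of the box nonnegative. -/
theorem volume_shell_thickened {τ η : ℝ} (hη : -(1 / 2) ≤ η) :
    volume (shell (K := K) (fun v => if v = w₀ then τ - 1 - η else 0 - η)
      (fun v => if v = w₀ then τ + η else 1 + η)) =
    ENNReal.ofReal (shellConst K * Real.exp (10 * finrank ℚ K * τ) *
      ((Real.exp (10 * finrank ℚ K * η) - Real.exp (-(10 * finrank ℚ K) * (1 + η))) *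
        (1 + 2 * η) ^ (Finset.univ.erase (w₀ : InfinitePlace K)).card)) := by
  rw [volume_shell]
  · simp only [if_true]
    rw [Finset.prod_congr rfl (g := fun _ => 1 + 2 * η), Finset.prod_const]
    · congr 1
      have h1 : Real.exp (10 * finrank ℚ K * (τ + η)) =
          Real.exp (10 * finrank ℚ K * τ) * Real.exp (10 * finrank ℚ K * η) := by
        rw [← Real.exp_add]; ring_nf
      have h2 : Real.exp (10 * finrank ℚ K * (τ - 1 - η)) =
          Real.exp (10 * finrank ℚ K * τ) * Real.exp (-(10 * finrank ℚ K) * (1 + η)) := by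
        rw [← Real.exp_add]; ring_nf
      rw [h1, h2]
      ring
    · intro v hv
      simp only [Finset.ne_of_mem_erase hv, if_false]
      ring
  · intro v
    split_ifs <;> linarith

/-- The number of lattice points in a shell is its volume up to an error term of the size of its
boundary. -/
theorem exists_abs_ncard_shellPoints_sub_le {I : Ideal (𝓞 K)} (hI : I ≠ ⊥) :
    ∃ C τ₀ : ℝ, 0 ≤ C ∧ ∀ τ ≥ τ₀,
      |(shellPoints I τ).ncard * ((Ideal.absNorm I : ℝ) ^ 10 * integerCovolume K ^ 2) -
        shellConst K * (Real.exp (10 * finrank ℚ K * τ) - Real.exp (10 * finrank ℚ K * (τ - 1)))| ≤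
      C * Real.exp ((10 * finrank ℚ K - 4) * τ) := by
  obtain ⟨F, hF, ⟨R, hR0, hR⟩, hvol, hex, huniq⟩ := exists_fundamentalDomain_pair hI
  obtain ⟨C₁, τ₁, hC₁, hpert⟩ := exists_coneCoord_sub_le K hR0
  obtain ⟨C₂, ε, hC₂, hε, hg⟩ := exists_abs_shellVolume_sub_le (10 * finrank ℚ K)
    (Finset.univ.erase (w₀ : InfinitePlace K)).card
  have hV := shellConst_pos (K := K)
  have hcov := integerCovolume_pos (K := K)
  have hN : (0 : ℝ) < Ideal.absNorm I := by
    exact_mod_cast Nat.pos_of_ne_zero (mt Ideal.absNorm_eq_zero_iff.1 hI)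
  set cov : ℝ := (Ideal.absNorm I : ℝ) ^ 10 * integerCovolume K ^ 2 with hcovdef
  have hcov0 : 0 < cov := by positivity
  have hlim : Filter.Tendsto (fun τ : ℝ => C₁ * Real.exp (-4 * (τ - 1))) Filter.atTop
      (nhds (C₁ * 0)) := by
    refine Filter.Tendsto.const_mul _ (Real.tendsto_exp_atBot.comp ?_)
    exact (Filter.tendsto_atTop_add_const_right _ (-1 : ℝ)
      Filter.tendsto_id).const_mul_atTop_of_neg (by norm_num)
  rw [mul_zero] at hlim
  obtain ⟨τ₂, hτ₂⟩ := Filter.eventually_atTop.1 ((hlim.eventually (eventually_lt_nhds hε)).and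
    (hlim.eventually (eventually_le_nhds (by norm_num : (0 : ℝ) < 1 / 2))))
  -- Points of the shell have level at least τ - 1, so the thickness is C₁e^(-4(τ-1)); this is the
  -- origin of the factor e⁴.
  refine ⟨shellConst K * C₂ * (C₁ * Real.exp 4), max (τ₁ + 1) τ₂, by positivity, fun τ hτ => ?_⟩
  set η := C₁ * Real.exp (-4 * (τ - 1)) with hη
  have hη0 : 0 ≤ η := by positivity
  obtain ⟨hηε, hη2⟩ := hτ₂ τ ((le_max_right _ _).trans hτ)
  have hτ1 : τ₁ ≤ τ - 1 := by linarith [(le_max_left _ _).trans hτ]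
  have hfin : (shellPoints I τ).Finite := (finite_conePoints I τ).subset (shellPoints_subset I τ)
  have hpert' : ∀ x ∈ nonvanishing K, (∀ v ≠ w₀, coneCoord x v ∈ Set.Ico (0 : ℝ) 1) →
      τ - 1 ≤ coneCoord x w₀ → ∀ y, ‖y - x‖ ≤ R → y ∈ nonvanishing K ∧
      ∀ v, |coneCoord y v - coneCoord x v| ≤ η := fun x hx h1 h2 y hy =>
    hpert (τ - 1) hτ1 x hx (fun v hv => abs_le_two_of_mem_Ico (h1 v hv)) h2 y hy
  have hScount : (pairEmb '' shellPoints I τ).Countable := (hfin.image _).countable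
  have hcard : ((pairEmb '' shellPoints I τ).encard : ℝ≥0∞) =
      ENNReal.ofReal ((shellPoints I τ).ncard : ℝ) := by
    rw [pairEmb_injective.encard_image, ← hfin.cast_ncard_eq]
    simp
  -- Translates of `F` by points of the shell are disjoint and stay in the shell thickened by η.
  have hup : (shellPoints I τ).ncard * cov ≤ shellConst K * Real.exp (10 * finrank ℚ K * τ) *
      ((Real.exp (10 * finrank ℚ K * η) - Real.exp (-(10 * finrank ℚ K) * (1 + η))) *
        (1 + 2 * η) ^ (Finset.univ.erase (w₀ : InfinitePlace K)).card) := by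
    have h := encard_mul_measure_le (μ := volume) (S := pairEmb '' shellPoints I τ)
      (B := shell (K := K) (fun v => if v = w₀ then τ - 1 - η else 0 - η)
        (fun v => if v = w₀ then τ + η else 1 + η)) hF hScount ?_ ?_
    · rw [hcard, hvol, volume_shell_thickened (by linarith),
        ← ENNReal.ofReal_mul (Nat.cast_nonneg _)] at h
      refine (ENNReal.ofReal_le_ofReal_iff ?_).1 h
      refine mul_nonneg (by positivity) (mul_nonneg (sub_nonneg.2 (Real.exp_le_exp.2 ?_))
        (by positivity))
      have : (0 : ℝ) ≤ 10 * finrank ℚ K := by positivity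
      nlinarith
    · rintro _ ⟨p, hp, rfl⟩ _ ⟨p', hp', rfl⟩ f hf f' hf' h
      rw [huniq p hp.1 p' hp'.1 f hf f' hf' h]
    · rintro _ ⟨p, hp, rfl⟩ f hf
      obtain ⟨h1, h2, h3⟩ := mem_shell_iff.1 hp.2
      obtain ⟨h4, h5⟩ := hpert' _ h1 h2 h3.1 (pairEmb p + f) (by simpa using hR f hf)
      refine mem_shell_iff.2 ⟨h4, fun v hv => ?_, ?_⟩
      · have := abs_le.1 (h5 v)
        have h6 := h2 v hv
        exact ⟨by linarith [h6.1], by linarith [h6.2]⟩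
      · have := abs_le.1 (h5 w₀)
        exact ⟨by linarith [h3.1], by linarith [h3.2]⟩
  -- A point of the shell shrunken by η lies in a translate of `F` whose lattice point is in the
  -- original shell.
  have hlow : shellConst K * Real.exp (10 * finrank ℚ K * τ) *
      ((Real.exp (10 * finrank ℚ K * (-η)) - Real.exp (-(10 * finrank ℚ K) * (1 + -η))) *
        (1 + 2 * -η) ^ (Finset.univ.erase (w₀ : InfinitePlace K)).card) ≤
      (shellPoints I τ).ncard * cov := by
    have h := measure_le_encard_mul (μ := volume) (S := pairEmb '' shellPoints I τ) (F := F)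
      (A := shell (K := K) (fun v => if v = w₀ then τ - 1 - -η else 0 - -η)
        (fun v => if v = w₀ then τ + -η else 1 + -η)) hScount ?_
    · rw [hcard, hvol, volume_shell_thickened (by linarith),
        ← ENNReal.ofReal_mul (Nat.cast_nonneg _)] at h
      exact (ENNReal.ofReal_le_ofReal_iff (by positivity)).1 h
    · intro x hx
      obtain ⟨p, hp, f, hf, rfl⟩ := hex x
      obtain ⟨h1, h2, h3⟩ := mem_shell_iff.1 hx
      obtain ⟨h4, h5⟩ := hpert' _ h1 (fun v hv => ⟨by linarith [(h2 v hv).1], by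
        linarith [(h2 v hv).2]⟩) (by linarith [h3.1]) (pairEmb p) (by simpa using hR f hf)
      refine ⟨_, ⟨p, ⟨hp, mem_shell_iff.2 ⟨h4, fun v hv => ?_, ?_⟩⟩, rfl⟩, f, hf, rfl⟩
      · have := abs_le.1 (h5 v)
        have h6 := h2 v hv
        exact ⟨by linarith [h6.1], by linarith [h6.2]⟩
      · have := abs_le.1 (h5 w₀)
        exact ⟨by linarith [h3.1], by linarith [h3.2]⟩
  have hmain : shellConst K *
      (Real.exp (10 * finrank ℚ K * τ) - Real.exp (10 * finrank ℚ K * (τ - 1))) =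
      shellConst K * Real.exp (10 * finrank ℚ K * τ) * (1 - Real.exp (-(10 * finrank ℚ K))) := by
    rw [mul_assoc (shellConst K), mul_sub (Real.exp _), ← Real.exp_add]
    ring_nf
  have hP : 0 ≤ shellConst K * Real.exp (10 * finrank ℚ K * τ) := by positivity
  have herr : shellConst K * Real.exp (10 * finrank ℚ K * τ) * (C₂ * η) =
      shellConst K * C₂ * (C₁ * Real.exp 4) * Real.exp ((10 * finrank ℚ K - 4) * τ) := by
    have : Real.exp (10 * finrank ℚ K * τ) * Real.exp (-4 * (τ - 1)) =
        Real.exp 4 * Real.exp ((10 * finrank ℚ K - 4) * τ) := by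
      rw [← Real.exp_add, ← Real.exp_add]; ring_nf
    rw [hη]
    linear_combination shellConst K * C₂ * C₁ * this
  have g1 := abs_le.1 (hg η (by rwa [abs_of_nonneg hη0]))
  have g2 := abs_le.1 (hg (-η) (by rwa [abs_neg, abs_of_nonneg hη0]))
  rw [abs_neg, abs_of_nonneg hη0] at g2
  rw [abs_of_nonneg hη0] at g1
  rw [hmain, ← herr, abs_le]
  constructor
  · have := mul_le_mul_of_nonneg_left g2.1 hP
    linarith
  · have := mul_le_mul_of_nonneg_left g1.2 hP
    linarith

/-- Telescoping in unit steps down to τ₀ gives a geometric series with ratio e^(-s) < 1. The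
constant D is chosen so that C + D e^(-s) ≤ D, which closes the induction. -/
theorem exists_abs_le_exp_of_abs_sub_le {e : ℝ → ℝ} {s C C' τ₀ : ℝ} (hs : 0 < s)
    (hstep : ∀ τ ≥ τ₀, |e τ - e (τ - 1)| ≤ C * Real.exp (s * τ))
    (hinit : ∀ τ < τ₀, |e τ| ≤ C' * Real.exp (s * τ)) :
    ∃ D, ∀ τ, |e τ| ≤ D * Real.exp (s * τ) := by
  have hq : Real.exp (-s) < 1 := Real.exp_lt_one_iff.2 (by linarith)
  refine ⟨max C' (C / (1 - Real.exp (-s))), ?_⟩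
  set D := max C' (C / (1 - Real.exp (-s)))
  have hD : C + D * Real.exp (-s) ≤ D := by
    have := (div_le_iff₀ (by linarith)).1 (le_max_right C' (C / (1 - Real.exp (-s))))
    change C ≤ D * _ at this
    linarith
  have key : ∀ n : ℕ, ∀ τ < τ₀ + n, |e τ| ≤ D * Real.exp (s * τ) := by
    intro n
    induction n with
    | zero =>
      intro τ hτ
      refine (hinit τ (by simpa using hτ)).trans ?_
      gcongr
      exact le_max_left _ _
    | succ n ih =>
      intro τ hτ
      push_cast at hτ
      by_cases h : τ < τ₀
      · refine (hinit τ h).trans ?_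
        gcongr
        exact le_max_left _ _
      · have h1 := hstep τ (not_lt.1 h)
        have h2 := ih (τ - 1) (by linarith)
        have h3 : Real.exp (s * (τ - 1)) = Real.exp (-s) * Real.exp (s * τ) := by
          rw [← Real.exp_add]; ring_nf
        calc |e τ| = |(e τ - e (τ - 1)) + e (τ - 1)| := by ring_nf
          _ ≤ |e τ - e (τ - 1)| + |e (τ - 1)| := abs_add_le _ _
          _ ≤ C * Real.exp (s * τ) + D * (Real.exp (-s) * Real.exp (s * τ)) := by
              rw [← h3]; linarith
          _ = (C + D * Real.exp (-s)) * Real.exp (s * τ) := by ring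
          _ ≤ _ := by gcongr
  intro τ
  obtain ⟨n, hn⟩ := exists_nat_gt (τ - τ₀)
  exact key n τ (by linarith)

theorem pairEmb_mem_nonvanishing {p : 𝓞 K × 𝓞 K} (hp : p ≠ 0) : pairEmb p ∈ nonvanishing K := by
  intro v
  have : p.1 ≠ 0 ∨ p.2 ≠ 0 := by
    by_contra! h
    exact hp (Prod.ext h.1 h.2)
  rcases this with h | h
  · refine lt_max_of_lt_left ?_
    have : 0 < v (p.1 : K) := InfinitePlace.pos_iff.2 (RingOfIntegers.coe_ne_zero_iff.2 h)
    simp only [pairEmb, normAtPlace_apply]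
    positivity
  · refine lt_max_of_lt_right ?_
    have : 0 < v (p.2 : K) := InfinitePlace.pos_iff.2 (RingOfIntegers.coe_ne_zero_iff.2 h)
    simp only [pairEmb, normAtPlace_apply]
    positivity

theorem ne_zero_of_pairEmb_mem_nonvanishing {p : 𝓞 K × 𝓞 K} (hp : pairEmb p ∈ nonvanishing K) :
    p ≠ 0 := by
  rintro rfl
  have := hp w₀
  simp [pairEmb, placeSize, mult_ne_zero] at this

theorem one_le_prod_rpow {a : 𝓞 K} (ha : a ≠ 0) (k : ℝ) (hk : 0 ≤ k) :
    1 ≤ ∏ v : InfinitePlace K, (v (a : K) ^ v.mult) ^ k := by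
  rw [Real.finsetProd_rpow _ _ fun v _ => by positivity, prod_eq_abs_norm]
  refine Real.one_le_rpow ?_ hk
  have h1 : Algebra.norm ℤ a ≠ 0 := Algebra.norm_ne_zero_iff.2 ha
  rw [← Algebra.coe_norm_int]
  exact_mod_cast Int.one_le_abs h1

/-- A nonzero integer has norm at least 1 in absolute value, so the product of the sizes is at least
1. In consequence the truncated cone has no lattice points for τ ≤ 0. -/
theorem coneCoord_nonneg {p : 𝓞 K × 𝓞 K} (hp : pairEmb p ∈ nonvanishing K) :
    0 ≤ coneCoord (pairEmb p) w₀ := by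
  have hd : (0 : ℝ) < finrank ℚ K := by exact_mod_cast finrank_pos
  have h0 := ne_zero_of_pairEmb_mem_nonvanishing hp
  have : p.1 ≠ 0 ∨ p.2 ≠ 0 := by
    by_contra! h
    exact h0 (Prod.ext h.1 h.2)
  have h1 : 1 ≤ ∏ v, placeSize v (pairEmb p) := by
    rcases this with h | h
    · refine (one_le_prod_rpow h (1 / 4) (by norm_num)).trans ?_
      refine Finset.prod_le_prod (fun v _ => by positivity) fun v _ => ?_
      simp only [placeSize, pairEmb, normAtPlace_apply]
      exact le_max_left _ _
    · refine (one_le_prod_rpow h (1 / 6) (by norm_num)).trans ?_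
      refine Finset.prod_le_prod (fun v _ => by positivity) fun v _ => ?_
      simp only [placeSize, pairEmb, normAtPlace_apply]
      exact le_max_right _ _
  have h2 : 0 ≤ finrank ℚ K * coneCoord (pairEmb p) w₀ := by
    rw [← sum_logSize]
    unfold logSize
    rw [← Real.log_prod fun v _ => (hp v).ne']
    exact Real.log_nonneg h1
  exact nonneg_of_mul_nonneg_right h2 hd

theorem conePoints_eq_empty (I : Ideal (𝓞 K)) {τ : ℝ} (hτ : τ ≤ 0) : conePoints I τ = ∅ := by
  refine Set.eq_empty_of_forall_notMem fun p hp => ?_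
  linarith [coneCoord_nonneg hp.2.1, hp.2.2.2]

/-- The number of lattice points in the fundamental cone with bounded height. -/
theorem exists_abs_ncard_conePoints_sub_le {I : Ideal (𝓞 K)} (hI : I ≠ ⊥) :
    ∃ C : ℝ, ∀ τ,
      |(conePoints I τ).ncard * ((Ideal.absNorm I : ℝ) ^ 10 * integerCovolume K ^ 2) -
        shellConst K * Real.exp (10 * finrank ℚ K * τ)| ≤
      C * Real.exp ((10 * finrank ℚ K - 4) * τ) := by
  obtain ⟨C, τ₀, hC, h⟩ := exists_abs_ncard_shellPoints_sub_le hI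
  set cov : ℝ := (Ideal.absNorm I : ℝ) ^ 10 * integerCovolume K ^ 2
  have hcov : 0 ≤ cov := by positivity
  have hV := shellConst_pos (K := K)
  have hd : (1 : ℝ) ≤ finrank ℚ K := by exact_mod_cast (finrank_pos : 0 < finrank ℚ K)
  have hs : (0 : ℝ) < 10 * finrank ℚ K - 4 := by linarith
  -- Below τ₀ the count vanishes for τ ≤ 0; otherwise it is at most its value at τ₀ while the
  -- exponential is at least 1. The main term is the error exponential times e^(4τ) ≤ e^(4|τ₀|).
  refine exists_abs_le_exp_of_abs_sub_le (C := C) (τ₀ := τ₀)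
    (C' := (conePoints I τ₀).ncard * cov + shellConst K * Real.exp (4 * |τ₀|)) hs
    (fun τ hτ => ?_) fun τ hτ => ?_
  · convert h τ hτ using 2
    rw [← ncard_conePoints_sub]
    ring
  · have h1 : Real.exp (10 * finrank ℚ K * τ) ≤
        Real.exp (4 * |τ₀|) * Real.exp ((10 * finrank ℚ K - 4) * τ) := by
      rw [← Real.exp_add]
      refine Real.exp_le_exp.2 ?_
      have := le_abs_self τ₀
      linarith
    have h2 : (conePoints I τ).ncard * cov ≤
        (conePoints I τ₀).ncard * cov * Real.exp ((10 * finrank ℚ K - 4) * τ) := by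
      by_cases h0 : τ ≤ 0
      · rw [conePoints_eq_empty I h0]
        simp only [Set.ncard_empty, Nat.cast_zero, zero_mul]
        positivity
      · have h3 : (1 : ℝ) ≤ Real.exp ((10 * finrank ℚ K - 4) * τ) :=
          Real.one_le_exp (mul_nonneg hs.le (not_le.1 h0).le)
        have h4 : ((conePoints I τ).ncard : ℝ) ≤ (conePoints I τ₀).ncard := by
          have hsub : conePoints I τ ⊆ conePoints I τ₀ := fun p hp =>
            ⟨hp.1, hp.2.1, hp.2.2.1, hp.2.2.2.trans hτ⟩
          exact_mod_cast Set.ncard_le_ncard hsub (finite_conePoints I τ₀)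
        calc _ ≤ (conePoints I τ₀).ncard * cov * 1 := by rw [mul_one]; gcongr
          _ ≤ _ := by gcongr
    have h5 : 0 ≤ (conePoints I τ).ncard * cov := by positivity
    have h6 : 0 ≤ shellConst K * Real.exp (10 * finrank ℚ K * τ) := by positivity
    have h7 := mul_le_mul_of_nonneg_left h1 hV.le
    have h8 : 0 ≤ (conePoints I τ₀).ncard * cov * Real.exp ((10 * finrank ℚ K - 4) * τ) := by
      positivity
    have h9 : 0 ≤ shellConst K *
      (Real.exp (4 * |τ₀|) * Real.exp ((10 * finrank ℚ K - 4) * τ)) := by positivity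
    rw [abs_le, add_mul, mul_assoc (shellConst K)]
    constructor <;> linarith

/-! ### Points with a vanishing coordinate or vanishing discriminant -/

variable (K) in
-- Disjoint translates of a fundamental domain fit into a box of side X + R + 1 ≤ (R + 2)X.
theorem exists_ncard_integers_le : ∃ C : ℝ, 0 ≤ C ∧ ∀ X : ℝ, 1 ≤ X →
    ({a : 𝓞 K | ∀ v : InfinitePlace K, v a ≤ X}.ncard : ℝ) ≤ C * X ^ finrank ℚ K := by
  obtain ⟨F, hF, ⟨R, hR0, hR⟩, hvol, -, huniq⟩ :=
    exists_fundamentalDomain_ideal (K := K) (J := ⊤) top_ne_bot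
  have hcov := integerCovolume_pos (K := K)
  have hone : ((Ideal.absNorm (⊤ : Ideal (𝓞 K)) : ℕ) : ℝ) = 1 := by simp
  rw [hone, one_mul] at hvol
  set V : ℝ := 2 ^ nrRealPlaces K * Real.pi ^ nrComplexPlaces K with hV
  have hV0 : 0 < V := by positivity
  refine ⟨V * (R + 2) ^ finrank ℚ K / integerCovolume K, by positivity, fun X hX => ?_⟩
  set S := {a : 𝓞 K | ∀ v : InfinitePlace K, v a ≤ X} with hS
  have hfin : S.Finite := finite_integers_le X
  have hinj : Function.Injective fun a : 𝓞 K => mixedEmbedding K a := fun a b h =>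
    RingOfIntegers.ext (mixedEmbedding_injective K h)
  let f : InfinitePlace K → ℝ≥0 := fun _ => (X + R + 1).toNNReal
  have hf : ((X + R + 1).toNNReal : ℝ) = X + R + 1 := Real.coe_toNNReal _ (by positivity)
  have h := encard_mul_measure_le (μ := volume) (S := (fun a : 𝓞 K => mixedEmbedding K a) '' S)
    (B := convexBodyLT K f) hF (hfin.image _).countable
    (by
      rintro _ ⟨a, -, rfl⟩ _ ⟨a', -, rfl⟩ f hf f' hf' h
      simp only [huniq a trivial a' trivial f hf f' hf' h])
    (by
      rintro _ ⟨a, ha, rfl⟩ y hy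
      rw [mem_convexBodyLT_iff]
      intro v
      rw [hf]
      have h1 := normAtPlace_add_le v (mixedEmbedding K a) y
      have h2 := (normAtPlace_le_norm v y).trans (hR y hy)
      rw [normAtPlace_apply] at h1
      have h3 := ha v
      linarith)
  rw [hinj.encard_image, ← hfin.cast_ncard_eq, hvol, convexBodyLT_volume] at h
  have h4 : ((convexBodyLTFactor K : ℝ≥0) : ℝ≥0∞) * ((∏ v, f v ^ v.mult : ℝ≥0) : ℝ≥0∞) =
      ENNReal.ofReal (V * (X + R + 1) ^ finrank ℚ K) := by
    rw [Finset.prod_pow_eq_pow_sum, sum_mult_eq, ← ENNReal.ofReal_coe_nnreal,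
      ← ENNReal.ofReal_coe_nnreal, ← ENNReal.ofReal_mul (by positivity), coe_convexBodyLTFactor,
      NNReal.coe_pow, hf]
  have h5 : (((S.ncard : ℕ∞)) : ℝ≥0∞) = ENNReal.ofReal (S.ncard : ℝ) := by simp
  rw [h4, h5, ← ENNReal.ofReal_mul (Nat.cast_nonneg _),
    ENNReal.ofReal_le_ofReal_iff (by positivity)] at h
  rw [div_mul_eq_mul_div, le_div_iff₀ hcov, mul_assoc, ← mul_pow]
  refine h.trans ?_
  gcongr
  nlinarith

/-- The pairs in the fundamental cone with a vanishing coordinate or a vanishing discriminant. -/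
def exceptionalPoints (I : Ideal (𝓞 K)) (τ : ℝ) : Set (𝓞 K × 𝓞 K) :=
  {p ∈ conePoints I τ | p.1 = 0 ∨ p.2 = 0 ∨ 4 * p.1 ^ 3 + 27 * p.2 ^ 2 = 0}

/-- For a fixed first coordinate a, the second is a root of the cubic X(27X² + 4a³), which is
nonzero even for a = 0. -/
theorem ncard_le_three_mul {S : Set (𝓞 K × 𝓞 K)} {A : Set (𝓞 K)} (hS : S.Finite) (hA : A.Finite)
    (hSA : ∀ p ∈ S, p.1 ∈ A) (h : ∀ p ∈ S, p.2 = 0 ∨ 4 * p.1 ^ 3 + 27 * p.2 ^ 2 = 0) :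
    S.ncard ≤ 3 * A.ncard := by
  rw [Set.ncard_eq_toFinset_card S hS, Set.ncard_eq_toFinset_card A hA]
  calc hS.toFinset.card ≤ 3 * (hS.toFinset.image Prod.fst).card := by
        refine Finset.card_le_mul_card_image _ 3 fun a _ => ?_
        let q : Polynomial (𝓞 K) :=
          Polynomial.X * (Polynomial.C 27 * Polynomial.X ^ 2 + Polynomial.C (4 * a ^ 3))
        have hdeg : (Polynomial.C 27 * Polynomial.X ^ 2 +
            Polynomial.C (4 * a ^ 3)).natDegree = 2 := by
          rw [Polynomial.natDegree_add_C, Polynomial.natDegree_C_mul_X_pow 2 (27 : 𝓞 K)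
            (by norm_num)]
        have hne : (Polynomial.C 27 * Polynomial.X ^ 2 + Polynomial.C (4 * a ^ 3)) ≠ 0 := by
          intro h0
          rw [h0] at hdeg
          simp at hdeg
        have hq : q ≠ 0 := mul_ne_zero Polynomial.X_ne_zero hne
        have hqd : q.natDegree = 3 := by
          rw [Polynomial.natDegree_mul Polynomial.X_ne_zero hne, hdeg, Polynomial.natDegree_X]
        calc _ ≤ q.roots.toFinset.card := by
              refine Finset.card_le_card_of_injOn Prod.snd ?_ ?_
              · intro p hp
                simp only [Finset.coe_filter, Set.Finite.mem_toFinset, Set.mem_ofPred_eq] at hp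
                simp only [Finset.mem_coe, Multiset.mem_toFinset]
                rw [Polynomial.mem_roots hq, Polynomial.IsRoot.def]
                simp only [q, Polynomial.eval_mul, Polynomial.eval_X, Polynomial.eval_add,
                  Polynomial.eval_C, Polynomial.eval_pow]
                rcases h p hp.1 with h | h
                · rw [h, zero_mul]
                · rw [← hp.2]
                  linear_combination p.2 * h
              · intro p hp p' hp' hpp
                simp only [Finset.coe_filter, Set.mem_ofPred_eq] at hp hp'
                exact Prod.ext (hp.2.trans hp'.2.symm) hpp
          _ ≤ _ := (Multiset.toFinset_card_le _).trans ((Polynomial.card_roots' q).trans hqd.le)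
    _ ≤ _ := by
        gcongr
        intro a ha
        obtain ⟨p, hp, rfl⟩ := Finset.mem_image.1 ha
        simpa using hSA p (by simpa using hp)

theorem exists_ncard_exceptionalPoints_le (I : Ideal (𝓞 K)) : ∃ C : ℝ, 0 ≤ C ∧ ∀ τ : ℝ,
    ((exceptionalPoints I τ).ncard : ℝ) ≤ C * Real.exp ((10 * finrank ℚ K - 4) * τ) := by
  obtain ⟨C, hC, hcount⟩ := exists_ncard_integers_le K
  obtain ⟨A, hA, hbound⟩ := exists_normAtPlace_le_of_coneCoord K
  have hd : (1 : ℝ) ≤ finrank ℚ K := by exact_mod_cast (finrank_pos : 0 < finrank ℚ K)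
  refine ⟨4 * C * Real.exp (A * finrank ℚ K), by positivity, fun τ => ?_⟩
  by_cases hτ : τ ≤ 0
  · have : exceptionalPoints I τ = ∅ := by
      rw [exceptionalPoints, conePoints_eq_empty I hτ]
      simp
    rw [this]
    simp only [Set.ncard_empty, Nat.cast_zero]
    positivity
  replace hτ := (not_le.1 hτ).le
  let B : ℝ → Set (𝓞 K) := fun X => {a | ∀ v : InfinitePlace K, v a ≤ X}
  have hcone : ∀ p ∈ conePoints I τ, p.1 ∈ B (Real.exp (4 * τ + A)) ∧
      p.2 ∈ B (Real.exp (6 * τ + A)) := by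
    rintro p ⟨-, hp, hc, hτ⟩
    have h := hbound τ _ hp (fun v hv => abs_le_two_of_mem_Ico (hc v hv)) hτ.le
    simp only [pairEmb, normAtPlace_apply] at h
    exact ⟨fun v => (h v).1, fun v => (h v).2⟩
  let S₁ := {p ∈ conePoints I τ | p.1 = 0}
  let S₂ := {p ∈ conePoints I τ | p.2 = 0 ∨ 4 * p.1 ^ 3 + 27 * p.2 ^ 2 = 0}
  have hfin := finite_conePoints I τ
  have hS : exceptionalPoints I τ ⊆ S₁ ∪ S₂ := by
    rintro p ⟨hp, h | h⟩
    · exact Or.inl ⟨hp, h⟩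
    · exact Or.inr ⟨hp, h⟩
  have h1 : S₁.ncard ≤ (B (Real.exp (6 * τ + A))).ncard := by
    refine Set.ncard_le_ncard_of_injOn Prod.snd (fun p hp => (hcone p hp.1).2) ?_
      (finite_integers_le _)
    intro p hp p' hp' h
    exact Prod.ext (hp.2.trans hp'.2.symm) h
  have h2 : S₂.ncard ≤ 3 * (B (Real.exp (4 * τ + A))).ncard :=
    ncard_le_three_mul (hfin.subset (Set.sep_subset _ _)) (finite_integers_le _)
      (fun p hp => (hcone p hp.1).1) fun p hp => hp.2
  have h3 : ∀ k : ℝ, 0 ≤ k → k ≤ 6 → ((B (Real.exp (k * τ + A))).ncard : ℝ) ≤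
      C * (Real.exp (A * finrank ℚ K) * Real.exp ((10 * finrank ℚ K - 4) * τ)) := by
    intro k hk hk6
    refine (hcount _ (Real.one_le_exp (by positivity))).trans ?_
    gcongr
    rw [← Real.exp_nat_mul, ← Real.exp_add]
    refine Real.exp_le_exp.2 ?_
    -- 6d ≤ 10d - 4 because d ≥ 1, with equality for d = 1.
    have h4 : finrank ℚ K * k ≤ 10 * finrank ℚ K - 4 := by nlinarith
    have := mul_le_mul_of_nonneg_right h4 hτ
    linarith
  have h4 : (exceptionalPoints I τ).ncard ≤ S₁.ncard + S₂.ncard :=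
    (Set.ncard_le_ncard hS ((hfin.subset (Set.sep_subset _ _)).union
      (hfin.subset (Set.sep_subset _ _)))).trans (Set.ncard_union_le _ _)
  have h5 : ((exceptionalPoints I τ).ncard : ℝ) ≤ (B (Real.exp (6 * τ + A))).ncard +
      3 * (B (Real.exp (4 * τ + A))).ncard := by
    exact_mod_cast h4.trans (add_le_add h1 h2)
  have h6 := h3 6 (by norm_num) le_rfl
  have h7 := h3 4 (by norm_num) (by norm_num)
  linarith

/-! ### The content of an integral pair and its height -/

theorem finiteMultiplicity_asIdeal (v : HeightOneSpectrum (𝓞 K)) {I : Ideal (𝓞 K)} (hI : I ≠ ⊥) :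
    FiniteMultiplicity v.asIdeal I :=
  FiniteMultiplicity.of_prime_left v.prime hI

theorem ideal_dvd_iff_multiplicity_le {I J : Ideal (𝓞 K)} (hI : I ≠ ⊥) (hJ : J ≠ ⊥) :
    I ∣ J ↔ ∀ v : HeightOneSpectrum (𝓞 K), multiplicity v.asIdeal I ≤ multiplicity v.asIdeal J := by
  rw [UniqueFactorizationMonoid.dvd_iff_emultiplicity_le hI]
  constructor
  · intro h v
    have := h _ v.prime
    rw [(finiteMultiplicity_asIdeal v hI).emultiplicity_eq_multiplicity,
      (finiteMultiplicity_asIdeal v hJ).emultiplicity_eq_multiplicity] at this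
    exact_mod_cast this
  · intro h p hp
    let v : HeightOneSpectrum (𝓞 K) := ⟨p, Ideal.isPrime_of_prime hp, hp.ne_zero⟩
    change emultiplicity v.asIdeal I ≤ emultiplicity v.asIdeal J
    rw [(finiteMultiplicity_asIdeal v hI).emultiplicity_eq_multiplicity,
      (finiteMultiplicity_asIdeal v hJ).emultiplicity_eq_multiplicity]
    exact_mod_cast h v

theorem ideal_eq_of_multiplicity_eq {I J : Ideal (𝓞 K)} (hI : I ≠ ⊥) (hJ : J ≠ ⊥)
    (h : ∀ v : HeightOneSpectrum (𝓞 K), multiplicity v.asIdeal I = multiplicity v.asIdeal J) :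
    I = J :=
  dvd_antisymm ((ideal_dvd_iff_multiplicity_le hI hJ).2 fun v => (h v).le)
    ((ideal_dvd_iff_multiplicity_le hJ hI).2 fun v => (h v).ge)

theorem multiplicity_ideal_mul (v : HeightOneSpectrum (𝓞 K)) {I J : Ideal (𝓞 K)} (hI : I ≠ ⊥)
    (hJ : J ≠ ⊥) :
    multiplicity v.asIdeal (I * J) = multiplicity v.asIdeal I + multiplicity v.asIdeal J :=
  multiplicity_mul v.prime (finiteMultiplicity_asIdeal v (mul_ne_zero hI hJ))

theorem multiplicity_ideal_pow (v : HeightOneSpectrum (𝓞 K)) {I : Ideal (𝓞 K)} (hI : I ≠ ⊥)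
    (k : ℕ) : multiplicity v.asIdeal (I ^ k) = k * multiplicity v.asIdeal I :=
  FiniteMultiplicity.multiplicity_pow v.prime (finiteMultiplicity_asIdeal v hI)

theorem emultiplicity_asIdeal_pow (v w : HeightOneSpectrum (𝓞 K)) (n : ℕ) :
    emultiplicity w.asIdeal (v.asIdeal ^ n) = if v = w then (n : ℕ∞) else 0 := by
  split_ifs with h
  · subst h
    exact emultiplicity_pow_self v.ne_bot v.prime.not_isUnit n
  · rw [emultiplicity_eq_zero]
    intro h'
    have h1 := w.prime.dvd_of_dvd_pow h'
    have h2 : v.asIdeal ≤ w.asIdeal := Ideal.dvd_iff_le.1 h1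
    have h3 := v.isMaximal.eq_of_le w.isPrime.ne_top h2
    exact h (HeightOneSpectrum.ext h3)

theorem finite_multiplicity_ne_zero {I : Ideal (𝓞 K)} (hI : I ≠ ⊥) :
    {v : HeightOneSpectrum (𝓞 K) | multiplicity v.asIdeal I ≠ 0}.Finite := by
  refine (Ideal.finite_factors hI).subset fun v hv => ?_
  have h := (finiteMultiplicity_asIdeal v hI).pow_dvd_iff_le_multiplicity.2
    (Nat.one_le_iff_ne_zero.2 hv)
  simpa using h

/-- The largest ideal whose twelfth power divides `I`. -/
def twelfthRoot (I : Ideal (𝓞 K)) : Ideal (𝓞 K) :=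
  ∏ᶠ v : HeightOneSpectrum (𝓞 K), v.asIdeal ^ (multiplicity v.asIdeal I / 12)

theorem twelfthRoot_eq_prod {I : Ideal (𝓞 K)} (hI : I ≠ ⊥) :
    twelfthRoot I = ∏ v ∈ (finite_multiplicity_ne_zero hI).toFinset,
      v.asIdeal ^ (multiplicity v.asIdeal I / 12) := by
  refine finprod_eq_finsetProd_of_mulSupport_subset _ fun v hv => ?_
  simp only [Set.Finite.coe_toFinset, Set.mem_ofPred_eq]
  intro h
  simp [h] at hv

theorem twelfthRoot_ne_bot {I : Ideal (𝓞 K)} (hI : I ≠ ⊥) : twelfthRoot I ≠ ⊥ := by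
  rw [twelfthRoot_eq_prod hI]
  exact Finset.prod_ne_zero_iff.2 fun v _ => pow_ne_zero _ v.ne_bot

theorem multiplicity_twelfthRoot (w : HeightOneSpectrum (𝓞 K)) {I : Ideal (𝓞 K)} (hI : I ≠ ⊥) :
    multiplicity w.asIdeal (twelfthRoot I) = multiplicity w.asIdeal I / 12 := by
  refine multiplicity_eq_of_emultiplicity_eq_some ?_
  rw [twelfthRoot_eq_prod hI, Finset.emultiplicity_prod w.prime]
  simp_rw [emultiplicity_asIdeal_pow]
  rw [Finset.sum_ite_eq']
  split_ifs with h
  · rfl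
  · simp only [Set.Finite.mem_toFinset, Set.mem_ofPred_eq, not_not] at h
    simp [h]

theorem dvd_twelfthRoot_iff {I J : Ideal (𝓞 K)} (hI : I ≠ ⊥) (hJ : J ≠ ⊥) :
    J ∣ twelfthRoot I ↔ J ^ 12 ∣ I := by
  rw [ideal_dvd_iff_multiplicity_le hJ (twelfthRoot_ne_bot hI),
    ideal_dvd_iff_multiplicity_le (pow_ne_zero _ hJ) hI]
  refine forall_congr' fun v => ?_
  rw [multiplicity_twelfthRoot v hI, multiplicity_ideal_pow v hJ, Nat.le_div_iff_mul_le (by simp),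
    mul_comm]

theorem twelfthRoot_pow_mul {I J : Ideal (𝓞 K)} (hI : I ≠ ⊥) (hJ : J ≠ ⊥) :
    twelfthRoot (J ^ 12 * I) = J * twelfthRoot I := by
  have h : J ^ 12 * I ≠ ⊥ := mul_ne_zero (pow_ne_zero _ hJ) hI
  refine ideal_eq_of_multiplicity_eq (twelfthRoot_ne_bot h)
    (mul_ne_zero hJ (twelfthRoot_ne_bot hI)) fun v => ?_
  rw [multiplicity_twelfthRoot v h, multiplicity_ideal_mul v hJ (twelfthRoot_ne_bot hI),
    multiplicity_twelfthRoot v hI, multiplicity_ideal_mul v (pow_ne_zero _ hJ) hI,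
    multiplicity_ideal_pow v hJ]
  omega

/-- The largest ideal `I` such that `a ∈ I ^ 4` and `b ∈ I ^ 6`, for a pair `(a, b)`. -/
def content (p : 𝓞 K × 𝓞 K) : Ideal (𝓞 K) := twelfthRoot (Ideal.span {p.1 ^ 3, p.2 ^ 2})

theorem span_pair_ne_bot {p : 𝓞 K × 𝓞 K} (hp : p ≠ 0) :
    Ideal.span {p.1 ^ 3, p.2 ^ 2} ≠ ⊥ := by
  intro h
  rw [Ideal.span_eq_bot] at h
  have h1 := h (p.1 ^ 3) (by simp)
  have h2 := h (p.2 ^ 2) (by simp)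
  exact hp (Prod.ext (by simpa using h1) (by simpa using h2))

theorem content_ne_bot {p : 𝓞 K × 𝓞 K} (hp : p ≠ 0) : content p ≠ ⊥ :=
  twelfthRoot_ne_bot (span_pair_ne_bot hp)

/-- I¹² divides (a³, b²) exactly when (I⁴)³ divides (a)³ and (I⁶)² divides (b)²; unique
factorization removes the outer exponents. -/
theorem dvd_content_iff {p : 𝓞 K × 𝓞 K} (hp : p ≠ 0) {I : Ideal (𝓞 K)} (hI : I ≠ ⊥) :
    I ∣ content p ↔ p.1 ∈ I ^ 4 ∧ p.2 ∈ I ^ 6 := by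
  rw [content, dvd_twelfthRoot_iff (span_pair_ne_bot hp) hI, Ideal.dvd_iff_le, Ideal.span_le,
    Set.insert_subset_iff, Set.singleton_subset_iff]
  refine and_congr ?_ ?_
  · rw [SetLike.mem_coe, ← Ideal.span_singleton_le_iff_mem, ← Ideal.dvd_iff_le,
      ← Ideal.span_singleton_pow, show 12 = 4 * 3 from rfl, pow_mul,
      UniqueFactorizationMonoid.pow_dvd_pow_iff_dvd (by norm_num),
      Ideal.dvd_iff_le, Ideal.span_singleton_le_iff_mem]
  · rw [SetLike.mem_coe, ← Ideal.span_singleton_le_iff_mem, ← Ideal.dvd_iff_le,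
      ← Ideal.span_singleton_pow, show 12 = 6 * 2 from rfl, pow_mul,
      UniqueFactorizationMonoid.pow_dvd_pow_iff_dvd (by norm_num),
      Ideal.dvd_iff_le, Ideal.span_singleton_le_iff_mem]

theorem content_smul {p : 𝓞 K × 𝓞 K} (hp : p ≠ 0) {t : 𝓞 K} (ht : t ≠ 0) :
    content (t ^ 4 * p.1, t ^ 6 * p.2) = Ideal.span {t} * content p := by
  have ht' : Ideal.span {t} ≠ ⊥ := by simpa using ht
  rw [content, content, ← twelfthRoot_pow_mul (span_pair_ne_bot hp) ht', Ideal.span_singleton_pow,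
    Ideal.span_mul_span']
  congr 2
  simp only [Set.singleton_mul, Set.image_insert_eq, Set.image_singleton]
  congr 1
  · ring
  · congr 1
    ring

theorem absNorm_twelfthRoot {I : Ideal (𝓞 K)} (hI : I ≠ ⊥) :
    (Ideal.absNorm (twelfthRoot I) : ℝ) = ∏ᶠ v : HeightOneSpectrum (𝓞 K),
      (Ideal.absNorm v.asIdeal : ℝ) ^ (multiplicity v.asIdeal I / 12) := by
  rw [twelfthRoot_eq_prod hI, map_prod, finprod_eq_finsetProd_of_mulSupport_subset
    (s := (finite_multiplicity_ne_zero hI).toFinset)]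
  · push_cast
    simp
  · intro v hv
    simp only [Set.Finite.coe_toFinset, Set.mem_ofPred_eq]
    intro h
    simp [h] at hv

theorem ord_eq_multiplicity (v : HeightOneSpectrum (𝓞 K)) {a : 𝓞 K} (ha : a ≠ 0) :
    ord v (a : K) = multiplicity v.asIdeal (Ideal.span {a}) := by
  have : v.valuation K (a : K) = v.intValuation a := HeightOneSpectrum.valuation_of_algebraMap v a
  rw [ord, this, HeightOneSpectrum.intValuation_eq_exp_neg_multiplicity v ha, WithZero.log_exp,
    neg_neg]

theorem finiteSize_eq (v : HeightOneSpectrum (𝓞 K)) {a : 𝓞 K} (ha : a ≠ 0) {k w : ℕ} (hk : 0 < k)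
    (hkw : k * w = 12) : finiteSize v w (a : K) = ((Ideal.absNorm v.asIdeal : ℝ)⁻¹) ^
      (multiplicity v.asIdeal (Ideal.span {a ^ k}) / 12) := by
  have ha' : (a : K) ≠ 0 := RingOfIntegers.coe_ne_zero_iff.2 ha
  have hs : Ideal.span {a} ≠ ⊥ := by simpa using ha
  rw [finiteSize, if_neg ha', ord_eq_multiplicity v ha, ← Ideal.span_singleton_pow,
    multiplicity_ideal_pow v hs, ← hkw, Nat.mul_div_mul_left _ _ hk, ← zpow_natCast]
  push_cast
  rfl

/-- ⌊v(a)/4⌋ = ⌊v(a³)/12⌋ and ⌊v(b)/6⌋ = ⌊v(b²)/12⌋, and floor division by 12 commutes with minima.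
A zero coordinate drops out of both sides. -/
theorem max_finiteSize_eq {p : 𝓞 K × 𝓞 K} (hp : p ≠ 0) (v : HeightOneSpectrum (𝓞 K)) :
    max (finiteSize v 4 (p.1 : K)) (finiteSize v 6 (p.2 : K)) =
      ((Ideal.absNorm v.asIdeal : ℝ)⁻¹) ^
        (multiplicity v.asIdeal (Ideal.span {p.1 ^ 3, p.2 ^ 2}) / 12) := by
  have hN : (1 : ℝ) < Ideal.absNorm v.asIdeal := by
    exact_mod_cast HeightOneSpectrum.one_lt_absNorm v
  have hN0 : 0 < (Ideal.absNorm v.asIdeal : ℝ)⁻¹ := by positivity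
  have hN1 : (Ideal.absNorm v.asIdeal : ℝ)⁻¹ ≤ 1 := inv_le_one_of_one_le₀ hN.le
  by_cases ha : p.1 = 0
  · have hb : p.2 ≠ 0 := fun h => hp (Prod.ext ha h)
    rw [finiteSize_eq v hb (k := 2) (by norm_num) (by norm_num), ha]
    have h0 : finiteSize v 4 (((0 : 𝓞 K)) : K) = 0 := by simp [finiteSize]
    rw [h0, max_eq_right (by positivity)]
    congr 3
    simp
  by_cases hb : p.2 = 0
  · rw [finiteSize_eq v ha (k := 3) (by norm_num) (by norm_num), hb]
    have h0 : finiteSize v 6 (((0 : 𝓞 K)) : K) = 0 := by simp [finiteSize]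
    rw [h0, max_eq_left (by positivity)]
    congr 3
    simp
  rw [finiteSize_eq v ha (k := 3) (by norm_num) (by norm_num),
    finiteSize_eq v hb (k := 2) (by norm_num) (by norm_num), Ideal.span_insert,
    HeightOneSpectrum.multiplicity_sup v (by simpa using ha) (by simpa using hb)]
  set m := multiplicity v.asIdeal (Ideal.span {p.1 ^ 3})
  set n := multiplicity v.asIdeal (Ideal.span {p.2 ^ 2})
  rcases le_total m n with h | h
  · rw [inf_eq_left.2 h, max_eq_left]
    exact pow_le_pow_of_le_one hN0.le hN1 (Nat.div_le_div_right h)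
  · rw [inf_eq_right.2 h, max_eq_right]
    exact pow_le_pow_of_le_one hN0.le hN1 (Nat.div_le_div_right h)

/-- The height of an integral point in terms of its content. -/
theorem weightedHeight_eq {p : 𝓞 K × 𝓞 K} (hp : p ≠ 0) :
    weightedHeight 4 6 (p.1 : K) (p.2 : K) =
      (∏ v, placeSize v (pairEmb p)) / Ideal.absNorm (content p) := by
  have h1 : ∏ᶠ v : HeightOneSpectrum (𝓞 K),
      max (finiteSize v 4 (p.1 : K)) (finiteSize v 6 (p.2 : K)) =
      (Ideal.absNorm (content p) : ℝ)⁻¹ := by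
    simp_rw [max_finiteSize_eq hp, inv_pow]
    rw [content, absNorm_twelfthRoot (span_pair_ne_bot hp), finprod_inv_distrib]
  rw [weightedHeight, h1, div_eq_inv_mul]
  congr 1
  refine Finset.prod_congr rfl fun v _ => ?_
  simp only [placeSize, pairEmb, normAtPlace_apply, infiniteSize]
  norm_num

/-! ### Isomorphism classes and integral short equations -/

/-- The short Weierstrass curve `y² = x³ + a x + b`. -/
def shortCurve (a b : K) : WeierstrassCurve K := ⟨0, 0, 0, a, b⟩

instance (a b : K) : (shortCurve a b).IsShortNF := ⟨rfl, rfl, rfl⟩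

theorem isElliptic_shortCurve {a b : K} (h : 4 * a ^ 3 + 27 * b ^ 2 ≠ 0) :
    (shortCurve a b).IsElliptic :=
  ⟨by
    rw [WeierstrassCurve.Δ_of_isShortNF, isUnit_iff_ne_zero]
    exact mul_ne_zero (by norm_num) h⟩

theorem disc_ne_zero_of_isElliptic {a b : K} (h : (shortCurve a b).IsElliptic) :
    4 * a ^ 3 + 27 * b ^ 2 ≠ 0 := by
  have := h.isUnit.ne_zero
  rw [WeierstrassCurve.Δ_of_isShortNF] at this
  exact right_ne_zero_of_mul this

/-- The discriminant of an integral short Weierstrass equation, up to the factor `-16`. -/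
def disc (p : 𝓞 K × 𝓞 K) : 𝓞 K := 4 * p.1 ^ 3 + 27 * p.2 ^ 2

theorem ne_zero_of_disc_ne_zero {p : 𝓞 K × 𝓞 K} (h : disc p ≠ 0) : p ≠ 0 := by
  rintro rfl
  simp [disc] at h

theorem coe_disc_ne_zero {p : 𝓞 K × 𝓞 K} (h : disc p ≠ 0) :
    4 * (p.1 : K) ^ 3 + 27 * (p.2 : K) ^ 2 ≠ 0 := by
  have := RingOfIntegers.coe_ne_zero_iff.2 h
  simpa only [disc, map_add, map_mul, map_pow, map_ofNat] using this

/-- The isomorphism class of the elliptic curve `y² = x³ + a x + b`. -/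
def shortClass (a b : K) (h : 4 * a ^ 3 + 27 * b ^ 2 ≠ 0) : IsoClass K :=
  Quotient.mk (isoSetoid K) (show EllipticCurve K from ⟨shortCurve a b, isElliptic_shortCurve h⟩)

/-- The isomorphism class of `y² = x³ + a x + b`; the equation `y² = x³ + x` stands in for a
singular one. -/
def curveClass (p : 𝓞 K × 𝓞 K) : IsoClass K :=
  if h : disc p ≠ 0 then shortClass p.1 p.2 (coe_disc_ne_zero h)
  else shortClass 1 0 (by norm_num)

/-- The action of the multiplicative monoid of integers on pairs, with weights `4` and `6`. -/
def weightedMul (t : 𝓞 K) (p : 𝓞 K × 𝓞 K) : 𝓞 K × 𝓞 K := (t ^ 4 * p.1, t ^ 6 * p.2)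

theorem weightedMul_weightedMul (s t : 𝓞 K) (p : 𝓞 K × 𝓞 K) :
    weightedMul s (weightedMul t p) = weightedMul (s * t) p := by
  simp only [weightedMul]
  ext <;> push_cast <;> ring

theorem weightedMul_one (p : 𝓞 K × 𝓞 K) : weightedMul 1 p = p := by simp [weightedMul]

theorem weightedMul_injective {t : 𝓞 K} (ht : t ≠ 0) :
    Function.Injective (weightedMul t) := by
  intro p q h
  simp only [weightedMul, Prod.mk.injEq] at h
  exact Prod.ext (mul_left_cancel₀ (pow_ne_zero _ ht) h.1)
    (mul_left_cancel₀ (pow_ne_zero _ ht) h.2)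

theorem disc_weightedMul (t : 𝓞 K) (p : 𝓞 K × 𝓞 K) :
    disc (weightedMul t p) = t ^ 12 * disc p := by
  simp only [disc, weightedMul]
  ring

theorem disc_weightedMul_ne_zero {t : 𝓞 K} (ht : t ≠ 0) {p : 𝓞 K × 𝓞 K} :
    disc (weightedMul t p) ≠ 0 ↔ disc p ≠ 0 := by
  rw [disc_weightedMul]
  simp [ht]

theorem weightedMul_ne_zero {t : 𝓞 K} (ht : t ≠ 0) {p : 𝓞 K × 𝓞 K} (hp : p ≠ 0) :
    weightedMul t p ≠ 0 := by
  intro h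
  apply hp
  apply weightedMul_injective ht
  rw [h]
  simp [weightedMul, Prod.ext_iff]

theorem content_weightedMul {p : 𝓞 K × 𝓞 K} (hp : p ≠ 0) {t : 𝓞 K} (ht : t ≠ 0) :
    content (weightedMul t p) = Ideal.span {t} * content p :=
  content_smul hp ht

/-- For short equations c₄ = -48a and c₆ = -864b, so their transformation laws already determine how
(a, b) changes. -/
theorem shortClass_eq_iff {a b a' b' : K} (h : 4 * a ^ 3 + 27 * b ^ 2 ≠ 0)
    (h' : 4 * a' ^ 3 + 27 * b' ^ 2 ≠ 0) :
    shortClass a b h = shortClass a' b' h' ↔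
      ∃ t : K, t ≠ 0 ∧ t ^ 4 * a' = a ∧ t ^ 6 * b' = b := by
  constructor
  · intro h
    obtain ⟨C, hC⟩ := Quotient.exact h
    have hC' : C • shortCurve a' b' = shortCurve a b := hC
    refine ⟨((C.u⁻¹ : Kˣ) : K), Units.ne_zero _, ?_, ?_⟩
    · have := congrArg WeierstrassCurve.c₄ hC'
      rw [WeierstrassCurve.variableChange_c₄, WeierstrassCurve.c₄_of_isShortNF,
        WeierstrassCurve.c₄_of_isShortNF] at this
      simp only [shortCurve] at this
      have h48 : (-48 : K) ≠ 0 := by norm_num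
      apply mul_left_cancel₀ h48
      linear_combination this
    · have := congrArg WeierstrassCurve.c₆ hC'
      rw [WeierstrassCurve.variableChange_c₆, WeierstrassCurve.c₆_of_isShortNF,
        WeierstrassCurve.c₆_of_isShortNF] at this
      simp only [shortCurve] at this
      have h48 : (-864 : K) ≠ 0 := by norm_num
      apply mul_left_cancel₀ h48
      linear_combination this
  · rintro ⟨t, ht, h4, h6⟩
    refine Quotient.sound ⟨⟨(Units.mk0 t ht)⁻¹, 0, 0, 0⟩, ?_⟩
    change (⟨(Units.mk0 t ht)⁻¹, 0, 0, 0⟩ : WeierstrassCurve.VariableChange K) • shortCurve a' b' =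
      shortCurve a b
    rw [WeierstrassCurve.variableChange_def]
    simp [shortCurve, h4, h6]

/-- The scaling factor is written as a fraction x / y, which keeps the relation among integers and
lets contents be compared. -/
theorem curveClass_eq_iff {p q : 𝓞 K × 𝓞 K} (hp : disc p ≠ 0) (hq : disc q ≠ 0) :
    curveClass p = curveClass q ↔
      ∃ x y : 𝓞 K, x ≠ 0 ∧ y ≠ 0 ∧ weightedMul x q = weightedMul y p := by
  rw [curveClass, curveClass, dif_pos hp, dif_pos hq, shortClass_eq_iff]
  constructor
  · rintro ⟨t, ht, h4, h6⟩
    obtain ⟨x, y, hy, rfl⟩ := IsFractionRing.div_surjective (A := 𝓞 K) t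
    have hy0 : y ≠ 0 := nonZeroDivisors.ne_zero hy
    have hy' : algebraMap (𝓞 K) K y ≠ 0 := by simpa using hy0
    have hx : x ≠ 0 := by
      rintro rfl
      simp at ht
    refine ⟨x, y, hx, hy0, Prod.ext ?_ ?_⟩
    · apply RingOfIntegers.coe_injective
      simp only [weightedMul, map_mul, map_pow]
      rw [show algebraMap (𝓞 K) K p.1 = _ * algebraMap (𝓞 K) K q.1 from h4.symm]
      field_simp
    · apply RingOfIntegers.coe_injective
      simp only [weightedMul, map_mul, map_pow]
      rw [show algebraMap (𝓞 K) K p.2 = _ * algebraMap (𝓞 K) K q.2 from h6.symm]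
      field_simp
  · rintro ⟨x, y, hx, hy, h⟩
    have hx' : algebraMap (𝓞 K) K x ≠ 0 := by simpa using hx
    have hy' : algebraMap (𝓞 K) K y ≠ 0 := by simpa using hy
    simp only [weightedMul, Prod.mk.injEq] at h
    have h1 := congrArg (algebraMap (𝓞 K) K) h.1
    have h2 := congrArg (algebraMap (𝓞 K) K) h.2
    simp only [map_mul, map_pow] at h1 h2
    refine ⟨algebraMap (𝓞 K) K x / algebraMap (𝓞 K) K y, div_ne_zero hx' hy', ?_, ?_⟩
    · rw [div_pow, div_mul_eq_mul_div, h1]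
      field_simp
    · rw [div_pow, div_mul_eq_mul_div, h2]
      field_simp

theorem exists_curveClass_eq (E : IsoClass K) :
    ∃ p : 𝓞 K × 𝓞 K, disc p ≠ 0 ∧ curveClass p = E := by
  obtain ⟨⟨W, hW⟩, rfl⟩ := Quotient.exists_rep E
  let _ : Invertible (2 : K) := invertibleOfNonzero (by norm_num)
  let _ : Invertible (3 : K) := invertibleOfNonzero (by norm_num)
  obtain ⟨C, hC⟩ := W.exists_variableChange_isShortNF
  have hCW : C • W = shortCurve (C • W).a₄ (C • W).a₆ := by
    apply WeierstrassCurve.ext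
    · exact hC.a₁
    · exact hC.a₂
    · exact hC.a₃
    · rfl
    · rfl
  generalize (C • W).a₄ = a at hCW
  generalize (C • W).a₆ = b at hCW
  have hE : (shortCurve a b).IsElliptic := by
    rw [← hCW]
    infer_instance
  obtain ⟨s, hs⟩ := IsLocalization.exist_integer_multiples_of_finset (nonZeroDivisors (𝓞 K))
    ({a, b} : Finset K)
  obtain ⟨a', ha'⟩ := hs a (by simp)
  obtain ⟨b', hb'⟩ := hs b (by simp)
  have hs0 : (s : 𝓞 K) ≠ 0 := nonZeroDivisors.ne_zero s.2
  have hsK : algebraMap (𝓞 K) K s ≠ 0 := by simp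
  rw [Algebra.smul_def] at ha' hb'
  -- Scaling by a common denominator s: as sa and sb are the integers a' and b', also s⁴a = s³a' and
  -- s⁶b = s⁵b' are integral.
  have e1 : algebraMap (𝓞 K) K (s ^ 3 * a') = algebraMap (𝓞 K) K s ^ 4 * a := by
    rw [map_mul, map_pow, ha']; ring
  have e2 : algebraMap (𝓞 K) K (s ^ 5 * b') = algebraMap (𝓞 K) K s ^ 6 * b := by
    rw [map_mul, map_pow, hb']; ring
  have hd : disc ((s : 𝓞 K) ^ 3 * a', (s : 𝓞 K) ^ 5 * b') ≠ 0 := by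
    intro h
    have h1 := congrArg (algebraMap (𝓞 K) K) h
    simp only [disc, map_add, map_mul (algebraMap (𝓞 K) K) 4, map_mul (algebraMap (𝓞 K) K) 27,
      map_pow _ (_ * _), e1, e2, map_zero, map_ofNat] at h1
    have h2 := disc_ne_zero_of_isElliptic hE
    apply mul_ne_zero (pow_ne_zero 12 hsK) h2
    linear_combination h1
  refine ⟨_, hd, ?_⟩
  rw [curveClass, dif_pos hd]
  have h1 := disc_ne_zero_of_isElliptic hE
  refine ((shortClass_eq_iff _ h1).2 ⟨_, hsK, e1.symm, e2.symm⟩).trans ?_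
  exact Quotient.sound (s := isoSetoid K) ⟨C, hCW⟩

theorem curveClass_weightedMul {t : 𝓞 K} (ht : t ≠ 0) {p : 𝓞 K × 𝓞 K} (hp : disc p ≠ 0) :
    curveClass (weightedMul t p) = curveClass p :=
  (curveClass_eq_iff ((disc_weightedMul_ne_zero ht).2 hp) hp).2
    ⟨t, 1, ht, one_ne_zero, (weightedMul_one _).symm⟩

theorem height_curveClass {p : 𝓞 K × 𝓞 K} (hp : disc p ≠ 0) :
    (curveClass p).height = ((∏ v, placeSize v (pairEmb p)) / Ideal.absNorm (content p)) ^ 12 := by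
  rw [← weightedHeight_eq (ne_zero_of_disc_ne_zero hp), curveClass, dif_pos hp]
  change naiveHeight (shortCurve _ _) = _
  rw [naiveHeight_of_isShortNF]
  rfl

/-! ### The units acting on the cone coordinates -/

theorem prod_placeSize_eq_exp {p : 𝓞 K × 𝓞 K} (hp : p ≠ 0) :
    ∏ v, placeSize v (pairEmb p) =
      Real.exp (finrank ℚ K * coneCoord (pairEmb p) w₀) := by
  rw [← sum_logSize, Real.exp_sum]
  refine Finset.prod_congr rfl fun v _ => ?_
  rw [logSize, Real.exp_log]
  exact pairEmb_mem_nonvanishing hp v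

theorem placeSize_weightedMul (v : InfinitePlace K) (t : 𝓞 K) (p : 𝓞 K × 𝓞 K) :
    placeSize v (pairEmb (weightedMul t p)) = v (t : K) ^ v.mult * placeSize v (pairEmb p) := by
  have h := fun q : 𝓞 K × 𝓞 K => show placeSize v (pairEmb q) =
      max (infiniteSize v 4 (q.1 : K)) (infiniteSize v 6 (q.2 : K)) by
    simp only [placeSize, pairEmb, normAtPlace_apply, infiniteSize]
    norm_num
  have h1 : (((weightedMul t p).1 : 𝓞 K) : K) = (t : K) ^ 4 * (p.1 : K) := by
    simp [weightedMul]
  have h2 : (((weightedMul t p).2 : 𝓞 K) : K) = (t : K) ^ 6 * (p.2 : K) := by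
    simp [weightedMul]
  rw [h, h, h1, h2, infiniteSize_smul v (by norm_num), infiniteSize_smul v (by norm_num),
    mul_max_of_nonneg _ _ (by positivity)]

variable (K) in
/-- The logarithms of the normalized absolute values of a unit. -/
def unitLog : Additive (𝓞 K)ˣ →+ realSpace K where
  toFun u := fun v => v.mult * Real.log (v (u.toMul : K))
  map_zero' := by
    ext v
    simp
  map_add' u w := by
    ext v
    have hu : v (u.toMul : K) ≠ 0 := (map_ne_zero v).2 (Units.coe_ne_zero _)
    have hw : v (w.toMul : K) ≠ 0 := (map_ne_zero v).2 (Units.coe_ne_zero _)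
    simp only [toMul_add, Units.coe_mul, map_mul, Pi.add_apply]
    rw [Real.log_mul hu hw]
    ring

theorem unitLog_torsion {ζ : (𝓞 K)ˣ} (h : ζ ∈ Units.torsion K) :
    unitLog K (Additive.ofMul ζ) = 0 := by
  ext v
  simp [unitLog, (Units.mem_torsion K).1 h v]

theorem unitLog_fundSystem (i : {w : InfinitePlace K // w ≠ w₀}) :
    unitLog K (Additive.ofMul (Units.fundSystem K (equivFinRank.symm i))) = completeBasis K i := by
  rw [completeBasis_apply_of_ne]
  ext v
  rw [expMap_symm_apply, normAtAllPlaces_mixedEmbedding]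
  rfl

/-- Units translate the cone coordinates; away from `w₀` the translation is by the integer exponents
in the fundamental units. The half-open unit box is thus a fundamental domain modulo torsion. -/
theorem equivFun_unitLog (ζ : Units.torsion K) (e : Fin (Units.rank K) → ℤ)
    (i : {w : InfinitePlace K // w ≠ w₀}) :
    (completeBasis K).equivFun (unitLog K (Additive.ofMul
      (ζ * ∏ j, Units.fundSystem K j ^ e j))) i = e (equivFinRank.symm i) := by
  rw [ofMul_mul, map_add, unitLog_torsion ζ.2, zero_add, ofMul_prod, map_sum,
    ← Equiv.sum_comp equivFinRank.symm]
  simp_rw [ofMul_zpow, map_zsmul, unitLog_fundSystem]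
  rw [map_sum, Finset.sum_apply]
  simp_rw [← Int.cast_smul_eq_zsmul ℝ, map_smul, Pi.smul_apply, Basis.equivFun_self, smul_eq_mul]
  rw [Finset.sum_eq_single i]
  · simp
  · intro j _ hj
    rw [if_neg (fun h => hj (Subtype.ext h)), mul_zero]
  · simp

theorem logSize_weightedMul (u : (𝓞 K)ˣ) {p : 𝓞 K × 𝓞 K} (hp : p ≠ 0) :
    logSize (pairEmb (weightedMul u p)) =
      unitLog K (Additive.ofMul u) + logSize (pairEmb p) := by
  ext v
  have hu : v (u : K) ≠ 0 := (map_ne_zero v).2 (Units.coe_ne_zero _)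
  have h1 : 0 < placeSize v (pairEmb p) := pairEmb_mem_nonvanishing hp v
  simp only [logSize, Pi.add_apply, placeSize_weightedMul]
  rw [Real.log_mul (pow_ne_zero _ hu) h1.ne', Real.log_pow]
  rfl

theorem coneCoord_weightedMul (u : (𝓞 K)ˣ) {p : 𝓞 K × 𝓞 K} (hp : p ≠ 0) :
    coneCoord (pairEmb (weightedMul u p)) =
      (completeBasis K).equivFun (unitLog K (Additive.ofMul u)) + coneCoord (pairEmb p) := by
  rw [coneCoord, logSize_weightedMul u hp, map_add, coneCoord]

/-- The pairs in the fundamental cone for the action of the units. -/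
def InCone (p : 𝓞 K × 𝓞 K) : Prop := ∀ v ≠ w₀, coneCoord (pairEmb p) v ∈ Set.Ico 0 1

theorem exists_unit_inCone {p : 𝓞 K × 𝓞 K} (hp : p ≠ 0) :
    ∃ u : (𝓞 K)ˣ, InCone (weightedMul u p) := by
  refine ⟨((1 : Units.torsion K) : (𝓞 K)ˣ) * ∏ j, Units.fundSystem K j ^
    (-⌊coneCoord (pairEmb p) (equivFinRank j)⌋), fun v hv => ?_⟩
  rw [coneCoord_weightedMul _ hp, Pi.add_apply,
    equivFun_unitLog 1 (fun j => -⌊coneCoord (pairEmb p) (equivFinRank j)⌋) ⟨v, hv⟩]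
  simp only [Equiv.apply_symm_apply, Int.cast_neg, neg_add_eq_sub, Int.self_sub_floor]
  exact ⟨Int.fract_nonneg _, Int.fract_lt_one _⟩

theorem mem_torsion_of_inCone {p : 𝓞 K × 𝓞 K} (hp : p ≠ 0) (h : InCone p) {u : (𝓞 K)ˣ}
    (hu : InCone (weightedMul u p)) : u ∈ Units.torsion K := by
  obtain ⟨⟨ζ, e⟩, rfl, -⟩ := Units.exist_unique_eq_mul_prod K u
  have he : e = 0 := by
    ext j
    obtain ⟨i, rfl⟩ := equivFinRank.symm.surjective j
    have h1 := hu i i.2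
    have h2 := h i i.2
    rw [coneCoord_weightedMul _ hp, Pi.add_apply, equivFun_unitLog ζ e i] at h1
    have h3 : (e (equivFinRank.symm i) : ℝ) < 1 := by linarith [h1.2, h2.1]
    have h4 : (-1 : ℝ) < e (equivFinRank.symm i) := by linarith [h1.1, h2.2]
    have h5 : e (equivFinRank.symm i) < 1 := by exact_mod_cast h3
    have h6 : -1 < e (equivFinRank.symm i) := by exact_mod_cast h4
    simp only [Pi.zero_apply]
    omega
  simp [he]

theorem coneCoord_torsion {ζ : (𝓞 K)ˣ} (h : ζ ∈ Units.torsion K) {p : 𝓞 K × 𝓞 K} (hp : p ≠ 0) :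
    coneCoord (pairEmb (weightedMul ζ p)) = coneCoord (pairEmb p) := by
  rw [coneCoord_weightedMul _ hp, unitLog_torsion h, map_zero, zero_add]

/-! ### Parametrizing pairs of a curve and an ideal -/

/-- An integral ideal in a given ideal class. -/
def repIdeal (c : ClassGroup (𝓞 K)) : Ideal (𝓞 K) :=
  ((ClassGroup.mk0_surjective c).choose : Ideal (𝓞 K))

theorem repIdeal_ne_bot (c : ClassGroup (𝓞 K)) : repIdeal c ≠ ⊥ :=
  nonZeroDivisors.ne_zero (ClassGroup.mk0_surjective c).choose.2

theorem mk0_repIdeal (c : ClassGroup (𝓞 K)) :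
    ClassGroup.mk0 ⟨repIdeal c, mem_nonZeroDivisors_of_ne_zero (repIdeal_ne_bot c)⟩ = c :=
  (ClassGroup.mk0_surjective c).choose_spec

theorem absNorm_pos {I : Ideal (𝓞 K)} (hI : I ≠ ⊥) : (0 : ℝ) < Ideal.absNorm I := by
  exact_mod_cast Nat.pos_of_ne_zero (Ideal.absNorm_eq_zero_iff.not.2 hI)

/-- The quotient of two ideals, one dividing the other. -/
def cofactor (I J : Ideal (𝓞 K)) : Ideal (𝓞 K) := if h : I ∣ J then h.choose else ⊥

theorem mul_cofactor {I J : Ideal (𝓞 K)} (h : I ∣ J) : I * cofactor I J = J := by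
  rw [cofactor, dif_pos h]
  exact h.choose_spec.symm

theorem mem_conePoints_iff {I : Ideal (𝓞 K)} (hI : I ≠ ⊥) {p : 𝓞 K × 𝓞 K} (hp : p ≠ 0) {T : ℝ}
    (hT : 0 < T) :
    p ∈ conePoints I (Real.log (Ideal.absNorm I * T) / finrank ℚ K) ↔
      I ∣ content p ∧ InCone p ∧ ∏ v, placeSize v (pairEmb p) < Ideal.absNorm I * T := by
  have hd : (0 : ℝ) < finrank ℚ K := by exact_mod_cast finrank_pos
  have hN := absNorm_pos hI
  rw [dvd_content_iff hp hI, prod_placeSize_eq_exp hp, ← Real.lt_log_iff_exp_lt (by positivity),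
    conePoints, Set.mem_ofPred_eq, lt_div_iff₀' hd]
  have := pairEmb_mem_nonvanishing hp
  unfold InCone
  tauto

variable (K) in
/-- The parameters for pairs of an elliptic curve and an ideal: the integral points in fundamental
cones. -/
def paramSet (T : ℝ) : Set (ClassGroup (𝓞 K) × (𝓞 K × 𝓞 K)) :=
  {x | x.2 ∈ conePoints (repIdeal x.1)
    (Real.log (Ideal.absNorm (repIdeal x.1) * T) / finrank ℚ K) ∧ disc x.2 ≠ 0}

variable (K) in
/-- The pairs of an elliptic curve `E` and a nonzero ideal `I` with `Ht(E) N(I) ^ 12 < T ^ 12`. -/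
def pairsLT (T : ℝ) : Set (IsoClass K × Ideal (𝓞 K)) :=
  {z | z.2 ≠ ⊥ ∧ z.1.height * (Ideal.absNorm z.2 : ℝ) ^ 12 < T ^ 12}

/-- The elliptic curve and the ideal that belong to a parameter. -/
def paramMap (x : ClassGroup (𝓞 K) × (𝓞 K × 𝓞 K)) : IsoClass K × Ideal (𝓞 K) :=
  (curveClass x.2, cofactor (repIdeal x.1) (content x.2))

/-- The height of the curve has N(I)N(J) in its denominator, so weighting by N(J)¹² cancels the
dependence on J. This is why pairs are easier to count than curves. -/
theorem height_mul_lt_iff {p : 𝓞 K × 𝓞 K} (hp : disc p ≠ 0) {I J : Ideal (𝓞 K)} (hI : I ≠ ⊥)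
    (hJ : J ≠ ⊥) (h : content p = I * J) {T : ℝ} (hT : 0 < T) :
    (curveClass p).height * (Ideal.absNorm J : ℝ) ^ 12 < T ^ 12 ↔
      ∏ v, placeSize v (pairEmb p) < Ideal.absNorm I * T := by
  have h1 := absNorm_pos hI
  have h2 := absNorm_pos hJ
  have h3 : 0 ≤ ∏ v, placeSize v (pairEmb p) :=
    Finset.prod_nonneg fun v _ => placeSize_nonneg v _
  rw [height_curveClass hp, ← mul_pow, pow_lt_pow_iff_left₀ (by positivity) hT.le (by norm_num), h,
    map_mul]
  push_cast
  rw [div_mul_eq_mul_div, mul_div_mul_right _ _ h2.ne', div_lt_iff₀ h1, mul_comm T]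

theorem mem_paramSet_iff {T : ℝ} (hT : 0 < T) {x : ClassGroup (𝓞 K) × (𝓞 K × 𝓞 K)} :
    x ∈ paramSet K T ↔ disc x.2 ≠ 0 ∧ repIdeal x.1 ∣ content x.2 ∧ InCone x.2 ∧
      ∏ v, placeSize v (pairEmb x.2) < Ideal.absNorm (repIdeal x.1) * T := by
  rw [paramSet, Set.mem_ofPred_eq, and_comm]
  refine and_congr_right fun h => ?_
  rw [mem_conePoints_iff (repIdeal_ne_bot _) (ne_zero_of_disc_ne_zero h) hT]

theorem cofactor_ne_bot {I J : Ideal (𝓞 K)} (h : I ∣ J) (hJ : J ≠ ⊥) : cofactor I J ≠ ⊥ := by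
  intro h0
  apply hJ
  rw [← mul_cofactor h, h0, Ideal.mul_bot]

theorem paramMap_mem {T : ℝ} (hT : 0 < T) {x : ClassGroup (𝓞 K) × (𝓞 K × 𝓞 K)}
    (hx : x ∈ paramSet K T) : paramMap x ∈ pairsLT K T := by
  obtain ⟨h1, h2, h3, h4⟩ := (mem_paramSet_iff hT).1 hx
  have h5 := cofactor_ne_bot h2 (content_ne_bot (ne_zero_of_disc_ne_zero h1))
  exact ⟨h5, (height_mul_lt_iff h1 (repIdeal_ne_bot _) h5 (mul_cofactor h2).symm hT).2 h4⟩

theorem exists_weightedMul_eq {p : 𝓞 K × 𝓞 K} {t : 𝓞 K} (ht : t ≠ 0) (hp : p ≠ 0)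
    (h : Ideal.span {t} ∣ content p) : ∃ q, weightedMul t q = p := by
  rw [dvd_content_iff hp (by simpa using ht), Ideal.span_singleton_pow, Ideal.span_singleton_pow,
    Ideal.mem_span_singleton, Ideal.mem_span_singleton] at h
  obtain ⟨⟨a, ha⟩, ⟨b, hb⟩⟩ := h
  exact ⟨(a, b), Prod.ext ha.symm hb.symm⟩

theorem span_singleton_ne_bot {t : 𝓞 K} (ht : t ≠ 0) : Ideal.span {t} ≠ ⊥ := by
  simpa using ht

theorem span_singleton_unit (u : (𝓞 K)ˣ) : Ideal.span {(u : 𝓞 K)} = 1 := by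
  rw [Ideal.one_eq_top, Ideal.span_singleton_eq_top]
  exact u.isUnit

theorem exists_paramMap_eq {T : ℝ} (hT : 0 < T) {z : IsoClass K × Ideal (𝓞 K)}
    (hz : z ∈ pairsLT K T) : ∃ x ∈ paramSet K T, paramMap x = z := by
  obtain ⟨E, J⟩ := z
  obtain ⟨hJ, hE⟩ := hz
  simp only at hJ hE
  obtain ⟨p, hp, rfl⟩ := exists_curveClass_eq E
  have hp0 := ne_zero_of_disc_ne_zero hp
  have hc := content_ne_bot hp0
  -- The class is forced by the requirement that I_c·J be equivalent to the content of `p`. A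
  -- relation (x)I_cJ = (y)·content then makes the rescaling of `p` by y/x integral, with content
  -- I_c·J.
  let c : ClassGroup (𝓞 K) := ClassGroup.mk0 ⟨content p, mem_nonZeroDivisors_of_ne_zero hc⟩ *
    (ClassGroup.mk0 ⟨J, mem_nonZeroDivisors_of_ne_zero hJ⟩)⁻¹
  have hI := repIdeal_ne_bot c
  have hcl : ClassGroup.mk0 (⟨repIdeal c, mem_nonZeroDivisors_of_ne_zero hI⟩ *
      ⟨J, mem_nonZeroDivisors_of_ne_zero hJ⟩) =
      ClassGroup.mk0 ⟨content p, mem_nonZeroDivisors_of_ne_zero hc⟩ := by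
    rw [map_mul, mk0_repIdeal]
    simp [c]
  rw [ClassGroup.mk0_eq_mk0_iff] at hcl
  obtain ⟨x, y, hx, hy, hxy⟩ := hcl
  replace hxy : Ideal.span {x} * (repIdeal c * J) = Ideal.span {y} * content p := hxy
  have hyp := content_weightedMul hp0 hy
  obtain ⟨q, hq⟩ := exists_weightedMul_eq hx (weightedMul_ne_zero hy hp0)
    (by rw [hyp, ← hxy]; exact dvd_mul_right _ _)
  have hqd : disc q ≠ 0 := by
    rw [← disc_weightedMul_ne_zero hx, hq, disc_weightedMul_ne_zero hy]
    exact hp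
  have hq0 := ne_zero_of_disc_ne_zero hqd
  have hqc : content q = repIdeal c * J := by
    apply mul_left_cancel₀ (span_singleton_ne_bot hx)
    rw [hxy, ← content_weightedMul hq0 hx, hq, hyp]
  obtain ⟨u, hu⟩ := exists_unit_inCone hq0
  have hu0 : ((u : 𝓞 K)) ≠ 0 := u.ne_zero
  have hud := (disc_weightedMul_ne_zero hu0).2 hqd
  have huc : content (weightedMul u q) = repIdeal c * J := by
    rw [content_weightedMul hq0 hu0, span_singleton_unit, one_mul, hqc]
  have huE : curveClass (weightedMul u q) = curveClass p := by
    rw [curveClass_weightedMul hu0 hqd, ← curveClass_weightedMul hx hqd, hq,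
      curveClass_weightedMul hy hp]
  have hdvd : repIdeal c ∣ content (weightedMul u q) := huc ▸ dvd_mul_right _ _
  refine ⟨(c, weightedMul u q), (mem_paramSet_iff hT).2 ⟨hud, hdvd, hu, ?_⟩, ?_⟩
  · rw [← height_mul_lt_iff hud hI hJ huc hT, huE]
    exact hE
  · refine Prod.ext huE ?_
    apply mul_left_cancel₀ hI
    change repIdeal c * cofactor _ _ = _
    rw [mul_cofactor hdvd, huc]

/-- If s and t scale the two points to the same one, comparing contents and cancelling the common
cofactor gives (s)I_c = (t)I_c'. Hence c = c' and s/t is a unit, which is torsion because both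
points lie in the cone. -/
theorem paramMap_eq_iff {T : ℝ} (hT : 0 < T) {x y : ClassGroup (𝓞 K) × (𝓞 K × 𝓞 K)}
    (hx : x ∈ paramSet K T) (hy : y ∈ paramSet K T) :
    paramMap y = paramMap x ↔ ∃ ζ ∈ Units.torsion K, (x.1, weightedMul ζ x.2) = y := by
  obtain ⟨c, p⟩ := x
  obtain ⟨c', q⟩ := y
  obtain ⟨hp, hcp, hconep, -⟩ := (mem_paramSet_iff hT).1 hx
  obtain ⟨hq, hcq, hconeq, -⟩ := (mem_paramSet_iff hT).1 hy
  simp only at hp hcp hconep hq hcq hconeq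
  have hp0 := ne_zero_of_disc_ne_zero hp
  have hq0 := ne_zero_of_disc_ne_zero hq
  simp only [paramMap, Prod.mk.injEq]
  constructor
  · rintro ⟨h1, h2⟩
    obtain ⟨s, t, hs, ht, hst⟩ := (curveClass_eq_iff hq hp).1 h1
    have h3 := congrArg content hst
    rw [content_weightedMul hp0 hs, content_weightedMul hq0 ht, ← mul_cofactor hcp,
      ← mul_cofactor hcq, h2, ← mul_assoc, ← mul_assoc] at h3
    have h4 := mul_right_cancel₀ (cofactor_ne_bot hcp (content_ne_bot hp0)) h3
    have hcc : c = c' := by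
      rw [← mk0_repIdeal c, ← mk0_repIdeal c', ClassGroup.mk0_eq_mk0_iff]
      exact ⟨s, t, hs, ht, h4⟩
    subst hcc
    have h5 := mul_right_cancel₀ (repIdeal_ne_bot c) h4
    rw [Ideal.span_singleton_eq_span_singleton] at h5
    obtain ⟨u, hu⟩ := h5.symm
    have h6 : weightedMul u p = q := by
      apply weightedMul_injective ht
      rw [weightedMul_weightedMul, hu, hst]
    exact ⟨u, mem_torsion_of_inCone hp0 hconep (h6 ▸ hconeq), rfl, h6⟩
  · rintro ⟨ζ, hζ, rfl, rfl⟩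
    have h0 : ((ζ : 𝓞 K)) ≠ 0 := ζ.ne_zero
    rw [curveClass_weightedMul h0 hp, content_weightedMul hp0 h0, span_singleton_unit, one_mul]
    exact ⟨rfl, rfl⟩

theorem weightedMul_torsion_mem_paramSet {T : ℝ} (hT : 0 < T)
    {x : ClassGroup (𝓞 K) × (𝓞 K × 𝓞 K)} (hx : x ∈ paramSet K T) {ζ : (𝓞 K)ˣ}
    (hζ : ζ ∈ Units.torsion K) : (x.1, weightedMul ζ x.2) ∈ paramSet K T := by
  obtain ⟨h1, h2, h3, h4⟩ := (mem_paramSet_iff hT).1 hx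
  have h0 : ((ζ : 𝓞 K)) ≠ 0 := ζ.ne_zero
  have hp0 := ne_zero_of_disc_ne_zero h1
  refine (mem_paramSet_iff hT).2 ⟨(disc_weightedMul_ne_zero h0).2 h1, ?_, ?_, ?_⟩
  · simpa only [content_weightedMul hp0 h0, span_singleton_unit, one_mul] using h2
  · unfold InCone
    simp only [coneCoord_torsion hζ hp0]
    exact h3
  · simp only [prod_placeSize_eq_exp (weightedMul_ne_zero h0 hp0), coneCoord_torsion hζ hp0,
      ← prod_placeSize_eq_exp hp0]
    exact h4

/-! ### From lattice points to the number of pairs -/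

theorem card_eq_mul_card_image {α β : Type*} [DecidableEq β] (s : Finset α) (f : α → β)
    (n : ℕ)
    (h : ∀ x ∈ s, (s.filter fun y => f y = f x).card = n) : s.card = n * (s.image f).card := by
  rw [Finset.card_eq_sum_card_image f s, Finset.sum_congr rfl (g := fun _ => n),
    Finset.sum_const, smul_eq_mul, mul_comm]
  intro b hb
  obtain ⟨x, hx, rfl⟩ := Finset.mem_image.1 hb
  exact h x hx

theorem neg_mem_torsion {ζ : (𝓞 K)ˣ} (h : ζ ∈ Units.torsion K) : -ζ ∈ Units.torsion K := by
  have h1 : (-1 : (𝓞 K)ˣ) ∈ Units.torsion K := neg_one_mem_torsion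
  simpa using mul_mem h1 h

/-- With both coordinates nonzero, u⁴ = w⁴ and u⁶ = w⁶ force u² = w². The curves with a = 0 or b = 0
may have larger stabilizers and are therefore treated as exceptional. -/
theorem weightedMul_unit_eq_iff {p : 𝓞 K × 𝓞 K} (h1 : p.1 ≠ 0) (h2 : p.2 ≠ 0) (u w : (𝓞 K)ˣ) :
    weightedMul (u : 𝓞 K) p = weightedMul (w : 𝓞 K) p ↔ u = w ∨ u = -w := by
  simp only [weightedMul, Prod.mk.injEq, mul_left_inj' h1, mul_left_inj' h2]
  constructor
  · rintro ⟨h4, h6⟩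
    have hw : (w : 𝓞 K) ^ 4 ≠ 0 := pow_ne_zero _ w.ne_zero
    have h : (u : 𝓞 K) ^ 2 = (w : 𝓞 K) ^ 2 := by
      apply mul_left_cancel₀ hw
      linear_combination h6 - (u : 𝓞 K) ^ 2 * h4
    rcases sq_eq_sq_iff_eq_or_eq_neg.1 h with h | h
    · exact Or.inl (Units.ext h)
    · exact Or.inr (Units.ext (by simpa using h))
  · rintro (rfl | rfl)
    · exact ⟨rfl, rfl⟩
    · constructor <;> simp only [Units.val_neg] <;> ring

instance : Fintype (Units.torsion K) := Fintype.ofFinite _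

theorem two_mul_card_torsion_orbit {p : 𝓞 K × 𝓞 K} (h1 : p.1 ≠ 0) (h2 : p.2 ≠ 0) :
    Units.torsionOrder K = 2 * (Finset.univ.image
      fun ζ : Units.torsion K => weightedMul ((ζ : (𝓞 K)ˣ) : 𝓞 K) p).card := by
  rw [Units.torsionOrder, Nat.card_eq_fintype_card, ← Finset.card_univ]
  refine card_eq_mul_card_image _ _ _ fun x _ => ?_
  have : (Finset.univ.filter fun y : Units.torsion K =>
      weightedMul ((y : (𝓞 K)ˣ) : 𝓞 K) p = weightedMul ((x : (𝓞 K)ˣ) : 𝓞 K) p) =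
      {x, ⟨-(x : (𝓞 K)ˣ), neg_mem_torsion x.2⟩} := by
    ext y
    simp only [Finset.mem_filter, Finset.mem_univ, true_and, weightedMul_unit_eq_iff h1 h2,
      Finset.mem_insert, Finset.mem_singleton, Subtype.ext_iff]
  rw [this, Finset.card_pair]
  intro h
  have h3 : ((x : (𝓞 K)ˣ) : 𝓞 K) = -((x : (𝓞 K)ˣ) : 𝓞 K) := by
    conv_lhs => rw [h]
    simp
  rw [self_eq_neg] at h3
  exact (x : (𝓞 K)ˣ).ne_zero h3

theorem finite_setOf_snd_mem {ι α : Type*} [Finite ι] {S : ι → Set α} (h : ∀ i, (S i).Finite) :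
    {x : ι × α | x.2 ∈ S x.1}.Finite := by
  refine (Set.Finite.prod (Set.finite_univ (α := ι)) (Set.finite_iUnion h)).subset ?_
  rintro ⟨i, a⟩ hx
  exact ⟨trivial, Set.mem_iUnion.2 ⟨i, hx⟩⟩

theorem ncard_setOf_snd_mem {ι α : Type*} [Fintype ι] {S : ι → Set α} (h : ∀ i, (S i).Finite) :
    {x : ι × α | x.2 ∈ S x.1}.ncard = ∑ i, (S i).ncard := by
  have := fun i => (h i).to_subtype
  simp_rw [← Nat.card_coe_set_eq]
  rw [← Nat.card_sigma]
  exact Nat.card_congr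
    { toFun := fun x => ⟨x.1.1, x.1.2, x.2⟩
      invFun := fun x => ⟨(x.1, x.2.1), x.2.2⟩
      left_inv := fun _ => rfl
      right_inv := fun _ => rfl }

/-- The bound for the last cone coordinate that belongs to a bound for the height. -/
def coneBound (I : Ideal (𝓞 K)) (T : ℝ) : ℝ := Real.log (Ideal.absNorm I * T) / finrank ℚ K

theorem finite_pairsLT {T : ℝ} (hT : 0 < T) : (pairsLT K T).Finite := by
  have h : (paramSet K T).Finite := (finite_setOf_snd_mem fun c : ClassGroup (𝓞 K) =>
    finite_conePoints (repIdeal c) (coneBound (repIdeal c) T)).subset fun x hx => hx.1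
  refine (h.image paramMap).subset fun z hz => ?_
  obtain ⟨x, hx, rfl⟩ := exists_paramMap_eq hT hz
  exact ⟨x, hx, rfl⟩

/-- On generic points every fibre of `paramMap` is a torsion orbit, with w/2 elements. Exceptional
points add at most their own number of pairs, costing w each, and 2 each for being left out of the
cone count. -/
theorem abs_ncard_pairsLT_sub_le {T : ℝ} (hT : 0 < T) :
    |(Units.torsionOrder K : ℝ) * (pairsLT K T).ncard - 2 * ∑ c : ClassGroup (𝓞 K),
        ((conePoints (repIdeal c) (coneBound (repIdeal c) T)).ncard : ℝ)| ≤
      (Units.torsionOrder K + 2) * ∑ c : ClassGroup (𝓞 K),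
        ((exceptionalPoints (repIdeal c) (coneBound (repIdeal c) T)).ncard : ℝ) := by
  set cone := fun c : ClassGroup (𝓞 K) => conePoints (repIdeal c) (coneBound (repIdeal c) T)
  set exc := fun c : ClassGroup (𝓞 K) => exceptionalPoints (repIdeal c) (coneBound (repIdeal c) T)
  have hcone : ∀ c, (cone c).Finite := fun c => finite_conePoints _ _
  have hsub : ∀ c, exc c ⊆ cone c := fun c => Set.sep_subset _ _
  have hexc : ∀ c, (exc c).Finite := fun c => (hcone c).subset (hsub c)
  have hgen : ∀ c, (cone c \ exc c).Finite := fun c => (hcone c).sdiff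
  set Y := {x : ClassGroup (𝓞 K) × (𝓞 K × 𝓞 K) | x.2 ∈ cone x.1 \ exc x.1}
  set X := {x : ClassGroup (𝓞 K) × (𝓞 K × 𝓞 K) | x.2 ∈ exc x.1}
  have hYfin : Y.Finite := finite_setOf_snd_mem hgen
  have hXfin : X.Finite := finite_setOf_snd_mem hexc
  have hY : ∀ x, x ∈ Y ↔ x ∈ paramSet K T ∧ x.2.1 ≠ 0 ∧ x.2.2 ≠ 0 := by
    intro x
    change (x.2 ∈ cone x.1 ∧ ¬ (x.2 ∈ cone x.1 ∧ (x.2.1 = 0 ∨ x.2.2 = 0 ∨ disc x.2 = 0))) ↔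
      (x.2 ∈ cone x.1 ∧ disc x.2 ≠ 0) ∧ x.2.1 ≠ 0 ∧ x.2.2 ≠ 0
    tauto
  have hcover : pairsLT K T ⊆ paramMap '' Y ∪ paramMap '' X := by
    intro z hz
    obtain ⟨x, hx, rfl⟩ := exists_paramMap_eq hT hz
    by_cases hxe : x.2 ∈ exc x.1
    · exact Or.inr ⟨x, hxe, rfl⟩
    · exact Or.inl ⟨x, ⟨hx.1, hxe⟩, rfl⟩
  have hYZ : paramMap '' Y ⊆ pairsLT K T := by
    rintro _ ⟨x, hx, rfl⟩
    exact paramMap_mem hT ((hY x).1 hx).1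
  have hcard : 2 * Y.ncard = Units.torsionOrder K * (paramMap '' Y).ncard := by
    have key : ∀ x ∈ hYfin.toFinset,
        (hYfin.toFinset.filter fun y => paramMap y = paramMap x).card =
          Units.torsionOrder K / 2 := by
      intro x hx
      rw [Set.Finite.mem_toFinset, hY] at hx
      obtain ⟨hx, h1, h2⟩ := hx
      rw [two_mul_card_torsion_orbit h1 h2, Nat.mul_div_cancel_left _ (by norm_num)]
      have : (hYfin.toFinset.filter fun y => paramMap y = paramMap x) =
          (Finset.univ.image fun ζ : Units.torsion K =>
            weightedMul ((ζ : (𝓞 K)ˣ) : 𝓞 K) x.2).image (Prod.mk x.1) := by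
        ext y
        simp only [Finset.mem_filter, Set.Finite.mem_toFinset, hY, Finset.mem_image,
          Finset.mem_univ, true_and, exists_exists_eq_and]
        constructor
        · rintro ⟨⟨hy, -⟩, h⟩
          obtain ⟨ζ, hζ, h⟩ := (paramMap_eq_iff hT hx hy).1 h
          exact ⟨⟨ζ, hζ⟩, h⟩
        · rintro ⟨ζ, rfl⟩
          have h3 := weightedMul_torsion_mem_paramSet hT hx ζ.2
          refine ⟨⟨h3, ?_, ?_⟩, (paramMap_eq_iff hT hx h3).2 ⟨ζ, ζ.2, rfl⟩⟩
          · exact mul_ne_zero (pow_ne_zero _ (ζ : (𝓞 K)ˣ).ne_zero) h1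
          · exact mul_ne_zero (pow_ne_zero _ (ζ : (𝓞 K)ˣ).ne_zero) h2
      rw [this, Finset.card_image_of_injective _ (Prod.mk_right_injective _)]
    have h1 := card_eq_mul_card_image _ _ _ key
    -- The orbit of (1, 1) shows that the torsion order is even, so the natural-number division by 2
    -- is exact.
    have h2 : Units.torsionOrder K = 2 * (Units.torsionOrder K / 2) := by
      conv_lhs => rw [two_mul_card_torsion_orbit (p := ((1 : 𝓞 K), (1 : 𝓞 K))) one_ne_zero
        one_ne_zero]
      rw [two_mul_card_torsion_orbit (p := ((1 : 𝓞 K), (1 : 𝓞 K))) one_ne_zero one_ne_zero,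
        Nat.mul_div_cancel_left _ (by norm_num)]
    rw [Set.ncard_eq_toFinset_card Y hYfin, h1, h2, mul_assoc, ← h2,
      Set.ncard_eq_toFinset_card _ (hYfin.image _), Set.Finite.toFinset_image]
  have hYcard : (Y.ncard : ℝ) = ∑ c, ((cone c).ncard : ℝ) - ∑ c, ((exc c).ncard : ℝ) := by
    rw [ncard_setOf_snd_mem hgen, ← Finset.sum_sub_distrib]
    push_cast
    refine Finset.sum_congr rfl fun c _ => ?_
    rw [Set.cast_ncard_sdiff (hsub c) (hcone c)]
  have hXcard : (X.ncard : ℝ) = ∑ c, ((exc c).ncard : ℝ) := by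
    rw [ncard_setOf_snd_mem hexc]
    push_cast
    rfl
  have hle : (pairsLT K T).ncard ≤ (paramMap '' Y).ncard + X.ncard :=
    ((Set.ncard_le_ncard hcover ((hYfin.image _).union (hXfin.image _))).trans
      (Set.ncard_union_le _ _)).trans (Nat.add_le_add_left (Set.ncard_image_le hXfin) _)
  have hge : (paramMap '' Y).ncard ≤ (pairsLT K T).ncard :=
    Set.ncard_le_ncard hYZ (finite_pairsLT hT)
  have hle' : ((pairsLT K T).ncard : ℝ) ≤ (paramMap '' Y).ncard + X.ncard := by exact_mod_cast hle
  have hge' : ((paramMap '' Y).ncard : ℝ) ≤ (pairsLT K T).ncard := by exact_mod_cast hge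
  have hcard' : 2 * (Y.ncard : ℝ) = Units.torsionOrder K * (paramMap '' Y).ncard := by
    exact_mod_cast hcard
  have hn : (0 : ℝ) ≤ Units.torsionOrder K := Nat.cast_nonneg _
  have hX0 : (0 : ℝ) ≤ X.ncard := Nat.cast_nonneg _
  rw [← hXcard]
  rw [← hXcard] at hYcard
  have e1 := mul_le_mul_of_nonneg_left hle' hn
  have e2 := mul_le_mul_of_nonneg_left hge' hn
  have e3 := mul_nonneg hn hX0
  rw [abs_le]
  constructor <;> nlinarith

theorem exp_mul_coneBound {I : Ideal (𝓞 K)} (hI : I ≠ ⊥) {T : ℝ} (hT : 0 < T) (a : ℝ) :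
    Real.exp (a * coneBound I T) =
      (Ideal.absNorm I : ℝ) ^ (a / finrank ℚ K) * T ^ (a / finrank ℚ K) := by
  have hN := absNorm_pos hI
  rw [← Real.mul_rpow hN.le hT.le, Real.rpow_def_of_pos (by positivity), coneBound]
  congr 1
  ring

variable (K) in
/-- The exponent of the error term. -/
def errorExponent : ℝ := 10 - 4 / finrank ℚ K

theorem errorExponent_eq : errorExponent K = (10 * finrank ℚ K - 4) / finrank ℚ K := by
  have hd : (finrank ℚ K : ℝ) ≠ 0 := by exact_mod_cast (finrank_pos : 0 < finrank ℚ K).ne'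
  rw [errorExponent]
  field_simp

theorem six_le_errorExponent : 6 ≤ errorExponent K := by
  have hd : (1 : ℝ) ≤ finrank ℚ K := by exact_mod_cast (finrank_pos : 0 < finrank ℚ K)
  have : 4 / (finrank ℚ K : ℝ) ≤ 4 := div_le_self (by norm_num) hd
  rw [errorExponent]
  linarith

theorem exists_ncard_exceptionalPoints_coneBound_le {I : Ideal (𝓞 K)} (hI : I ≠ ⊥) :
    ∃ C : ℝ, ∀ T : ℝ, 0 < T →
      ((exceptionalPoints I (coneBound I T)).ncard : ℝ) ≤ C * T ^ errorExponent K := by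
  obtain ⟨C, -, h⟩ := exists_ncard_exceptionalPoints_le I
  refine ⟨C * (Ideal.absNorm I : ℝ) ^ errorExponent K, fun T hT => ?_⟩
  refine (h _).trans_eq ?_
  rw [exp_mul_coneBound hI hT, errorExponent_eq, mul_assoc]

/-- At this level e^(10dτ) = (N(I)T)¹⁰, and N(I)¹⁰ cancels against the covolume of I⁴ × I⁶. All
ideal classes share the same main term, which is how the class number enters. -/
theorem exists_abs_ncard_conePoints_coneBound_sub_le {I : Ideal (𝓞 K)} (hI : I ≠ ⊥) :
    ∃ C : ℝ, ∀ T : ℝ, 0 < T →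
      |((conePoints I (coneBound I T)).ncard : ℝ) -
        shellConst K / integerCovolume K ^ 2 * T ^ 10| ≤ C * T ^ errorExponent K := by
  obtain ⟨C, h⟩ := exists_abs_ncard_conePoints_sub_le hI
  have hN := absNorm_pos hI
  have hcov := integerCovolume_pos (K := K)
  have hd : (finrank ℚ K : ℝ) ≠ 0 := by exact_mod_cast (finrank_pos : 0 < finrank ℚ K).ne'
  set D := (Ideal.absNorm I : ℝ) ^ 10 * integerCovolume K ^ 2
  have hD : 0 < D := by positivity
  refine ⟨C * (Ideal.absNorm I : ℝ) ^ errorExponent K / D, fun T hT => ?_⟩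
  have h1 := h (coneBound I T)
  rw [exp_mul_coneBound hI hT, exp_mul_coneBound hI hT, ← errorExponent_eq,
    mul_div_cancel_right₀ _ hd, show (10 : ℝ) = ((10 : ℕ) : ℝ) by norm_num, Real.rpow_natCast,
    Real.rpow_natCast] at h1
  rw [div_mul_eq_mul_div _ D, le_div_iff₀ hD, ← abs_of_pos hD, ← abs_mul, mul_assoc C]
  refine le_trans (le_of_eq ?_) h1
  congr 1
  simp only [D]
  field_simp

variable (K) in
/-- The leading constant in the count of pairs of an elliptic curve and an ideal. -/
def pairConst : ℝ :=
  2 * (classNumber K * (shellConst K / integerCovolume K ^ 2)) / Units.torsionOrder K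

variable (K) in
theorem exists_abs_ncard_pairsLT_sub_le : ∃ C : ℝ, ∀ T : ℝ, 0 < T →
    |((pairsLT K T).ncard : ℝ) - pairConst K * T ^ 10| ≤ C * T ^ errorExponent K := by
  choose C₁ h₁ using fun c : ClassGroup (𝓞 K) =>
    exists_abs_ncard_conePoints_coneBound_sub_le (repIdeal_ne_bot c)
  choose C₂ h₂ using fun c : ClassGroup (𝓞 K) =>
    exists_ncard_exceptionalPoints_coneBound_le (repIdeal_ne_bot c)
  have hw : (0 : ℝ) < Units.torsionOrder K := by exact_mod_cast Units.torsionOrder_pos K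
  set w := (Units.torsionOrder K : ℝ)
  refine ⟨((w + 2) * ∑ c, C₂ c + 2 * ∑ c, C₁ c) / w, fun T hT => ?_⟩
  set A := shellConst K / integerCovolume K ^ 2
  have e0 := abs_ncard_pairsLT_sub_le (K := K) hT
  set S := ∑ c : ClassGroup (𝓞 K),
    ((conePoints (repIdeal c) (coneBound (repIdeal c) T)).ncard : ℝ)
  have e1 : |S - classNumber K * A * T ^ 10| ≤ (∑ c, C₁ c) * T ^ errorExponent K := by
    have : classNumber K * A * T ^ 10 = ∑ c : ClassGroup (𝓞 K), A * T ^ 10 := by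
      rw [Finset.sum_const, Finset.card_univ, nsmul_eq_mul, classNumber, mul_assoc]
    rw [this, ← Finset.sum_sub_distrib, Finset.sum_mul]
    exact (Finset.abs_sum_le_sum_abs _ _).trans (Finset.sum_le_sum fun c _ => h₁ c T hT)
  have e2 : ∑ c : ClassGroup (𝓞 K),
      ((exceptionalPoints (repIdeal c) (coneBound (repIdeal c) T)).ncard : ℝ) ≤
      (∑ c, C₂ c) * T ^ errorExponent K := by
    rw [Finset.sum_mul]
    exact Finset.sum_le_sum fun c _ => h₂ c T hT
  have e3 : |w * (pairsLT K T).ncard - 2 * (classNumber K * A * T ^ 10)| ≤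
      ((w + 2) * ∑ c, C₂ c + 2 * ∑ c, C₁ c) * T ^ errorExponent K := by
    have e4 := mul_le_mul_of_nonneg_left e2 (by positivity : 0 ≤ w + 2)
    rw [abs_le] at e0 e1 ⊢
    constructor <;> nlinarith
  have e5 : ((pairsLT K T).ncard : ℝ) - pairConst K * T ^ 10 =
      (w * (pairsLT K T).ncard - 2 * (classNumber K * A * T ^ 10)) / w := by
    change _ - 2 * (classNumber K * A) / w * T ^ 10 = _
    field_simp
  rw [e5, abs_div, abs_of_pos hw, div_mul_eq_mul_div]
  gcongr

/-! ### The Dedekind zeta function and squarefree ideals -/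

variable (K) in
/-- The nonzero integral ideals. -/
abbrev NonzeroIdeal : Type _ := {I : Ideal (𝓞 K) // I ≠ ⊥}

variable (K) in
/-- The terms of the Dirichlet series of the Dedekind zeta function at a real number. -/
def zetaTerm (s : ℝ) (n : ℕ) : ℝ :=
  if n = 0 then 0 else Nat.card {I : Ideal (𝓞 K) // Ideal.absNorm I = n} / (n : ℝ) ^ s

theorem ofReal_zetaTerm (s : ℝ) (n : ℕ) : ((zetaTerm K s n : ℝ) : ℂ) =
    LSeries.term (fun n ↦ (Nat.card {I : Ideal (𝓞 K) // Ideal.absNorm I = n} : ℂ)) s n := by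
  rw [zetaTerm, LSeries.term_def]
  split_ifs with h
  · simp
  · push_cast
    rw [Complex.ofReal_cpow (by positivity)]
    simp

/-- The number of ideals of norm at most n is asymptotic to a constant times n, so the partial sums
of the coefficients are O(n). -/
theorem lSeriesSummable_zeta {s : ℝ} (hs : 1 < s) :
    LSeriesSummable (fun n ↦ (Nat.card {I : Ideal (𝓞 K) // Ideal.absNorm I = n} : ℂ)) s := by
  have h := LSeriesSummable_of_sum_norm_bigO_and_nonneg (r := 1) (s := (s : ℂ))
    (f := fun n ↦ (Nat.card {I : Ideal (𝓞 K) // Ideal.absNorm I = n} : ℝ)) ?_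
    (fun n => Nat.cast_nonneg _) zero_le_one (by simpa using hs)
  · simpa using h
  · refine Asymptotics.isBigO_atTop_natCast_rpow_of_tendsto_div_rpow (a := dedekindZeta_residue K) ?_
    simp only [Real.rpow_one]
    refine ((NumberField.Ideal.tendsto_norm_le_div_atTop₀ K).comp
      tendsto_natCast_atTop_atTop).congr fun n ↦ ?_
    simp only [Function.comp_apply, Nat.cast_le, ← Nat.cast_sum]
    congr
    rw [← add_left_inj 1, ← Ideal.card_norm_le_eq_card_norm_le_add_one,
      show Finset.Icc 1 n = Finset.Ioc 0 n from Finset.Icc_succ_left_eq_Ioc _ _,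
      show 1 = Nat.card {I : Ideal (𝓞 K) // Ideal.absNorm I = 0} by
        simp [Ideal.absNorm_eq_zero_iff],
      Finset.sum_Ioc_add_eq_sum_Icc (n.zero_le),
      ← Finset.card_preimage_eq_sum_card_image_eq
        (fun k _ ↦ Ideal.finite_setOfPred_absNorm_eq k)]
    simp [Set.coe_eq_subtype]

theorem summable_zetaTerm {s : ℝ} (hs : 1 < s) : Summable (zetaTerm K s) := by
  rw [← Complex.summable_ofReal]
  exact (lSeriesSummable_zeta hs).congr fun n => (ofReal_zetaTerm s n).symm

theorem tsum_zetaTerm (s : ℝ) : ∑' n, zetaTerm K s n = (dedekindZeta K s).re := by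
  have : dedekindZeta K s = ((∑' n, zetaTerm K s n : ℝ) : ℂ) := by
    rw [Complex.ofReal_tsum]
    exact tsum_congr fun n => (ofReal_zetaTerm s n).symm
  rw [this, Complex.ofReal_re]

theorem finite_nonzeroIdeal_absNorm_eq (n : ℕ) :
    Finite {I : NonzeroIdeal K // Ideal.absNorm I.1 = n} := by
  have : Finite {I : Ideal (𝓞 K) // Ideal.absNorm I = n} := Ideal.finite_setOfPred_absNorm_eq n
  exact Finite.of_injective
    (fun I => (⟨I.1.1, I.2⟩ : {I : Ideal (𝓞 K) // Ideal.absNorm I = n}))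
    fun I J h => Subtype.ext (Subtype.ext (by simpa using h))

theorem hasSum_absNorm_eq (s : ℝ) (n : ℕ) :
    HasSum (fun I : {I : NonzeroIdeal K // Ideal.absNorm I.1 = n} =>
      (Ideal.absNorm I.1.1 : ℝ) ^ (-s)) (zetaTerm K s n) := by
  have := finite_nonzeroIdeal_absNorm_eq (K := K) n
  have := Fintype.ofFinite {I : NonzeroIdeal K // Ideal.absNorm I.1 = n}
  convert hasSum_fintype _ using 1
  rw [Finset.sum_congr rfl (g := fun _ => (n : ℝ) ^ (-s)) fun I _ => by rw [I.2]]
  rw [Finset.sum_const, Finset.card_univ, nsmul_eq_mul, zetaTerm, ← Nat.card_eq_fintype_card]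
  split_ifs with h
  · subst h
    have : IsEmpty {I : NonzeroIdeal K // Ideal.absNorm I.1 = 0} :=
      ⟨fun I => I.1.2 (Ideal.absNorm_eq_zero_iff.1 I.2)⟩
    simp
  · rw [Real.rpow_neg (Nat.cast_nonneg _), div_eq_mul_inv]
    congr 2
    refine Nat.card_congr
      { toFun := fun I => ⟨⟨I.1, fun h0 => h ?_⟩, I.2⟩
        invFun := fun I => ⟨I.1.1, I.2⟩
        left_inv := fun _ => rfl
        right_inv := fun _ => rfl }
    rw [← I.2, h0, Ideal.absNorm_bot]

theorem summable_absNorm_rpow {s : ℝ} (hs : 1 < s) :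
    Summable fun I : NonzeroIdeal K => (Ideal.absNorm I.1 : ℝ) ^ (-s) := by
  rw [← (Equiv.sigmaFiberEquiv fun I : NonzeroIdeal K => Ideal.absNorm I.1).summable_iff]
  refine (summable_sigma_of_nonneg fun x => ?_).2 ⟨fun n => (hasSum_absNorm_eq (K := K) s n).summable, ?_⟩
  · exact Real.rpow_nonneg (Nat.cast_nonneg _) _
  refine (summable_zetaTerm (K := K) hs).congr fun n => ?_
  exact (hasSum_absNorm_eq (K := K) s n).tsum_eq.symm

theorem tsum_absNorm_rpow {s : ℝ} (hs : 1 < s) :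
    ∑' I : NonzeroIdeal K, (Ideal.absNorm I.1 : ℝ) ^ (-s) = (dedekindZeta K s).re := by
  have h := (summable_absNorm_rpow (K := K) hs).hasSum.tsum_fiberwise
    fun I : NonzeroIdeal K => Ideal.absNorm I.1
  rw [← h.tsum_eq, ← tsum_zetaTerm]
  exact tsum_congr fun n => (hasSum_absNorm_eq s n).tsum_eq

/-- The product of a finite set of prime ideals. -/
def primeProd (A : Finset (HeightOneSpectrum (𝓞 K))) : Ideal (𝓞 K) := ∏ v ∈ A, v.asIdeal

theorem primeProd_ne_bot (A : Finset (HeightOneSpectrum (𝓞 K))) : primeProd A ≠ ⊥ :=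
  Finset.prod_ne_zero_iff.2 fun v _ => v.ne_bot

theorem multiplicity_primeProd (w : HeightOneSpectrum (𝓞 K))
    (A : Finset (HeightOneSpectrum (𝓞 K))) :
    multiplicity w.asIdeal (primeProd A) = if w ∈ A then 1 else 0 := by
  refine multiplicity_eq_of_emultiplicity_eq_some ?_
  have h : ∀ v : HeightOneSpectrum (𝓞 K),
      emultiplicity w.asIdeal v.asIdeal = if v = w then ((1 : ℕ) : ℕ∞) else 0 := fun v => by
    simpa only [pow_one] using emultiplicity_asIdeal_pow v w 1
  rw [primeProd, Finset.emultiplicity_prod w.prime]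
  simp_rw [h]
  rw [Finset.sum_ite_eq']
  split_ifs <;> rfl

theorem primeProd_injective : Function.Injective (primeProd (K := K)) := by
  intro A B h
  ext w
  have h1 := multiplicity_primeProd w A
  rw [h, multiplicity_primeProd] at h1
  by_cases hA : w ∈ A <;> by_cases hB : w ∈ B <;> simp_all

/-- The finite set of prime ideals that divide a nonzero ideal. -/
def primeDivisors (J : NonzeroIdeal K) : Finset (HeightOneSpectrum (𝓞 K)) :=
  (finite_multiplicity_ne_zero J.2).toFinset

theorem primeProd_dvd_iff (A : Finset (HeightOneSpectrum (𝓞 K))) (J : NonzeroIdeal K) :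
    primeProd A ∣ J.1 ↔ A ∈ (primeDivisors J).powerset := by
  rw [ideal_dvd_iff_multiplicity_le (primeProd_ne_bot A) J.2, Finset.mem_powerset,
    Finset.subset_iff]
  refine forall_congr' fun v => ?_
  rw [multiplicity_primeProd, primeDivisors, Set.Finite.mem_toFinset, Set.mem_ofPred_eq]
  split_ifs with h <;> simp [h, Nat.one_le_iff_ne_zero]

theorem primeDivisors_eq_empty_iff (J : NonzeroIdeal K) : primeDivisors J = ∅ ↔ J.1 = ⊤ := by
  constructor
  · intro h
    refine ideal_eq_of_multiplicity_eq J.2 top_ne_bot fun v => ?_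
    have h1 : v ∉ primeDivisors J := by simp [h]
    rw [primeDivisors, Set.Finite.mem_toFinset, Set.mem_ofPred_eq, not_not] at h1
    rw [h1, ← Ideal.one_eq_top, eq_comm, multiplicity_eq_zero]
    exact v.prime.not_dvd_one
  · intro h
    rw [Finset.eq_empty_iff_forall_notMem]
    intro v hv
    rw [primeDivisors, Set.Finite.mem_toFinset, Set.mem_ofPred_eq] at hv
    apply hv
    rw [h, ← Ideal.one_eq_top, multiplicity_eq_zero]
    exact v.prime.not_dvd_one

theorem sum_powerset_primeDivisors (J : NonzeroIdeal K) :
    ∑ A ∈ (primeDivisors J).powerset, (-1 : ℝ) ^ A.card = if J.1 = ⊤ then 1 else 0 := by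
  have h := congrArg (Int.cast : ℤ → ℝ)
    (Finset.sum_powerset_neg_one_pow_card (x := primeDivisors J))
  simpa [primeDivisors_eq_empty_iff] using h

/-- The multiplication of an ideal by a product of prime ideals. -/
def primeProdMul (x : Finset (HeightOneSpectrum (𝓞 K)) × NonzeroIdeal K) : NonzeroIdeal K :=
  ⟨primeProd x.1 * x.2.1, mul_ne_zero (primeProd_ne_bot x.1) x.2.2⟩

/-- The factorizations of an ideal into a product of distinct prime ideals and an ideal. -/
def fiberEquiv (J : NonzeroIdeal K) : (primeDivisors J).powerset ≃ primeProdMul ⁻¹' {J} where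
  toFun A := ⟨(A.1, ⟨cofactor (primeProd A.1) J.1,
    cofactor_ne_bot ((primeProd_dvd_iff A.1 J).2 A.2) J.2⟩),
    Subtype.ext (mul_cofactor ((primeProd_dvd_iff A.1 J).2 A.2))⟩
  invFun x := ⟨x.1.1, (primeProd_dvd_iff x.1.1 J).1
    (Dvd.intro _ (congrArg Subtype.val (show primeProdMul x.1 = J from x.2)))⟩
  left_inv _ := rfl
  right_inv x := by
    have hx : primeProdMul x.1 = J := x.2
    have h1 : primeProd x.1.1 * x.1.2.1 = J.1 := congrArg Subtype.val hx
    refine Subtype.ext (Prod.ext rfl (Subtype.ext ?_))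
    apply mul_left_cancel₀ (primeProd_ne_bot x.1.1)
    change primeProd x.1.1 * cofactor (primeProd x.1.1) J.1 = _
    rw [mul_cofactor (Dvd.intro _ h1), h1]

theorem summable_primeProd_rpow {s : ℝ} (hs : 1 < s) :
    Summable fun A : Finset (HeightOneSpectrum (𝓞 K)) =>
      (Ideal.absNorm (primeProd A) : ℝ) ^ (-s) :=
  (summable_absNorm_rpow hs).comp_injective
    (i := fun A => (⟨primeProd A, primeProd_ne_bot A⟩ : NonzeroIdeal K))
    fun _ _ h => primeProd_injective (congrArg Subtype.val h)

theorem summable_neg_one_pow_primeProd {s : ℝ} (hs : 1 < s) :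
    Summable fun A : Finset (HeightOneSpectrum (𝓞 K)) =>
      (-1 : ℝ) ^ A.card * (Ideal.absNorm (primeProd A) : ℝ) ^ (-s) := by
  refine Summable.of_norm ((summable_primeProd_rpow (K := K) hs).congr fun A => ?_)
  rw [norm_mul, norm_pow, norm_neg, norm_one, one_pow, one_mul, Real.norm_of_nonneg]
  positivity

/-- Multiplying the two absolutely convergent series and grouping by the product ideal J leaves
N(J)^(-s) times the alternating sum over sets of primes dividing J, which vanishes unless J is the
unit ideal. -/
theorem tsum_primeProd_mul_dedekindZeta {s : ℝ} (hs : 1 < s) :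
    (∑' A : Finset (HeightOneSpectrum (𝓞 K)),
      (-1 : ℝ) ^ A.card * (Ideal.absNorm (primeProd A) : ℝ) ^ (-s)) * (dedekindZeta K s).re = 1 := by
  have h1 := summable_neg_one_pow_primeProd (K := K) hs
  have h2 := summable_absNorm_rpow (K := K) hs
  have h3 := summable_mul_of_summable_norm h1.norm h2.norm
  have h4 := (h1.hasSum.mul h2.hasSum h3).tsum_fiberwise primeProdMul
  rw [tsum_absNorm_rpow hs] at h4
  rw [← h4.tsum_eq]
  have h5 : ∀ J : NonzeroIdeal K, ∑' x : primeProdMul ⁻¹' {J},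
      (-1 : ℝ) ^ x.1.1.card * (Ideal.absNorm (primeProd x.1.1) : ℝ) ^ (-s) *
        (Ideal.absNorm x.1.2.1 : ℝ) ^ (-s) = if J = ⟨⊤, top_ne_bot⟩ then 1 else 0 := by
    intro J
    have h6 : ∀ x : primeProdMul ⁻¹' {J}, (-1 : ℝ) ^ x.1.1.card *
        (Ideal.absNorm (primeProd x.1.1) : ℝ) ^ (-s) * (Ideal.absNorm x.1.2.1 : ℝ) ^ (-s) =
        (-1 : ℝ) ^ x.1.1.card * (Ideal.absNorm J.1 : ℝ) ^ (-s) := by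
      intro x
      have hx : primeProdMul x.1 = J := x.2
      have h1 : primeProd x.1.1 * x.1.2.1 = J.1 := congrArg Subtype.val hx
      rw [mul_assoc, ← Real.mul_rpow (Nat.cast_nonneg _) (Nat.cast_nonneg _), ← h1, map_mul,
        Nat.cast_mul]
    rw [tsum_congr h6, ← (fiberEquiv J).tsum_eq]
    change ∑' A : (primeDivisors J).powerset, (-1 : ℝ) ^ A.1.card * _ = _
    rw [Finset.tsum_subtype (primeDivisors J).powerset
      fun A => (-1 : ℝ) ^ A.card * (Ideal.absNorm J.1 : ℝ) ^ (-s), ← Finset.sum_mul,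
      sum_powerset_primeDivisors]
    by_cases hJ : J.1 = ⊤
    · simp [hJ, Subtype.ext_iff]
    · simp [hJ, Subtype.ext_iff]
  exact (tsum_congr h5).trans (tsum_ite_eq _ _)

/-! ### Möbius inversion from pairs to curves -/

theorem image_pairsLT_div {J : Ideal (𝓞 K)} (hJ : J ≠ ⊥) (T : ℝ) :
    (fun z : IsoClass K × Ideal (𝓞 K) => (z.1, J * z.2)) '' pairsLT K (T / Ideal.absNorm J) =
      {z ∈ pairsLT K T | J ∣ z.2} := by
  have hN := absNorm_pos hJ
  have key : ∀ (h : ℝ) (I : Ideal (𝓞 K)), h * (Ideal.absNorm I : ℝ) ^ 12 <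
      (T / Ideal.absNorm J) ^ 12 ↔ h * (Ideal.absNorm (J * I) : ℝ) ^ 12 < T ^ 12 := by
    intro h I
    rw [div_pow, lt_div_iff₀ (by positivity), map_mul, Nat.cast_mul, mul_pow, mul_assoc,
      mul_comm ((Ideal.absNorm I : ℝ) ^ 12)]
  ext ⟨E, I⟩
  constructor
  · rintro ⟨⟨E, I⟩, ⟨h1, h2⟩, h⟩
    simp only [Prod.mk.injEq] at h
    obtain ⟨rfl, rfl⟩ := h
    exact ⟨⟨mul_ne_zero hJ h1, (key _ _).1 h2⟩, dvd_mul_right _ _⟩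
  · rintro ⟨⟨h1, h2⟩, ⟨I, rfl⟩⟩
    exact ⟨(E, I), ⟨right_ne_zero_of_mul h1, (key _ _).2 h2⟩, rfl⟩

/-- Multiplying the ideal by `J` identifies the pairs of bound T/N(J) with those pairs of bound T
whose ideal is divisible by `J`; these are the counts that enter the inversion. -/
theorem ncard_pairsLT_div {J : Ideal (𝓞 K)} (hJ : J ≠ ⊥) (T : ℝ) :
    (pairsLT K (T / Ideal.absNorm J)).ncard = {z ∈ pairsLT K T | J ∣ z.2}.ncard := by
  rw [← image_pairsLT_div hJ, Set.ncard_image_of_injective]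
  rintro ⟨E, I⟩ ⟨E', I'⟩ h
  simp only [Prod.mk.injEq] at h
  exact Prod.ext h.1 (mul_left_cancel₀ hJ h.2)

theorem image_isoClassesOfHeightLT (T : ℝ) :
    (fun E : IsoClass K => (E, (⊤ : Ideal (𝓞 K)))) '' isoClassesOfHeightLT K (T ^ 12) =
      {z ∈ pairsLT K T | z.2 = ⊤} := by
  ext ⟨E, I⟩
  constructor
  · rintro ⟨E, h, h'⟩
    simp only [Prod.mk.injEq] at h'
    obtain ⟨rfl, rfl⟩ := h'
    have h1 : E.height < T ^ 12 := h
    exact ⟨⟨top_ne_bot, by simpa using h1⟩, rfl⟩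
  · rintro ⟨⟨-, h2⟩, h⟩
    simp only at h h2
    subst h
    refine ⟨E, ?_, rfl⟩
    change E.height < T ^ 12
    simpa using h2

theorem mk_top_injective : Function.Injective fun E : IsoClass K => (E, (⊤ : Ideal (𝓞 K))) :=
  fun _ _ h => congrArg Prod.fst h

theorem finite_isoClassesOfHeightLT_pow {T : ℝ} (hT : 0 < T) :
    (isoClassesOfHeightLT K (T ^ 12)).Finite := by
  refine Set.Finite.of_finite_image ?_ mk_top_injective.injOn
  rw [image_isoClassesOfHeightLT]
  exact (finite_pairsLT hT).subset (Set.sep_subset _ _)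

theorem ncard_isoClassesOfHeightLT_pow (T : ℝ) :
    (isoClassesOfHeightLT K (T ^ 12)).ncard = {z ∈ pairsLT K T | z.2 = ⊤}.ncard := by
  rw [← image_isoClassesOfHeightLT, Set.ncard_image_of_injective _ mk_top_injective]

/-- Möbius inversion for the count of elliptic curves. -/
theorem hasSum_ncard_pairsLT {T : ℝ} (hT : 0 < T) :
    HasSum (fun A : Finset (HeightOneSpectrum (𝓞 K)) =>
      (-1 : ℝ) ^ A.card * (pairsLT K (T / Ideal.absNorm (primeProd A))).ncard)
      (isoClassesOfHeightLT K (T ^ 12)).ncard := by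
  have hfin := finite_pairsLT (K := K) hT
  have hcard : ∀ P : IsoClass K × Ideal (𝓞 K) → Prop,
      ({z ∈ pairsLT K T | P z}.ncard : ℝ) = ∑ z ∈ hfin.toFinset, if P z then 1 else 0 := by
    intro P
    rw [Finset.sum_boole, Set.ncard_eq_toFinset_card _ (hfin.subset (Set.sep_subset _ _))]
    congr 2
    ext z
    simp
  have h1 : ∀ z ∈ hfin.toFinset, HasSum (fun A : Finset (HeightOneSpectrum (𝓞 K)) =>
      (-1 : ℝ) ^ A.card * if primeProd A ∣ z.2 then 1 else 0) (if z.2 = ⊤ then 1 else 0) := by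
    intro z hz
    rw [Set.Finite.mem_toFinset] at hz
    have h2 := sum_powerset_primeDivisors ⟨z.2, hz.1⟩
    rw [← h2]
    have h3 : ∑ A ∈ (primeDivisors ⟨z.2, hz.1⟩).powerset, (-1 : ℝ) ^ A.card =
        ∑ A ∈ (primeDivisors ⟨z.2, hz.1⟩).powerset,
          (-1 : ℝ) ^ A.card * if primeProd A ∣ z.2 then 1 else 0 :=
      Finset.sum_congr rfl fun A hA => by
        rw [if_pos ((primeProd_dvd_iff A ⟨z.2, hz.1⟩).2 hA), mul_one]
    rw [h3]
    -- For a fixed pair only the finitely many sets of primes dividing its ideal contribute.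
    refine hasSum_sum_of_ne_finset_zero fun A hA => ?_
    rw [if_neg (fun h => hA ((primeProd_dvd_iff A ⟨z.2, hz.1⟩).1 h)), mul_zero]
  have h4 := hasSum_sum h1
  rw [ncard_isoClassesOfHeightLT_pow, hcard]
  refine h4.congr_fun fun A => ?_
  rw [ncard_pairsLT_div (primeProd_ne_bot A), hcard, Finset.mul_sum]

variable (K) in
-- Insert the pair estimate at T/N into the inversion. The main terms give Σ ±N⁻¹⁰ = 1/ζ_K(10), and
-- the errors are dominated by a convergent series of the powers of N with minus the error exponent.
theorem exists_abs_ncard_isoClassesOfHeightLT_pow_sub_le : ∃ C : ℝ, ∀ T : ℝ, 0 < T →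
    |((isoClassesOfHeightLT K (T ^ 12)).ncard : ℝ) -
      pairConst K / (dedekindZeta K 10).re * T ^ 10| ≤ C * T ^ errorExponent K := by
  obtain ⟨C, h⟩ := exists_abs_ncard_pairsLT_sub_le K
  have hs : 1 < errorExponent K := by linarith [six_le_errorExponent (K := K)]
  have hzeta := tsum_primeProd_mul_dedekindZeta (K := K) (s := 10) (by norm_num)
  push_cast at hzeta
  have hsum := (summable_neg_one_pow_primeProd (K := K) (s := 10) (by norm_num)).hasSum
  rw [eq_div_of_mul_eq (right_ne_zero_of_mul_eq_one hzeta) hzeta] at hsum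
  have hbound := (summable_primeProd_rpow (K := K) hs).hasSum
  refine ⟨C * ∑' A : Finset (HeightOneSpectrum (𝓞 K)),
    (Ideal.absNorm (primeProd A) : ℝ) ^ (-errorExponent K), fun T hT => ?_⟩
  have h1 := (hasSum_ncard_pairsLT (K := K) hT).sub (hsum.mul_left (pairConst K * T ^ 10))
  have h2 := hbound.mul_left (C * T ^ errorExponent K)
  have h3 : ∀ A : Finset (HeightOneSpectrum (𝓞 K)),
      ‖(-1 : ℝ) ^ A.card * (pairsLT K (T / Ideal.absNorm (primeProd A))).ncard -
        pairConst K * T ^ 10 * ((-1 : ℝ) ^ A.card *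
          (Ideal.absNorm (primeProd A) : ℝ) ^ (-10 : ℝ))‖ ≤
      C * T ^ errorExponent K * (Ideal.absNorm (primeProd A) : ℝ) ^ (-errorExponent K) := by
    intro A
    have hN := absNorm_pos (primeProd_ne_bot A)
    set N := (Ideal.absNorm (primeProd A) : ℝ)
    have h4 := h (T / N) (by positivity)
    have e1 : (-1 : ℝ) ^ A.card * (pairsLT K (T / N)).ncard -
        pairConst K * T ^ 10 * ((-1 : ℝ) ^ A.card * N ^ (-10 : ℝ)) =
        (-1 : ℝ) ^ A.card * ((pairsLT K (T / N)).ncard - pairConst K * (T / N) ^ 10) := by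
      rw [Real.rpow_neg hN.le, show (10 : ℝ) = ((10 : ℕ) : ℝ) by norm_num, Real.rpow_natCast,
        div_pow]
      ring
    rw [e1, norm_mul, norm_pow, norm_neg, norm_one, one_pow, one_mul, Real.norm_eq_abs,
      Real.rpow_neg hN.le]
    rw [Real.div_rpow hT.le hN.le] at h4
    refine h4.trans_eq ?_
    ring
  have h5 := tsum_of_norm_bounded h2 h3
  rw [h1.tsum_eq, Real.norm_eq_abs] at h5
  calc _ = _ := by
        congr 2
        ring
    _ ≤ _ := h5
    _ = _ := by ring

/-! ### The leading constant and the final substitution -/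

theorem kappa_eq : kappa K = pairConst K / (dedekindZeta K 10).re := by
  have hw : (0 : ℝ) < Units.torsionOrder K := by exact_mod_cast Units.torsionOrder_pos K
  have hD : |(discr K : ℝ)| ≠ 0 := abs_ne_zero.2 (Int.cast_ne_zero.2 (discr_ne_zero K))
  have hcov : integerCovolume K ^ 2 = (4 : ℝ)⁻¹ ^ nrComplexPlaces K * |(discr K : ℝ)| := by
    rw [integerCovolume, mul_pow, Real.sq_sqrt (abs_nonneg _), ← pow_mul, mul_comm _ 2, pow_mul]
    norm_num
  -- Since -1 is a root of unity, the gcd is always 2: it is the order of the generic stabilizer.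
  have hgcd : Nat.gcd 2 (Units.torsionOrder K) = 2 :=
    Nat.gcd_eq_left (Units.even_torsionOrder K).two_dvd
  have hpow : (2 ^ (nrRealPlaces K + nrComplexPlaces K) * Real.pi ^ nrComplexPlaces K) ^ 2 =
      (2 ^ nrRealPlaces K * Real.pi ^ nrComplexPlaces K) ^ 2 * (4 : ℝ) ^ nrComplexPlaces K := by
    have h4 : (4 : ℝ) ^ nrComplexPlaces K = 2 ^ (nrComplexPlaces K * 2) := by
      rw [mul_comm, pow_mul]
      norm_num
    rw [h4, pow_add]
    ring
  rw [kappa, pairConst, hcov, hgcd, hpow, shellConst, inv_pow]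
  push_cast
  field_simp

theorem isoClassesOfHeightLT_mono {B B' : ℝ} (h : B ≤ B') :
    isoClassesOfHeightLT K B ⊆ isoClassesOfHeightLT K B' :=
  fun _ hE => lt_of_lt_of_le hE h

theorem rpow_inv_twelve_pow {B : ℝ} (hB : 0 ≤ B) : (B ^ (12 : ℝ)⁻¹) ^ 12 = B := by
  have := Real.rpow_inv_natCast_pow hB (n := 12) (by norm_num)
  simpa using this

variable (K) in
theorem finite_isoClassesOfHeightLT (B : ℝ) : (isoClassesOfHeightLT K B).Finite := by
  have h : 0 < max B 1 := lt_max_of_lt_right one_pos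
  refine Set.Finite.subset ?_ (isoClassesOfHeightLT_mono (le_max_left B 1))
  rw [← rpow_inv_twelve_pow h.le]
  exact finite_isoClassesOfHeightLT_pow (by positivity)

end EllipticCount

end

theorem mainTheorem4 (K : Type*) [Field K] [NumberField K] :
    (∀ B : ℝ, (EllipticCount.isoClassesOfHeightLT K B).Finite) ∧
    ∃ C : ℝ, ∀ B : ℝ, 1 ≤ B →
      |((EllipticCount.isoClassesOfHeightLT K B).ncard : ℝ) -
          EllipticCount.kappa K * B ^ (5 / 6 : ℝ)| ≤
        C * B ^ (5 / 6 - 1 / (3 * (Module.finrank ℚ K : ℝ)) : ℝ) := by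
  refine ⟨EllipticCount.finite_isoClassesOfHeightLT K, ?_⟩
  obtain ⟨C, h⟩ := EllipticCount.exists_abs_ncard_isoClassesOfHeightLT_pow_sub_le K
  refine ⟨C, fun B hB => ?_⟩
  have hB0 : 0 < B := by linarith
  -- T = B^(1/12) turns T¹⁰ into B^(5/6) and T^(10-4/d) into B^(5/6-1/(3d)).
  have h1 := h (B ^ (12 : ℝ)⁻¹) (by positivity)
  rw [EllipticCount.rpow_inv_twelve_pow hB0.le, ← EllipticCount.kappa_eq, ← Real.rpow_natCast,
    ← Real.rpow_mul hB0.le, ← Real.rpow_mul hB0.le, EllipticCount.errorExponent] at h1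
  have e1 : (12 : ℝ)⁻¹ * ((10 : ℕ) : ℝ) = 5 / 6 := by norm_num
  have e2 : (12 : ℝ)⁻¹ * (10 - 4 / (Module.finrank ℚ K : ℝ)) =
      5 / 6 - 1 / (3 * (Module.finrank ℚ K : ℝ)) := by
    have hd : (Module.finrank ℚ K : ℝ) ≠ 0 := by
      exact_mod_cast (Module.finrank_pos : 0 < Module.finrank ℚ K).ne'
    field_simp
    ring
  rwa [e1, e2] at h1
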